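/- Let $X$ be a totally bounded (i.e. relatively compact) metric space and $m$ a finite Radon measure on $X$ with $\operatorname{supp} m=X$. Let $\mathcal E_A$, with domain $V_{1/2}$, be a Dirichlet form on $L^2(X)=L^2(X,m)$ (densely defined, symmetric, non-negative, closed, Markovian), and let $A$ be the associated self-adjoint operator, $\mathcal E_A(h,v)=(Ah,v)$ for $h\in D(A)$, $v\in V_{1/2}$. Assume that $V_{1/2}$ embeds compactly into $L^2(X)$, that $V_{1/2}\hookrightarrow L^{2q_A}(X)$ for some real $q_A>1$, and that all eigenvalues of $A$ are strictly positive. With an orthonormal basis of eigenvectors $A\varphi_n=\lambda_n\varphi_n$, put $\|h\|_{V_s}^2=\sum_n\lambda_n^{2s}|(h,\varphi_n)|^2$; $V_s=D(A^s)$ is the space where this is finite, and $V_{-s}$ is the dual of $V_s$ (for $s\ge 0$). Let $1<\alpha<2$, $\gamma=1/\alpha$ and $\theta_A=\frac{q_A}{2(q_A-1)}$. Let $f\in C^1(\mathbb R)$ with $f(0)=0$ and $|f'(s)|\le C|s|^{r-1}$ for all $s\in\mathbb R$ and some $C>0$, where one of the following holds. - Case (i): $q_A>2$, $\alpha\in[\alpha_0,2)$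 with $\alpha_0=1/\theta_A$; $r\in(1,\infty)$ is arbitrary if $\alpha=\alpha_0$, and $r=\frac{\theta_A\alpha}{\theta_A\alpha-1}$ if $\alpha>\alpha_0$. - Case (ii): $1<q_A\le 2$ and $r=\frac{\theta_A\alpha}{\theta_A\alpha-1}$. Let $1\le p<\frac1{2-\alpha}$ and $\frac1p+\frac1q=1$ (so $\frac1{\alpha-1}<q\le\infty$). For $y$ continuously differentiable on $[0,T]$, $\mathbb D_t^\alpha y$ denotes the second derivative, in the sense of distributions on $(0,T)$, of $t\mapsto\frac1{\Gamma(2-\alpha)}\int_0^t(t-s)^{1-\alpha}\big(y(s)-y(0)-s\,y'(0)\big)\,ds$. For $T>0$, a weak solution on $[0,T]$ of $$\mathbb D_t^\alpha u+Au=f(u),\qquad u(0)=u_0,\quad \partial_tu(0)=u_1,$$ is a function $u\in C([0,T];V_\gamma)\cap C^1([0,T];L^2(X))$ with $u\in L^{\rho q}((0,T);L^{2\rho}(X))$ for some $\rho>1$ and $\mathbb D_t^\alpha u\in C([0,T];V_{-\gamma})+L^q((0,T);L^2(X))$, such that $u(0)=u_0$ and $\partial_tu(0)=u_1$; $\|u(t)-u_0\|_{V_\sigma}\to0$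 and $\|\partial_tu(t)-u_1\|_{V_{-\beta}}\to0$ as $t\to0^+$ for some $0\le\sigma<\frac1\alpha$ and $0<\beta\le1-\frac1\alpha$; and, for every $\varphi\in V_\gamma$ and a.e. $t\in(0,T)$, $$\langle\mathbb D_t^\alpha u(t),\varphi\rangle_{V_{-\gamma},V_\gamma}+\mathcal E_A(u(t),\varphi)=(f(u(t)),\varphi).$$ **Theorem.** Let $u$ be a weak solution on $[0,T]$ with $\|u\|_{L^{q(r-1)}((0,T);L^\infty(X))}<\infty$. Then $u$ is a strong solution on $[0,T]$: it is a weak solution, $\mathbb D_t^\alpha u\in L^1((0,T);L^2(X))$, $u\in L^1((0,T);D(A))$, and $\mathbb D_t^\alpha u+Au=f(u)$ holds a.e. in $X\times(0,T)$. -/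

import Mathlib

open MeasureTheory Set Filter Topology
open scoped ENNReal ContDiff

noncomputable section

/-- A Dirichlet form on `L²(X, m)`: a densely defined, symmetric, non-negative, closed bilinear form
with the Markov property. -/
structure DirichletForm {X : Type*} [MeasurableSpace X] (m : Measure X) where
  /-- the form domain `V_{1/2}` -/
  domain : Submodule ℝ (Lp ℝ 2 m)
  /-- the bilinear form `𝓔_A` -/
  form : domain →ₗ[ℝ] domain →ₗ[ℝ] ℝ
  dense_domain : Dense (domain : Set (Lp ℝ 2 m))
  symm : ∀ u v : domain, form u v = form v u
  nonneg : ∀ u : domain, 0 ≤ form u u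
  closed : ∀ l : ℝ, 0 < l → ∀ u : ℕ → domain,
    (∀ ε : ℝ, 0 < ε → ∃ N : ℕ, ∀ j ≥ N, ∀ k ≥ N,
      form (u j - u k) (u j - u k) + l * ‖((u j - u k : domain) : Lp ℝ 2 m)‖ ^ 2 < ε) →
    ∃ v : domain, Tendsto
      (fun j => form (u j - v) (u j - v) + l * ‖((u j - v : domain) : Lp ℝ 2 m)‖ ^ 2) atTop (𝓝 0)
  markov : ∀ ε : ℝ, 0 < ε → ∃ φ : ℝ → ℝ, ContDiff ℝ ∞ φ ∧ (∀ t ∈ Icc (0 : ℝ) 1, φ t = t) ∧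
    (∀ t, -ε ≤ φ t ∧ φ t ≤ 1 + ε) ∧ (∀ τ t, τ < t → 0 ≤ φ t - φ τ ∧ φ t - φ τ ≤ t - τ) ∧
    ∀ u : domain, ∃ v : domain,
      ((v : Lp ℝ 2 m) : X → ℝ) =ᵐ[m] (fun x => φ ((u : Lp ℝ 2 m) x)) ∧ form v v ≤ form u u

namespace DirichletForm

variable {X : Type*} [MeasurableSpace X] {m : Measure X} (E : DirichletForm m)

/-- An element of `L²` is determined by its inner products with the form domain. -/
theorem eq_of_inner_domain {g g' : Lp ℝ 2 m}
    (h : ∀ v : E.domain, inner ℝ g (v : Lp ℝ 2 m) = inner ℝ g' (v : Lp ℝ 2 m)) : g = g' :=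
  E.dense_domain.eq_of_inner_left ℝ fun v hv => h ⟨v, hv⟩

/-- The operator domain `D(A)`: those `h ∈ V_{1/2}` for which there is `g ∈ L²` with
`𝓔_A(h, v) = (g, v)` for all `v ∈ V_{1/2}`. -/
def opDomain : Submodule ℝ (Lp ℝ 2 m) where
  carrier := {h | ∃ (hh : h ∈ E.domain) (g : Lp ℝ 2 m),
    ∀ v : E.domain, E.form ⟨h, hh⟩ v = inner ℝ g (v : Lp ℝ 2 m)}
  zero_mem' := ⟨E.domain.zero_mem, 0, fun v => by
    have h0 : (⟨0, E.domain.zero_mem⟩ : E.domain) = 0 := rfl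
    rw [h0]; simp⟩
  add_mem' := by
    rintro a b ⟨ha, g, hg⟩ ⟨hb, g', hg'⟩
    refine ⟨E.domain.add_mem ha hb, g + g', fun v => ?_⟩
    have h0 : (⟨a + b, E.domain.add_mem ha hb⟩ : E.domain) = ⟨a, ha⟩ + ⟨b, hb⟩ := rfl
    rw [h0, map_add, LinearMap.add_apply, hg, hg', inner_add_left]
  smul_mem' := by
    rintro c a ⟨ha, g, hg⟩
    refine ⟨E.domain.smul_mem c ha, c • g, fun v => ?_⟩
    have h0 : (⟨c • a, E.domain.smul_mem c ha⟩ : E.domain) = c • ⟨a, ha⟩ := rfl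
    rw [h0, map_smul, LinearMap.smul_apply, hg, real_inner_smul_left, smul_eq_mul]

theorem opDomain_le (h : E.opDomain) : (h : Lp ℝ 2 m) ∈ E.domain := h.2.1

/-- The value `A h` for `h ∈ D(A)`. -/
def opFun (h : E.opDomain) : Lp ℝ 2 m := Classical.choose h.2.2

theorem form_eq_inner_opFun (h : E.opDomain) (v : E.domain) :
    E.form ⟨h, E.opDomain_le h⟩ v = inner ℝ (E.opFun h) (v : Lp ℝ 2 m) :=
  Classical.choose_spec h.2.2 v

/-- The self-adjoint operator `A` associated with the form: `𝓔_A(u, v) = (A u, v)` for `u ∈ D(A)`,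
`v ∈ V_{1/2}`. -/
def op : Lp ℝ 2 m →ₗ.[ℝ] Lp ℝ 2 m where
  domain := E.opDomain
  toFun :=
    { toFun := E.opFun
      map_add' := fun a b => E.eq_of_inner_domain fun v => by
        rw [inner_add_left, ← form_eq_inner_opFun, ← form_eq_inner_opFun, ← form_eq_inner_opFun,
          ← LinearMap.add_apply, ← map_add]
        rfl
      map_smul' := fun c a => E.eq_of_inner_domain fun v => by
        rw [RingHom.id_apply, real_inner_smul_left, ← form_eq_inner_opFun, ← form_eq_inner_opFun,
          ← smul_eq_mul, ← LinearMap.smul_apply, ← map_smul]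
        rfl }

/-- The eigenspace `{h ∈ D(A) : A h = l h}`. -/
def eigenspace (l : ℝ) : Submodule ℝ (Lp ℝ 2 m) where
  carrier := {h | ∃ hh : h ∈ E.op.domain, E.op ⟨h, hh⟩ = l • h}
  zero_mem' := ⟨E.op.domain.zero_mem, by
    have h0 : (⟨0, E.op.domain.zero_mem⟩ : E.op.domain) = 0 := rfl
    rw [h0, LinearPMap.map_zero, smul_zero]⟩
  add_mem' := by
    rintro a b ⟨ha, ha'⟩ ⟨hb, hb'⟩
    refine ⟨E.op.domain.add_mem ha hb, ?_⟩
    have h0 : (⟨a + b, E.op.domain.add_mem ha hb⟩ : E.op.domain) = ⟨a, ha⟩ + ⟨b, hb⟩ := rfl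
    rw [h0, LinearPMap.map_add, ha', hb', smul_add]
  smul_mem' := by
    rintro c a ⟨ha, ha'⟩
    refine ⟨E.op.domain.smul_mem c ha, ?_⟩
    have h0 : (⟨c • a, E.op.domain.smul_mem c ha⟩ : E.op.domain) = c • ⟨a, ha⟩ := rfl
    rw [h0, LinearPMap.map_smul, ha', smul_comm]

/-- The orthogonal projection of `L²` onto the eigenspace of `l`
(eigenspaces of `A` are closed, so the closure changes nothing). -/
def eigenProj (l : ℝ) : Lp ℝ 2 m →L[ℝ] Lp ℝ 2 m :=
  (E.eigenspace l).topologicalClosure.starProjection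

/-- The spectral components `l ^ s P_l h` of `A ^ s h`, indexed by `l`; only eigenvalues contribute.
With an orthonormal basis of eigenvectors `φₙ`, `A φₙ = λₙ φₙ`, one has
`∑ₗ ‖l ^ s P_l h‖² = ∑ₙ |(h, φₙ)|² λₙ ^ (2 s)`. -/
def spec (s : ℝ) : Lp ℝ 2 m →ₗ[ℝ] (ℝ → Lp ℝ 2 m) where
  toFun h l := l ^ s • E.eigenProj l h
  map_add' a b := by funext l; simp
  map_smul' c a := by
    funext l
    simp only [map_smul, RingHom.id_apply, Pi.smul_apply]
    rw [smul_comm]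

/-- `V_s = D(A ^ s)` as a subspace of `L²`, for `s ≥ 0`. For `s < 0` these are the elements of `L²`
that lie in `V_s` (all of `L²` when the eigenvalues are bounded below by a positive constant). -/
def powDomain (s : ℝ) : Submodule ℝ (Lp ℝ 2 m) where
  carrier := {h | Memℓp (E.spec s h) 2}
  zero_mem' := by
    rw [mem_ofPred_eq, map_zero]
    exact zero_memℓp
  add_mem' := by
    intro a b ha hb
    rw [mem_ofPred_eq] at ha hb ⊢
    rw [map_add]
    exact ha.add hb
  smul_mem' := by
    intro c a ha
    rw [mem_ofPred_eq] at ha ⊢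
    rw [map_smul]
    exact ha.const_smul c

/-- The space `V_s` carrying its own norm `‖h‖ = (∑ₗ ‖l ^ s P_l h‖²) ^ (1/2)`. -/
def VSpace (s : ℝ) : Type _ := E.powDomain s

instance (s : ℝ) : AddCommGroup (E.VSpace s) :=
  inferInstanceAs (AddCommGroup (E.powDomain s))

instance (s : ℝ) : Module ℝ (E.VSpace s) :=
  inferInstanceAs (Module ℝ (E.powDomain s))

/-- The inclusion `V_s ⊆ L²`. -/
def VSpace.toL2 (s : ℝ) : E.VSpace s →ₗ[ℝ] Lp ℝ 2 m := (E.powDomain s).subtype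

/-- `h ↦ (l ^ s P_l h)_l` as a map into `ℓ²`. -/
def VSpace.toSeq (s : ℝ) : E.VSpace s →ₗ[ℝ] lp (fun _ : ℝ => Lp ℝ 2 m) 2 where
  toFun h := ⟨E.spec s (VSpace.toL2 E s h), h.2⟩
  map_add' a b := by
    apply Subtype.ext
    rw [lp.coeFn_add]
    simp only [map_add]
    rfl
  map_smul' c a := by
    apply Subtype.ext
    rw [lp.coeFn_smul]
    simp only [map_smul, RingHom.id_apply]
    rfl

instance (s : ℝ) : SeminormedAddCommGroup (E.VSpace s) :=
  SeminormedAddCommGroup.induced _ _ (VSpace.toSeq E s)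

instance (s : ℝ) : NormedSpace ℝ (E.VSpace s) :=
  NormedSpace.induced ℝ (E.VSpace s) _ (VSpace.toSeq E s)

/-- The standing assumptions on `A`: compact embedding `V_{1/2} ⊂ L²(X)`, Sobolev embedding
`V_{1/2} ⊂ L^{2 q_A}(X)`, and strictly positive eigenvalues. -/
structure StandingAssumptions (qA : ℝ) : Prop where
  one_lt : 1 < qA
  compact_embedding : IsCompact (closure
    {h : Lp ℝ 2 m | ∃ hh : h ∈ E.domain, E.form ⟨h, hh⟩ ⟨h, hh⟩ + ‖h‖ ^ 2 ≤ 1})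
  sobolev : ∃ C : ℝ, 0 < C ∧ ∀ u : E.domain,
    eLpNorm ((u : Lp ℝ 2 m) : X → ℝ) (ENNReal.ofReal (2 * qA)) m ≤
      ENNReal.ofReal (C * √(E.form u u + ‖(u : Lp ℝ 2 m)‖ ^ 2))
  eigenvalue_pos : ∀ l : ℝ, E.eigenspace l ≠ ⊥ → 0 < l

end DirichletForm

/-- `z` is the fractional derivative `𝔻_t^α y` on `(0, T)` of the function `y` (differentiable at
`0`), i.e. the second derivative, in the sense of distributions on `(0, T)`, of
`t ↦ 1/Γ(2-α) ∫₀ᵗ (t-s)^{1-α} (y(s) - y(0) - s y'(0)) ds`. -/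
def HasFracDeriv {F : Type*} [NormedAddCommGroup F] [NormedSpace ℝ F] (α T : ℝ)
    (y z : ℝ → F) : Prop :=
  IntegrableOn z (Ioo 0 T) ∧
  ∀ η : ℝ → ℝ, ContDiff ℝ ∞ η → HasCompactSupport η → tsupport η ⊆ Ioo 0 T →
    ∫ t in Ioo 0 T, deriv (deriv η) t •
        ((Real.Gamma (2 - α))⁻¹ • ∫ s in Ioo 0 t,
          (t - s) ^ (1 - α) • (y s - y 0 - s • derivWithin y (Icc 0 T) 0))
      = ∫ t in Ioo 0 T, η t • z t

/-- The norm of `u` in `L^a((0, T); L^b(X))`. -/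
def mixedNorm {X : Type*} [MeasurableSpace X] {m : Measure X} (a b : ℝ≥0∞) (T : ℝ)
    (u : ℝ → Lp ℝ 2 m) : ℝ≥0∞ :=
  eLpNorm (fun t => eLpNorm (u t) b m) a (volume.restrict (Ioo 0 T))

namespace DirichletForm

variable {X : Type*} [MeasurableSpace X] {m : Measure X} (E : DirichletForm m)

/-- `u ∈ C([0, T]; V_s)`. -/
def ContinuousInto (s T : ℝ) (u : ℝ → Lp ℝ 2 m) : Prop :=
  ∃ v : ℝ → E.VSpace s, ContinuousOn v (Icc 0 T) ∧ ∀ t ∈ Icc 0 T, VSpace.toL2 E s (v t) = u t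

/-- `‖g(t) - g₀‖_{V_s} → 0` as `t → 0⁺`. -/
def TendstoAtZero (s : ℝ) (g : ℝ → Lp ℝ 2 m) (g₀ : Lp ℝ 2 m) : Prop :=
  ∃ v : ℝ → E.VSpace s, (∀ᶠ t in 𝓝[>] (0 : ℝ), VSpace.toL2 E s (v t) = g t - g₀) ∧
    Tendsto (fun t => ‖v t‖) (𝓝[>] 0) (𝓝 0)

/-- `u` is a (locally defined) weak solution on `(0, T)` of `𝔻_t^α u + A u = f(u)`, `u(0) = u₀`,
`∂_t u(0) = u₁`, in the critical and supercritical cases, with integrability exponent `q` in time.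
With `γ = 1/α`, the `V_{-γ}`-valued function `𝔻_t^α u` is given by its two parts
`d₁ ∈ C([0, T]; V_{-γ})` and `d₂ ∈ L^q((0, T); L²(X))`; here `V_{-γ}` is the dual of `V_γ`. -/
structure IsWeakSolution (α : ℝ) (q : ℝ≥0∞) (f : ℝ → ℝ) (u₀ u₁ : Lp ℝ 2 m) (T : ℝ)
    (u : ℝ → Lp ℝ 2 m) : Prop where
  continuousInto : E.ContinuousInto (1 / α) T u
  contDiffOn : ContDiffOn ℝ 1 u (Icc 0 T)
  mixed_integrability : ∃ ρ : ℝ, 1 < ρ ∧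
    mixedNorm (ENNReal.ofReal ρ * q) (ENNReal.ofReal (2 * ρ)) T u < ⊤
  initial_value : u 0 = u₀
  initial_deriv : derivWithin u (Icc 0 T) 0 = u₁
  initial_limits : ∃ σ β : ℝ, 0 ≤ σ ∧ σ < 1 / α ∧ 0 < β ∧ β ≤ 1 - 1 / α ∧
    E.TendstoAtZero σ u u₀ ∧ E.TendstoAtZero (-β) (derivWithin u (Icc 0 T)) u₁
  equation : ∃ (d₁ : ℝ → StrongDual ℝ (E.VSpace (1 / α))) (d₂ : ℝ → Lp ℝ 2 m),
    ContinuousOn d₁ (Icc 0 T) ∧ MemLp d₂ q (volume.restrict (Ioo 0 T)) ∧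
    ∀ φ : E.VSpace (1 / α),
      HasFracDeriv α T (fun t => inner ℝ (u t) (VSpace.toL2 E (1 / α) φ))
        (fun t => d₁ t φ + inner ℝ (d₂ t) (VSpace.toL2 E (1 / α) φ)) ∧
      ∀ᵐ t ∂(volume.restrict (Ioo 0 T)),
        ∃ (hu : u t ∈ E.domain) (hφ : VSpace.toL2 E (1 / α) φ ∈ E.domain),
          d₁ t φ + inner ℝ (d₂ t) (VSpace.toL2 E (1 / α) φ) + E.form ⟨u t, hu⟩ ⟨_, hφ⟩ =
            ∫ x, f (u t x) * VSpace.toL2 E (1 / α) φ x ∂m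

/-- `u` is a strong solution on `(0, T)`: a weak solution with `𝔻_t^α u ∈ L¹((0, T); L²(X))` and
`u ∈ L¹((0, T); D(A))`; the equation then holds pointwise a.e. in `X × (0, T)`. Here `d` is
`𝔻_t^α u` and `w` is `A u`. -/
def IsStrongSolution (α : ℝ) (q : ℝ≥0∞) (f : ℝ → ℝ) (u₀ u₁ : Lp ℝ 2 m) (T : ℝ)
    (u : ℝ → Lp ℝ 2 m) : Prop :=
  E.IsWeakSolution α q f u₀ u₁ T u ∧
  ∃ d w : ℝ → Lp ℝ 2 m,
    (HasFracDeriv α T u d ∧ IntegrableOn d (Ioo 0 T)) ∧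
    (IntegrableOn w (Ioo 0 T) ∧
      ∀ᵐ t ∂(volume.restrict (Ioo 0 T)), ∃ ht : u t ∈ E.op.domain, E.op ⟨u t, ht⟩ = w t) ∧
    ∀ᵐ t ∂(volume.restrict (Ioo 0 T)), ∀ᵐ x ∂m, d t x + w t x = f (u t x)

end DirichletForm

/-- `θ_A = q_A / (2 (q_A - 1))`. -/
def thetaA (qA : ℝ) : ℝ := qA / (2 * (qA - 1))

/-- The relation between `q_A`, `α` and the growth exponent `r` in the critical and supercritical
range: Case (i) `q_A > 2`, `α ∈ [α₀, 2)` with `α₀ = 1 / θ_A`, where `r > 1` is arbitrary if `α = α₀`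
and `r = θ_A α / (θ_A α - 1)` if `α > α₀`; or Case (ii) `1 < q_A ≤ 2`, `α ∈ (1, 2)`, with
`r = θ_A α / (θ_A α - 1)`. -/
def IsCriticalGrowth (qA α r : ℝ) : Prop :=
  (2 < qA ∧ α < 2 ∧
    ((α = 1 / thetaA qA ∧ 1 < r) ∨
      (1 / thetaA qA < α ∧ r = thetaA qA * α / (thetaA qA * α - 1)))) ∨
  (1 < qA ∧ qA ≤ 2 ∧ 1 < α ∧ α < 2 ∧ r = thetaA qA * α / (thetaA qA * α - 1))

/-- The growth condition on `f ∈ C¹(ℝ)` with exponent `r`. -/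
def HasGrowth (f : ℝ → ℝ) (r : ℝ) : Prop :=
  ContDiff ℝ 1 f ∧ f 0 = 0 ∧ ∃ C : ℝ, 0 < C ∧ ∀ s : ℝ, |deriv f s| ≤ C * |s| ^ (r - 1)

end

/-! Write F(t) = f(u(t)). The point is that F has one derivative in time in an L¹ sense. Indeed u is
C¹, hence Lipschitz, with values in L²(X), and the growth of f gives ‖F(t) − F(s)‖ ≤ (b(t) + b(s))
|t − s|, where b is a multiple of ‖u(t)‖_∞^(r−1). This weight is integrable because u ∈
L^{q(r−1)}(0,T; L^∞) and q ≥ 1 (`exists_weight_nemytskii`). Hence ∫ ‖F(s+h) − F(s)‖ ds ≤ A h, and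
this in turn forces ∫₀ʰ ‖F‖ ≤ M h (`integral_norm_shift_sub_le`, `integral_norm_le_of_shift`).

Pairing u with an eigenvector φ of eigenvalue l gives y = (u, φ) with 𝔻^α y + l y = (F, φ). Its
solution by Mittag-Leffler kernels is used in the form l y(t) = d/dt (N_l * (F, φ))(t) + l y(0)
E_α(−l t^α) + l y'(0) t E_{α,2}(−l t^α), with N_l(t) = 1 − E_α(−l t^α)
(`hasDerivAt_causalConv_mlKernel`). The kernels N_l are bounded uniformly in l. Letting the time
derivative fall on F rather than on N_l, whose derivative is only O(1/t) uniformly in l, bounds the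
first term by a constant (`abs_deriv_integral_inner_le`). For the data, u(0) ∈ V_{1/α} and ∂ₜu(0) ∈
L² together with l^(1−1/α) |E_α(−l t^α)| ≲ t^(1−α) and l t |E_{α,2}(−l t^α)| ≲ t^(1−α) give
O(t^(1−α)). Duality against finite sums of eigenvectors then yields u(t) ∈ D(A) and ‖A u(t)‖ ≤ C₁
t^(1−α) + C₂ (`exists_op_bound`), which is integrable since α < 2. Finally 𝔻^α u is identified with
F − Au by testing on eigenvectors, which are total because the resolvent is compact.

The uniform kernel bounds (`exists_mlKernel_bounds`) reduce to l = 1 by scaling and come from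
Laplace inversion on the line Re s = 1/t after one integration by parts. -/

noncomputable section

/-! ### Riemann–Liouville kernels -/

/-- The Riemann–Liouville kernel `t ^ (β - 1) / Γ(β)` on the positive half line. -/
def rlKernel (β t : ℝ) : ℝ := if 0 < t then t ^ (β - 1) / Real.Gamma β else 0

theorem rlKernel_of_pos {β t : ℝ} (ht : 0 < t) :
    rlKernel β t = t ^ (β - 1) / Real.Gamma β := if_pos ht

theorem rlKernel_of_nonpos {β t : ℝ} (ht : t ≤ 0) : rlKernel β t = 0 := if_neg ht.not_gt

theorem rlKernel_nonneg {β : ℝ} (hβ : 0 < β) (t : ℝ) : 0 ≤ rlKernel β t := by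
  unfold rlKernel
  split_ifs with h
  · exact div_nonneg (Real.rpow_nonneg h.le _) (Real.Gamma_pos_of_pos hβ).le
  · exact le_rfl

theorem rlKernel_one {t : ℝ} (ht : 0 < t) : rlKernel 1 t = 1 := by
  simp [rlKernel_of_pos ht]

theorem rlKernel_two {t : ℝ} (ht : 0 < t) : rlKernel 2 t = t := by
  rw [rlKernel_of_pos ht]
  norm_num

theorem integrableOn_rlKernel {β : ℝ} (hβ : 0 < β) (t : ℝ) :
    IntegrableOn (rlKernel β) (Ioo 0 t) := by
  rcases le_or_gt t 0 with h | h
  · simp [Ioo_eq_empty_of_le h]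
  have h1 : IntegrableOn (fun s : ℝ => s ^ (β - 1) / Real.Gamma β) (Ioo 0 t) :=
    ((intervalIntegral.integrableOn_Ioo_rpow_iff h).2 (by linarith)).div_const _
  exact h1.congr_fun (fun s hs => (rlKernel_of_pos hs.1).symm) measurableSet_Ioo

theorem rlKernel_le_of_le {β s t : ℝ} (hβ : 1 ≤ β) (hst : s ≤ t) :
    rlKernel β s ≤ rlKernel β t := by
  rcases le_or_gt s 0 with h | h
  · rw [rlKernel_of_nonpos h]
    exact rlKernel_nonneg (by linarith) t
  · rw [rlKernel_of_pos h, rlKernel_of_pos (h.trans_le hst)]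
    have := Real.Gamma_pos_of_pos (show 0 < β by linarith)
    have := Real.rpow_le_rpow h.le hst (show 0 ≤ β - 1 by linarith)
    gcongr

theorem continuous_rlKernel {β : ℝ} (hβ : 1 < β) : Continuous (rlKernel β) := by
  have h : rlKernel β = fun t : ℝ => (max t 0) ^ (β - 1) / Real.Gamma β := by
    funext t
    rcases le_or_gt t 0 with h | h
    · rw [rlKernel_of_nonpos h, max_eq_right h, Real.zero_rpow (by linarith), zero_div]
    · rw [rlKernel_of_pos h, max_eq_left h.le]
  rw [h]
  exact ((continuous_id.max continuous_const).rpow_const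
    (fun _ => Or.inr (by linarith))).div_const _

/-! ### Causal convolution -/

/-- Convolution over `(0, t)` of a scalar kernel with a vector-valued function. -/
def causalConv {F : Type*} [NormedAddCommGroup F] [NormedSpace ℝ F] (f : ℝ → ℝ) (g : ℝ → F)
    (t : ℝ) : F := ∫ s in Ioo 0 t, f (t - s) • g s

section CausalConv

variable {F : Type*} [NormedAddCommGroup F] [NormedSpace ℝ F]

theorem causalConv_of_nonpos (f : ℝ → ℝ) (g : ℝ → F) {t : ℝ} (ht : t ≤ 0) :
    causalConv f g t = 0 := by
  simp [causalConv, Ioo_eq_empty_of_le ht]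

theorem causalConv_congr {f f' : ℝ → ℝ} {g g' : ℝ → F} {t : ℝ} (hf : EqOn f f' (Ioo 0 t))
    (hg : EqOn g g' (Ioo 0 t)) : causalConv f g t = causalConv f' g' t := by
  refine setIntegral_congr_fun measurableSet_Ioo fun s hs => ?_
  rw [hf ⟨by linarith [hs.2], by linarith [hs.1]⟩, hg hs]

theorem causalConv_congr_ae {f : ℝ → ℝ} {g g' : ℝ → F} {t T : ℝ} (htT : t ≤ T)
    (hg : ∀ᵐ s ∂(volume.restrict (Ioo 0 T)), g s = g' s) :
    causalConv f g t = causalConv f g' t := by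
  refine integral_congr_ae ?_
  have := ae_mono (Measure.restrict_mono (Ioo_subset_Ioo_right htT) le_rfl) hg
  filter_upwards [this] with s hs
  rw [hs]

theorem causalConv_comm (f g : ℝ → ℝ) (t : ℝ) : causalConv f g t = causalConv g f t := by
  rcases le_or_gt t 0 with h | h
  · rw [causalConv_of_nonpos _ _ h, causalConv_of_nonpos _ _ h]
  simp only [causalConv, smul_eq_mul]
  rw [← integral_Ioc_eq_integral_Ioo, ← integral_Ioc_eq_integral_Ioo,
    ← intervalIntegral.integral_of_le h.le, ← intervalIntegral.integral_of_le h.le]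
  have := intervalIntegral.integral_comp_sub_left (fun s => f (t - s) * g s) t (a := 0) (b := t)
  simp only [sub_zero, sub_self, sub_sub_cancel] at this
  rw [← this]
  exact intervalIntegral.integral_congr fun s _ => mul_comm _ _

/-- Bridge to convolution on the whole line: cutting `f` to (0, T) and letting the second factor
vanish on the negative axis confines the integrand to (0, t). The freedom in `k` allows either a
continuous extension of `g` or an indicator. -/
theorem causalConv_eq_convolution {f : ℝ → ℝ} {g k : ℝ → F} {T t : ℝ} (htT : t ≤ T)
    (hk : EqOn k g (Ioo 0 t)) (hk0 : ∀ s ≤ 0, k s = 0) :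
    convolution ((Ioo 0 T).indicator f) k (ContinuousLinearMap.lsmul ℝ ℝ) volume t
      = causalConv f g t := by
  rw [convolution_eq_swap, causalConv, ← integral_indicator measurableSet_Ioo]
  congr 1
  funext s
  simp only [ContinuousLinearMap.lsmul_apply]
  by_cases hs : s ∈ Ioo 0 t
  · have hs' : t - s ∈ Ioo 0 T := ⟨by linarith [hs.2], by linarith [hs.1]⟩
    rw [indicator_of_mem hs, indicator_of_mem hs', hk hs]
  · rw [indicator_of_notMem hs]
    rcases le_or_gt s 0 with h | h
    · rw [hk0 s h, smul_zero]
    · rw [indicator_of_notMem, zero_smul]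
      exact fun h' => hs ⟨h, by linarith [h'.1]⟩

/-- Extending `g` constantly past both endpoints gives a bounded continuous function, and `g 0 = 0`
makes this extension vanish on the negative axis; integrable times bounded continuous then convolves
to a continuous function. -/
theorem continuousOn_causalConv {f : ℝ → ℝ} {g : ℝ → F} {T : ℝ} (hT : 0 < T)
    (hf : IntegrableOn f (Ioo 0 T)) (hg : ContinuousOn g (Icc 0 T)) (hg0 : g 0 = 0) :
    ContinuousOn (causalConv f g) (Icc 0 T) := by
  set k : ℝ → F := IccExtend hT.le ((Icc 0 T).domRestrict g) with hk
  have hkc : Continuous k := (continuousOn_iff_continuous_domRestrict.1 hg).Icc_extend'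
  have hkg : ∀ s ∈ Icc 0 T, k s = g s := fun s hs => by
    rw [hk, IccExtend_of_mem _ _ hs]
    rfl
  have hk0 : ∀ s ≤ 0, k s = 0 := fun s hs => by
    rw [hk, IccExtend_of_le_left _ _ hs]
    exact hg0
  have hkb : BddAbove (range fun x => ‖k x‖) := by
    obtain ⟨C, hC⟩ := isCompact_Icc.exists_bound_of_continuousOn hg
    refine ⟨C, ?_⟩
    rintro _ ⟨x, rfl⟩
    exact hC _ (projIcc 0 T hT.le x).2
  have := (BddAbove.continuous_convolution_right_of_integrable
    (ContinuousLinearMap.lsmul ℝ ℝ : ℝ →L[ℝ] F →L[ℝ] F) hkb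
    (hf.integrable_indicator measurableSet_Ioo) hkc)
  refine this.continuousOn.congr fun t ht => ?_
  rw [causalConv_eq_convolution (g := g) ht.2
    (fun s hs => hkg s ⟨hs.1.le, hs.2.le.trans ht.2⟩) hk0]

/-- Fubini. Boundedness of `f` secures absolute convergence of the triple convolution at every `t`;
integrability of the three factors alone would give it only almost everywhere. -/
theorem causalConv_assoc {f g h : ℝ → ℝ} {t C : ℝ}
    (hf : IntegrableOn f (Ioo 0 t)) (hg : IntegrableOn g (Ioo 0 t))
    (hh : IntegrableOn h (Ioo 0 t)) (hC : ∀ s ∈ Ioo 0 t, |f s| ≤ C) :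
    causalConv f (causalConv g h) t = causalConv (causalConv f g) h t := by
  rcases le_or_gt t 0 with h0 | h0
  · rw [causalConv_of_nonpos _ _ h0, causalConv_of_nonpos _ _ h0]
  have hf' := hf.integrable_indicator measurableSet_Ioo
  have hg' := hg.integrable_indicator measurableSet_Ioo
  have hh' := hh.integrable_indicator measurableSet_Ioo
  have key := convolution_assoc (μ := volume) (ν := volume) (x₀ := t)
    (ContinuousLinearMap.lsmul ℝ ℝ : ℝ →L[ℝ] ℝ →L[ℝ] ℝ) (ContinuousLinearMap.lsmul ℝ ℝ)
    (ContinuousLinearMap.lsmul ℝ ℝ) (ContinuousLinearMap.lsmul ℝ ℝ)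
    (fun x y z => by simp [mul_assoc])
    hf'.aestronglyMeasurable hg'.aestronglyMeasurable hh'.aestronglyMeasurable
    (hf'.ae_convolution_exists _ hg') (hg'.norm.ae_convolution_exists _ hh'.norm) (by
      have hi := hg'.norm.integrable_convolution (ContinuousLinearMap.mul ℝ ℝ) hh'.norm
      rw [convolutionExistsAt_iff_integrable_swap]
      simp only [ContinuousLinearMap.mul_apply']
      refine hi.bdd_mul (c := max C 0) ?_ (Eventually.of_forall fun s => ?_)
      · exact hf'.aestronglyMeasurable.norm.comp_quasiMeasurePreserving
          (quasiMeasurePreserving_sub_left_of_right_invariant volume t)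
      · rw [norm_norm]
        by_cases hs : t - s ∈ Ioo 0 t
        · rw [indicator_of_mem hs]
          exact (hC _ hs).trans (le_max_left _ _)
        · rw [indicator_of_notMem hs, norm_zero]
          exact le_max_right _ _)
  rw [causalConv_eq_convolution (g := causalConv g h) le_rfl (fun s hs => ?_) (fun s hs => ?_)]
    at key
  · rw [← key, convolution_eq_swap, causalConv, ← integral_indicator measurableSet_Ioo]
    congr 1
    funext s
    simp only [ContinuousLinearMap.lsmul_apply]
    by_cases hs : s ∈ Ioo 0 t
    · rw [indicator_of_mem hs, indicator_of_mem hs]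
      rw [causalConv_eq_convolution (g := g) (by linarith [hs.1])
        (fun r hr => indicator_of_mem (show r ∈ Ioo 0 t from ⟨hr.1, by linarith [hr.2, hs.1]⟩) _)
        (fun r hr => indicator_of_notMem (fun (h : r ∈ Ioo 0 t) => absurd h.1 hr.not_gt) _)]
    · rw [indicator_of_notMem hs, indicator_of_notMem hs, smul_zero]
  · exact causalConv_eq_convolution hs.2.le
      (fun r hr => indicator_of_mem (show r ∈ Ioo 0 t from ⟨hr.1, hr.2.trans hs.2⟩) _)
      (fun r hr => indicator_of_notMem (fun (h : r ∈ Ioo 0 t) => absurd h.1 hr.not_gt) _)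
  · rw [causalConv_eq_convolution (g := h) (by linarith)
      (fun r hr => absurd (hr.1.trans hr.2) (by linarith)) 
      (fun r hr => indicator_of_notMem (fun (h : r ∈ Ioo 0 t) => absurd h.1 hr.not_gt) _),
      causalConv_of_nonpos _ _ hs]

end CausalConv

/-- The Beta integral B(ν, μ) = Γ(ν)Γ(μ)/Γ(ν+μ), taken over from the complex Beta function:
fractional integrals form a semigroup. -/
theorem causalConv_rlKernel {μ ν : ℝ} (hμ : 0 < μ) (hν : 0 < ν) :
    causalConv (rlKernel μ) (rlKernel ν) = rlKernel (μ + ν) := by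
  funext t
  rcases le_or_gt t 0 with h | h
  · rw [causalConv_of_nonpos _ _ h, rlKernel_of_nonpos h]
  have h1 : causalConv (rlKernel μ) (rlKernel ν) t =
      (Real.Gamma μ * Real.Gamma ν)⁻¹ * ∫ s in (0 : ℝ)..t, s ^ (ν - 1) * (t - s) ^ (μ - 1) := by
    rw [causalConv, intervalIntegral.integral_of_le h.le, integral_Ioc_eq_integral_Ioo,
      ← integral_const_mul]
    refine setIntegral_congr_fun measurableSet_Ioo fun s hs => ?_
    simp only [smul_eq_mul]
    rw [rlKernel_of_pos (sub_pos.2 hs.2), rlKernel_of_pos hs.1]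
    field_simp
  have h2 : ((∫ s in (0 : ℝ)..t, s ^ (ν - 1) * (t - s) ^ (μ - 1) : ℝ) : ℂ)
      = ((t ^ (μ + ν - 1) * (Real.Gamma ν * Real.Gamma μ / Real.Gamma (ν + μ)) : ℝ) : ℂ) := by
    have h3 := Complex.betaIntegral_scaled (ν : ℂ) (μ : ℂ) h
    have h4 := Complex.Gamma_mul_Gamma_eq_betaIntegral (s := (ν : ℂ)) (t := (μ : ℂ))
      (by simpa using hν) (by simpa using hμ)
    have h5 : Complex.Gamma ((ν : ℂ) + μ) ≠ 0 := by
      rw [← Complex.ofReal_add, Complex.Gamma_ofReal]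
      exact_mod_cast (Real.Gamma_pos_of_pos (add_pos hν hμ)).ne'
    push_cast
    rw [Complex.ofReal_cpow h.le]
    rw [← Complex.Gamma_ofReal, ← Complex.Gamma_ofReal, ← Complex.Gamma_ofReal,
      Complex.ofReal_add, h4, mul_div_cancel_left₀ _ h5, ← intervalIntegral.integral_ofReal]
    push_cast
    rw [add_comm (μ : ℂ) ν, ← h3]
    refine intervalIntegral.integral_congr fun s hs => ?_
    rw [uIcc_of_le h.le] at hs
    rw [Complex.ofReal_cpow hs.1, Complex.ofReal_cpow (sub_nonneg.2 hs.2)]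
    push_cast
    rfl
  rw [h1, Complex.ofReal_injective h2, rlKernel_of_pos h, add_comm ν μ]
  have := (Real.Gamma_pos_of_pos hμ).ne'
  have := (Real.Gamma_pos_of_pos hν).ne'
  field_simp

/-! ### Mittag-Leffler kernels: series, convolution, scaling, Laplace transform -/

/-- The Mittag-Leffler kernel `t ^ (β - 1) E_{α, β}(-l t ^ α)`, as a series of
Riemann–Liouville kernels. -/
def mlKernel (α l β t : ℝ) : ℝ := ∑' k : ℕ, (-l) ^ k * rlKernel (α * k + β) t

theorem mlKernel_of_nonpos (α l β : ℝ) {t : ℝ} (ht : t ≤ 0) : mlKernel α l β t = 0 := by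
  simp [mlKernel, rlKernel_of_nonpos ht]

section MittagLeffler

variable {α l β : ℝ}

/-- Comparison with the exponential series. Dropping two terms puts every Gamma argument above k +
2, in the range where Γ is increasing, so each Gamma value is at least k!. -/
theorem summable_rpow_div_Gamma (hα : 1 < α) (hβ : 0 < β) {L A : ℝ} (hL : 0 ≤ L) (hA : 0 < A) :
    Summable fun k : ℕ => L ^ k * (A ^ (α * k + β) / Real.Gamma (α * k + β)) := by
  rw [← summable_nat_add_iff 2]
  refine Summable.of_nonneg_of_le (fun k => ?_) (fun k => ?_)
    ((Real.summable_pow_div_factorial (L * A ^ α)).mul_left (L ^ 2 * (A ^ α) ^ 2 * A ^ β))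
  · have : 0 < Real.Gamma (α * ((k + 2 : ℕ) : ℝ) + β) := Real.Gamma_pos_of_pos (by positivity)
    positivity
  · have hk : ((k : ℝ) + 2) ≤ α * ((k + 2 : ℕ) : ℝ) + β := by
      push_cast
      nlinarith [Nat.cast_nonneg (α := ℝ) k]
    have h1 : ((k.factorial : ℕ) : ℝ) ≤ Real.Gamma (α * ((k + 2 : ℕ) : ℝ) + β) := by
      have h2 : Real.Gamma ((k : ℝ) + 2) ≤ Real.Gamma (α * ((k + 2 : ℕ) : ℝ) + β) :=
        Real.Gamma_strictMonoOn_Ici.monotoneOn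
          (by simp) (by simp only [mem_Ici]; linarith [Nat.cast_nonneg (α := ℝ) k]) hk
      have h3 : Real.Gamma ((k : ℝ) + 2) = ((k + 1).factorial : ℕ) := by
        rw [← Real.Gamma_nat_eq_factorial]
        push_cast
        ring_nf
      rw [h3] at h2
      refine le_trans ?_ h2
      exact_mod_cast Nat.factorial_le (Nat.le_succ k)
    have h4 : A ^ (α * ((k + 2 : ℕ) : ℝ) + β) = (A ^ α) ^ (k + 2) * A ^ β := by
      rw [Real.rpow_add hA, Real.rpow_mul hA.le, Real.rpow_natCast]
    have h5 : (0 : ℝ) < (k.factorial : ℕ) := by positivity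
    rw [h4]
    calc L ^ (k + 2) * ((A ^ α) ^ (k + 2) * A ^ β / Real.Gamma (α * ((k + 2 : ℕ) : ℝ) + β))
        ≤ L ^ (k + 2) * ((A ^ α) ^ (k + 2) * A ^ β / (k.factorial : ℕ)) := by gcongr
      _ = _ := by rw [mul_pow]; ring

theorem summable_abs_mlKernel (hα : 1 < α) (hβ : 0 < β) (l t : ℝ) :
    Summable fun k : ℕ => |l| ^ k * rlKernel (α * k + β) t := by
  rcases le_or_gt t 0 with h | h
  · simp [rlKernel_of_nonpos h, summable_zero]
  refine ((summable_rpow_div_Gamma hα hβ (abs_nonneg l) h).mul_right t⁻¹).congr fun k => ?_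
  rw [rlKernel_of_pos h, Real.rpow_sub_one h.ne']
  ring

theorem norm_mlKernel_term (hα : 1 < α) (hβ : 0 < β) (l t : ℝ) (k : ℕ) :
    ‖(-l) ^ k * rlKernel (α * k + β) t‖ = |l| ^ k * rlKernel (α * k + β) t := by
  rw [norm_mul, norm_pow, norm_neg, Real.norm_eq_abs, Real.norm_eq_abs,
    abs_of_nonneg (rlKernel_nonneg (by positivity) _)]

theorem hasSum_mlKernel (hα : 1 < α) (hβ : 0 < β) (l t : ℝ) :
    HasSum (fun k : ℕ => (-l) ^ k * rlKernel (α * k + β) t) (mlKernel α l β t) := by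
  refine Summable.hasSum (Summable.of_norm ?_)
  simpa only [norm_mlKernel_term hα hβ] using summable_abs_mlKernel hα hβ l t

/-- Splitting off the term k = 0 of the series. For β = 1 it identifies 1 − l t^α E_{α,1+α}(−l t^α)
with E_α(−l t^α), which is how the relaxation function appears throughout. -/
theorem mlKernel_add (hα : 1 < α) (hβ : 0 < β) (l t : ℝ) :
    mlKernel α l β t + l * mlKernel α l (β + α) t = rlKernel β t := by
  have h1 := (hasSum_mlKernel hα hβ l t).summable.tsum_eq_zero_add
  have h2 : ∀ k : ℕ, (-l) ^ (k + 1) * rlKernel (α * ((k + 1 : ℕ) : ℝ) + β) t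
      = (-l) * ((-l) ^ k * rlKernel (α * k + (β + α)) t) := fun k => by
    rw [pow_succ]
    push_cast
    rw [show α * ((k : ℝ) + 1) + β = α * k + (β + α) by ring]
    ring
  simp only [h2, tsum_mul_left] at h1
  simp only [mlKernel]
  rw [h1]
  simp

theorem continuous_mlKernel (hα : 1 < α) (hβ : 1 < β) (l : ℝ) : Continuous (mlKernel α l β) := by
  refine continuous_iff_continuousAt.2 fun t => ?_
  have h1 : ContinuousOn (mlKernel α l β) (Iio (t + 1)) := by
    refine continuousOn_tsum (u := fun k : ℕ => |l| ^ k * rlKernel (α * k + β) (t + 1))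
      (fun k => ?_) (summable_abs_mlKernel hα (by linarith) l _) (fun k s hs => ?_)
    · refine (continuous_const.mul (continuous_rlKernel ?_)).continuousOn
      have : 0 ≤ α * k := by positivity
      linarith
    · rw [norm_mlKernel_term hα (by linarith)]
      refine mul_le_mul_of_nonneg_left (rlKernel_le_of_le ?_ (le_of_lt hs)) (by positivity)
      have : 0 ≤ α * k := by positivity
      linarith
  exact h1.continuousAt (Iio_mem_nhds (by linarith))

/-- The Beta integral applied term by term: fractional integration only raises the second index. -/
theorem causalConv_rlKernel_mlKernel {μ : ℝ} (hα : 1 < α) (hμ : 0 < μ) (hβ : 0 < β) (l : ℝ) :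
    causalConv (rlKernel μ) (mlKernel α l β) = mlKernel α l (μ + β) := by
  funext t
  have h0 : ∀ k : ℕ, 0 < α * k + β := fun k => by positivity
  have hint : ∀ k : ℕ, ∫ s in Ioo 0 t, rlKernel μ (t - s) * rlKernel (α * k + β) s
      = rlKernel (α * k + (μ + β)) t := fun k => by
    have := congrFun (causalConv_rlKernel hμ (h0 k)) t
    rw [causalConv] at this
    simp only [smul_eq_mul] at this
    rw [this]
    ring_nf
  have hi : ∀ k : ℕ, Integrable (fun s => rlKernel μ (t - s) * rlKernel (α * k + β) s)
      (volume.restrict (Ioo 0 t)) := fun k => by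
    rcases le_or_gt t 0 with h | h
    · simp [Ioo_eq_empty_of_le h]
    -- A nonintegrable function has Bochner integral 0, so a nonzero value already proves
    -- integrability.
    refine Integrable.of_integral_ne_zero ?_
    rw [hint, rlKernel_of_pos h]
    have := Real.Gamma_pos_of_pos (show 0 < α * k + (μ + β) by positivity)
    positivity
  have key := hasSum_integral_of_summable_integral_norm
    (F := fun (k : ℕ) s => (-l) ^ k * (rlKernel μ (t - s) * rlKernel (α * k + β) s))
    (μ := volume.restrict (Ioo 0 t)) (fun k => (hi k).const_mul _) (by
      refine (summable_abs_mlKernel hα (add_pos hμ hβ) l t).congr fun k => ?_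
      rw [← hint, ← integral_const_mul]
      refine integral_congr_ae (Eventually.of_forall fun s => ?_)
      simp only
      rw [norm_mul, norm_pow, norm_neg, Real.norm_eq_abs, Real.norm_eq_abs, abs_of_nonneg
        (mul_nonneg (rlKernel_nonneg hμ _) (rlKernel_nonneg (h0 k) _))])
  simp only [integral_const_mul, hint] at key
  rw [mlKernel, key.tsum_eq, causalConv]
  refine integral_congr_ae (Eventually.of_forall fun s => ?_)
  simp only [mlKernel, smul_eq_mul]
  rw [← tsum_mul_left]
  refine tsum_congr fun k => ?_
  ring

/-- Reduces every bound uniform in l to the case l = 1, at the rescaled time l^(1/α) t. -/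
theorem mlKernel_scaling (hα : 1 < α) (hl : 0 < l) (β t : ℝ) :
    mlKernel α l β t = l ^ (-(β - 1) / α) * mlKernel α 1 β (l ^ (1 / α) * t) := by
  have hlp : 0 < l ^ (1 / α) := Real.rpow_pos_of_pos hl _
  rcases le_or_gt t 0 with h | h
  · rw [mlKernel_of_nonpos _ _ _ h, mlKernel_of_nonpos _ _ _
      (mul_nonpos_of_nonneg_of_nonpos hlp.le h), mul_zero]
  simp only [mlKernel]
  rw [← tsum_mul_left]
  refine tsum_congr fun k => ?_
  rw [rlKernel_of_pos h, rlKernel_of_pos (mul_pos hlp h), Real.mul_rpow hlp.le h.le,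
    ← Real.rpow_mul hl.le]
  have h1 : 1 / α * (α * k + β - 1) = (k : ℝ) + (β - 1) / α := by
    field_simp
    ring
  have h2 : l ^ (-(β - 1) / α) * l ^ ((β - 1) / α) = 1 := by
    rw [← Real.rpow_add hl, neg_div, neg_add_cancel, Real.rpow_zero]
  rw [h1, Real.rpow_add hl, Real.rpow_natCast]
  rw [neg_pow l]
  calc (-1) ^ k * l ^ k * (t ^ (α * k + β - 1) / Real.Gamma (α * k + β))
      = (l ^ (-(β - 1) / α) * l ^ ((β - 1) / α)) *
        ((-1) ^ k * l ^ k * (t ^ (α * k + β - 1) / Real.Gamma (α * k + β))) := by rw [h2, one_mul]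
    _ = _ := by ring

theorem integral_exp_mul_rlKernel {c : ℝ} (hβ : 0 < β) (hc : 0 < c) :
    ∫ t in Ioi 0, Real.exp (-(c * t)) * rlKernel β t = c ^ (-β) := by
  have h1 := Real.integral_rpow_mul_exp_neg_mul_Ioi hβ hc
  have h2 : ∫ t in Ioi 0, Real.exp (-(c * t)) * rlKernel β t
      = ∫ t in Ioi 0, (Real.Gamma β)⁻¹ * (t ^ (β - 1) * Real.exp (-(c * t))) := by
    refine setIntegral_congr_fun measurableSet_Ioi fun t ht => ?_
    rw [rlKernel_of_pos ht]
    ring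
  rw [h2, integral_const_mul, h1, one_div, Real.inv_rpow hc.le, Real.rpow_neg hc.le]
  have := (Real.Gamma_pos_of_pos hβ).ne'
  field_simp

theorem integrable_exp_mul_rlKernel {c : ℝ} (hβ : 0 < β) (hc : 0 < c) :
    IntegrableOn (fun t => Real.exp (-(c * t)) * rlKernel β t) (Ioi 0) := by
  refine Integrable.of_integral_ne_zero ?_
  rw [integral_exp_mul_rlKernel hβ hc]
  exact (Real.rpow_pos_of_pos hc _).ne'

/-- The transform of each term is a power of c, and the sum is geometric with ratio −c^(−α); hence
the restriction c > 1. The closed form makes sense on the whole right half plane, which the contour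
shift later exploits. -/
theorem laplace_mlKernel (hα : 1 < α) (hβ : 0 < β) {c : ℝ} (hc : 1 < c) :
    IntegrableOn (fun t => Real.exp (-(c * t)) * mlKernel α 1 β t) (Ioi 0) ∧
    ∫ t in Ioi 0, Real.exp (-(c * t)) * mlKernel α 1 β t = c ^ (α - β) / (1 + c ^ α) := by
  have hc0 : 0 < c := by linarith
  have h0 : ∀ k : ℕ, 0 < α * k + β := fun k => by positivity
  have hx : c ^ (-α) < 1 := Real.rpow_lt_one_of_one_lt_of_neg hc (by linarith)
  have hx0 : 0 < c ^ (-α) := Real.rpow_pos_of_pos hc0 _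
  have hterm : ∀ k : ℕ, c ^ (-(α * k + β)) = (c ^ (-α)) ^ k * c ^ (-β) := fun k => by
    rw [← Real.rpow_natCast, ← Real.rpow_mul hc0.le, ← Real.rpow_add hc0]
    ring_nf
  have hsm : Summable fun k : ℕ => ∫ t in Ioi 0,
      ‖(-1 : ℝ) ^ k * (Real.exp (-(c * t)) * rlKernel (α * k + β) t)‖ := by
    refine ((summable_geometric_of_lt_one hx0.le hx).mul_right (c ^ (-β))).congr fun k => ?_
    rw [← hterm, ← integral_exp_mul_rlKernel (h0 k) hc0]
    refine integral_congr_ae (Eventually.of_forall fun s => ?_)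
    simp only
    rw [norm_mul, norm_pow, norm_neg, norm_one, one_pow, one_mul, Real.norm_eq_abs, abs_of_nonneg
        (mul_nonneg (Real.exp_pos _).le (rlKernel_nonneg (h0 k) _))]
  have hint : ∀ k : ℕ, Integrable (fun t => (-1 : ℝ) ^ k *
      (Real.exp (-(c * t)) * rlKernel (α * k + β) t)) (volume.restrict (Ioi 0)) :=
    fun k => (integrable_exp_mul_rlKernel (h0 k) hc0).const_mul _
  have key := hasSum_integral_of_summable_integral_norm hint hsm
  have heq : ∀ t, ∑' k : ℕ, (-1 : ℝ) ^ k * (Real.exp (-(c * t)) * rlKernel (α * k + β) t)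
      = Real.exp (-(c * t)) * mlKernel α 1 β t := fun t => by
    rw [mlKernel, ← tsum_mul_left]
    exact tsum_congr fun k => by ring
  simp only [heq, integral_const_mul, integral_exp_mul_rlKernel (h0 _) hc0, hterm] at key
  have hgeo : HasSum (fun k : ℕ => (-1 : ℝ) ^ k * ((c ^ (-α)) ^ k * c ^ (-β)))
      ((1 + c ^ (-α))⁻¹ * c ^ (-β)) := by
    have := (hasSum_geometric_of_abs_lt_one (r := -c ^ (-α))
      (by rwa [abs_neg, abs_of_pos hx0])).mul_right (c ^ (-β))
    rw [sub_neg_eq_add] at this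
    refine this.congr_fun fun k => ?_
    rw [neg_pow]
    ring
  have hval : (1 + c ^ (-α))⁻¹ * c ^ (-β) = c ^ (α - β) / (1 + c ^ α) := by
    have : 0 < c ^ α := Real.rpow_pos_of_pos hc0 _
    rw [sub_eq_add_neg, Real.rpow_add hc0, Real.rpow_neg hc0.le α]
    field_simp
    ring
  rw [key.unique hgeo, hval]
  refine ⟨?_, rfl⟩
  refine Integrable.of_integral_ne_zero ?_
  rw [key.unique hgeo]
  positivity

end MittagLeffler

/-! ### Integrals over vertical lines -/

/-- The parametrization of the vertical line `re s = c` used for Fourier inversion. -/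
def vline (c ξ : ℝ) : ℂ := c + (2 * Real.pi * ξ : ℝ) * Complex.I

theorem vline_re (c ξ : ℝ) : (vline c ξ).re = c := by simp [vline]

theorem norm_vline (c ξ : ℝ) : ‖vline c ξ‖ = √(c ^ 2 + (2 * Real.pi * ξ) ^ 2) := by
  rw [vline, Complex.norm_add_mul_I]

theorem norm_vline_pos {c : ℝ} (hc : 0 < c) (ξ : ℝ) : 0 < ‖vline c ξ‖ := by
  rw [norm_vline]
  positivity

theorem norm_vline_mono {c c' : ℝ} (hc : 0 ≤ c) (h : c ≤ c') (ξ : ℝ) :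
    ‖vline c ξ‖ ≤ ‖vline c' ξ‖ := by
  rw [norm_vline, norm_vline]
  gcongr

theorem norm_vline_mul {c : ℝ} (hc : 0 < c) (ξ : ℝ) : ‖vline c (c * ξ)‖ = c * ‖vline 1 ξ‖ := by
  rw [norm_vline, norm_vline, ← Real.sqrt_sq hc.le, ← Real.sqrt_mul (sq_nonneg _),
    Real.sqrt_sq hc.le]
  ring_nf

theorem continuous_vline (c : ℝ) : Continuous (vline c) := by
  unfold vline
  fun_prop

theorem integrable_norm_vline_rpow {a c : ℝ} (ha : 1 < a) (hc : 0 < c) :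
    Integrable fun ξ : ℝ => ‖vline c ξ‖ ^ (-a) := by
  have h1 : Integrable fun ξ : ℝ => ‖vline 1 ξ‖ ^ (-a) := by
    have h2 := integrable_rpow_neg_one_add_norm_sq (E := ℝ) (μ := volume) (r := a) (by simpa)
    have h3 := h2.comp_mul_left' (R := 2 * Real.pi) (by positivity)
    refine h3.congr (Eventually.of_forall fun ξ => ?_)
    simp only
    rw [norm_vline, Real.sqrt_eq_rpow, ← Real.rpow_mul (by positivity), Real.norm_eq_abs, sq_abs]
    ring_nf
  have h4 := (h1.comp_mul_left' (R := c⁻¹) (by positivity)).const_mul (c ^ (-a))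
  refine h4.congr (Eventually.of_forall fun ξ => ?_)
  simp only
  have := norm_vline_mul hc (c⁻¹ * ξ)
  rw [mul_inv_cancel_left₀ hc.ne'] at this
  rw [this, Real.mul_rpow hc.le (norm_nonneg _)]

/-- With c = 1/t, this homogeneity is what produces the power of t in the decay estimates. -/
theorem integral_norm_vline_rpow {c : ℝ} (a : ℝ) (hc : 0 < c) :
    ∫ ξ : ℝ, ‖vline c ξ‖ ^ (-a) = c ^ (1 - a) * ∫ ξ : ℝ, ‖vline 1 ξ‖ ^ (-a) := by
  have h1 := Measure.integral_comp_mul_left (fun ξ : ℝ => ‖vline c ξ‖ ^ (-a)) c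
  simp only [norm_vline_mul hc, Real.mul_rpow hc.le (norm_nonneg _), integral_const_mul,
    smul_eq_mul, abs_of_pos (inv_pos.2 hc)] at h1
  rw [sub_eq_add_neg, Real.rpow_add hc, Real.rpow_one, mul_assoc, h1]
  field_simp

section VerticalLines

variable {h : ℂ → ℂ} {a : ℝ}

theorem continuous_comp_vline {g : ℂ → ℂ} (hg : ContinuousOn g {s | 0 < s.re}) {c : ℝ}
    (hc : 0 < c) : Continuous fun ξ => g (vline c ξ) :=
  hg.comp_continuous (continuous_vline c) fun ξ => by
    simpa only [mem_ofPred_eq, vline_re] using hc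

theorem isOpen_re_pos : IsOpen {s : ℂ | 0 < s.re} :=
  isOpen_lt continuous_const Complex.continuous_re

/-- Vertical line integrals of a holomorphic function with integrable decay do not depend on the
line, and those of its derivative vanish. -/
theorem integral_vline_deriv_eq_zero (hd : DifferentiableOn ℂ h {s | 0 < s.re}) (ha : 1 < a)
    (hb : ∀ c₁ c₂ : ℝ, 0 < c₁ → ∃ M : ℝ, ∀ s : ℂ, c₁ ≤ s.re → s.re ≤ c₂ →
      ‖h s‖ ≤ M * (‖s‖ ^ (-(2 : ℝ)) + ‖s‖ ^ (-a)) ∧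
      ‖deriv h s‖ ≤ M * (‖s‖ ^ (-(2 : ℝ)) + ‖s‖ ^ (-a))) :
    (∀ c : ℝ, 0 < c → ∫ ξ, deriv h (vline c ξ) = 0) ∧
    ∀ c c' : ℝ, 0 < c → 0 < c' → ∫ ξ, h (vline c ξ) = ∫ ξ, h (vline c' ξ) := by
  have hd' : DifferentiableOn ℂ (deriv h) {s | 0 < s.re} := hd.deriv isOpen_re_pos
  have hB : ∀ c : ℝ, 0 < c →
      Integrable fun ξ : ℝ => ‖vline c ξ‖ ^ (-(2 : ℝ)) + ‖vline c ξ‖ ^ (-a) := fun c hc =>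
    (integrable_norm_vline_rpow one_lt_two hc).add (integrable_norm_vline_rpow ha hc)
  have hi : ∀ c : ℝ, 0 < c → Integrable (fun ξ => h (vline c ξ)) ∧
      Integrable (fun ξ => deriv h (vline c ξ)) := fun c hc => by
    obtain ⟨M, hM⟩ := hb c c hc
    refine ⟨((hB c hc).const_mul M).mono'
      (continuous_comp_vline hd.continuousOn hc).aestronglyMeasurable
      (Eventually.of_forall fun ξ => (hM _ (vline_re c ξ).ge (vline_re c ξ).le).1),
      ((hB c hc).const_mul M).mono'
      (continuous_comp_vline hd'.continuousOn hc).aestronglyMeasurable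
      (Eventually.of_forall fun ξ => (hM _ (vline_re c ξ).ge (vline_re c ξ).le).2)⟩
  have hder : ∀ s : ℂ, 0 < s.re → HasDerivAt h (deriv h s) s := fun s hs =>
    (hd.differentiableAt (isOpen_re_pos.mem_nhds hs)).hasDerivAt
  -- Along the line, `deriv h` is up to the factor 2πi the ξ-derivative of h, which is integrable
  -- together with h.
  have hzero : ∀ c : ℝ, 0 < c → ∫ ξ, deriv h (vline c ξ) = 0 := fun c hc => by
    have hline : ∀ ξ : ℝ, HasDerivAt (fun ξ => h (vline c ξ))
        ((2 * Real.pi * Complex.I) * deriv h (vline c ξ)) ξ := fun ξ => by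
      have h1 : HasDerivAt (vline c) (2 * Real.pi * Complex.I) ξ := by
        have h0 : HasDerivAt (fun ξ : ℝ => 2 * Real.pi * ξ) (2 * Real.pi) ξ := by
          simpa using (hasDerivAt_id ξ).const_mul (2 * Real.pi)
        have := (h0.ofReal_comp.mul_const Complex.I).const_add (c : ℂ)
        push_cast at this
        refine HasDerivAt.congr_of_eventuallyEq this (Eventually.of_forall fun ξ => ?_)
        simp [vline]
      have := HasDerivAt.scomp ξ (hder _ (by rwa [vline_re])) h1
      simpa [Function.comp_def] using this
    have := integral_eq_zero_of_hasDerivAt_of_integrable hline ((hi c hc).2.const_mul _)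
      (hi c hc).1
    rw [integral_const_mul] at this
    exact (mul_eq_zero.1 this).resolve_left (by simp [Real.pi_ne_zero])
  refine ⟨hzero, fun c c' hc hc' => ?_⟩
  -- In place of Cauchy's theorem on rectangles: the derivative in c of the line integral is the
  -- integral of h' over the line, which has just been shown to vanish.
  have hG : ∀ c : ℝ, 0 < c → HasDerivAt (fun c => ∫ ξ, h (vline c ξ)) 0 c := fun c hc => by
    obtain ⟨M, hM⟩ := hb (c / 2) (2 * c) (by linarith)
    have hM0 : ∀ x ∈ Ioo (c / 2) (2 * c), ∀ ξ : ℝ, ‖deriv h (vline x ξ)‖ ≤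
        |M| * (‖vline (c / 2) ξ‖ ^ (-(2 : ℝ)) + ‖vline (c / 2) ξ‖ ^ (-a)) := fun x hx ξ => by
      refine (hM _ (by rw [vline_re]; exact hx.1.le) (by rw [vline_re]; exact hx.2.le)).2.trans ?_
      have h1 := norm_vline_pos (show 0 < c / 2 by linarith) ξ
      have h2 := norm_vline_mono (show 0 ≤ c / 2 by linarith) hx.1.le ξ
      have h3 := Real.rpow_le_rpow_of_nonpos h1 h2 (show -(2 : ℝ) ≤ 0 by norm_num)
      have h4 := Real.rpow_le_rpow_of_nonpos h1 h2 (show -a ≤ 0 by linarith)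
      have h5 := le_abs_self M
      have : (0 : ℝ) ≤ ‖vline x ξ‖ ^ (-(2 : ℝ)) + ‖vline x ξ‖ ^ (-a) := by positivity
      gcongr
    have := (hasDerivAt_integral_of_dominated_loc_of_deriv_le (μ := volume)
      (F := fun c ξ => h (vline c ξ)) (F' := fun c ξ => deriv h (vline c ξ)) (x₀ := c)
      (s := Ioo (c / 2) (2 * c)) (Ioo_mem_nhds (by linarith) (by linarith))
      ((lt_mem_nhds hc).mono fun x hx => (hi x hx).1.aestronglyMeasurable) (hi c hc).1
      (hi c hc).2.aestronglyMeasurable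
      (Eventually.of_forall fun ξ x hx => hM0 x hx ξ)
      ((hB (c / 2) (by linarith)).const_mul |M|)
      (Eventually.of_forall fun ξ x hx => by
        have hx0 : 0 < x := by linarith [hx.1]
        have h1 : HasDerivAt (fun x => vline x ξ) 1 x := by
          have := (hasDerivAt_id x).ofReal_comp.add_const
            (((2 * Real.pi * ξ : ℝ) : ℂ) * Complex.I)
          simpa [vline] using this
        have := HasDerivAt.scomp x (hder (vline x ξ) (by rwa [vline_re])) h1
        simpa [Function.comp_def] using this)).2
    rwa [hzero c hc] at this
  exact isOpen_Ioi.is_const_of_deriv_eq_zero isPreconnected_Ioi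
    (fun x hx => (hG x hx).differentiableAt.differentiableWithinAt)
    (fun x hx => (hG x hx).deriv) hc hc'

end VerticalLines

/-! ### Laplace inversion and decay -/

section LaplaceInversion

variable {ψ : ℝ → ℝ} {Φ : ℂ → ℂ}

/-- Differentiating e^(−st) in s produces a factor t; it is absorbed at the cost of δ in the
exponent. -/
theorem exp_neg_mul_mul_le {δ x : ℝ} (hδ : 0 < δ) (c : ℝ) :
    Real.exp (-(c * x)) * x ≤ δ⁻¹ * Real.exp (-((c - δ) * x)) := by
  have h1 : δ * x ≤ Real.exp (δ * x) := by linarith [Real.add_one_le_exp (δ * x)]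
  have h2 : Real.exp (-((c - δ) * x)) = Real.exp (-(c * x)) * Real.exp (δ * x) := by
    rw [← Real.exp_add]
    ring_nf
  rw [h2]
  have h3 : x ≤ δ⁻¹ * Real.exp (δ * x) := by
    rw [inv_mul_eq_div, le_div_iff₀ hδ]
    linarith
  calc Real.exp (-(c * x)) * x ≤ Real.exp (-(c * x)) * (δ⁻¹ * Real.exp (δ * x)) := by gcongr
    _ = _ := by ring

theorem norm_cexp_neg_mul (s : ℂ) (t : ℝ) : ‖Complex.exp (-(s * t))‖ = Real.exp (-(s.re * t)) := by
  rw [Complex.norm_exp]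
  simp

theorem integrable_cexp_mul (hψ : ∀ c : ℝ, 1 < c →
      IntegrableOn (fun t => Real.exp (-(c * t)) * ψ t) (Ioi 0)) {s : ℂ} (hs : 1 < s.re) :
    IntegrableOn (fun t : ℝ => Complex.exp (-(s * t)) * ψ t) (Ioi 0) := by
  have h1 := (hψ _ hs).ofReal (𝕜 := ℂ)
  have h2 : Integrable (fun t : ℝ => Complex.exp (-((s.im * t : ℝ) * Complex.I)) *
      ((Real.exp (-(s.re * t)) * ψ t : ℝ) : ℂ)) (volume.restrict (Ioi 0)) := by
    refine h1.bdd_mul (c := 1) (Continuous.aestronglyMeasurable (by fun_prop))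
      (Eventually.of_forall fun t => ?_)
    rw [← neg_mul, ← Complex.ofReal_neg, Complex.norm_exp_ofReal_mul_I]
  refine h2.congr (Eventually.of_forall fun t => ?_)
  simp only
  push_cast
  rw [← mul_assoc, ← Complex.exp_add]
  congr 2
  conv_rhs => rw [← Complex.re_add_im s]
  ring

/-- Both sides are holomorphic on Re s > 1 and agree at the real points 2 + 1/(n+1), which
accumulate at 2; the identity theorem does the rest. -/
theorem laplace_eq_of_real (hψ : ∀ c : ℝ, 1 < c →
      IntegrableOn (fun t => Real.exp (-(c * t)) * ψ t) (Ioi 0))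
    (hd : DifferentiableOn ℂ Φ {s | 0 < s.re})
    (hΦ : ∀ c : ℝ, 1 < c → ((∫ t in Ioi 0, Real.exp (-(c * t)) * ψ t : ℝ) : ℂ) = Φ c)
    {s : ℂ} (hs : 1 < s.re) : ∫ t in Ioi (0 : ℝ), Complex.exp (-(s * t)) * ψ t = Φ s := by
  have hU : IsOpen {s : ℂ | 1 < s.re} := isOpen_lt continuous_const Complex.continuous_re
  have hdiff : DifferentiableOn ℂ (fun s => ∫ t in Ioi (0 : ℝ), Complex.exp (-(s * t)) * ψ t)
      {s : ℂ | 1 < s.re} := fun s hs => by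
    have hs' : 1 < s.re := hs
    -- One third, because δ is lost twice (once for the neighbourhood, once for the factor t) and Re
    -- s − 2δ must stay above 1.
    set δ := (s.re - 1) / 3 with hδ
    have hδ0 : 0 < δ := by rw [hδ]; linarith
    have hm : AEStronglyMeasurable (fun t : ℝ => (ψ t : ℂ)) (volume.restrict (Ioi 0)) := by
      have h1 := (integrable_cexp_mul hψ hs').aestronglyMeasurable
      have h2 : AEStronglyMeasurable (fun t : ℝ => Complex.exp (s * t) *
          (Complex.exp (-(s * t)) * ψ t)) (volume.restrict (Ioi 0)) :=
        (Continuous.aestronglyMeasurable (by fun_prop)).mul h1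
      refine h2.congr (Eventually.of_forall fun t => ?_)
      simp only
      rw [← mul_assoc, ← Complex.exp_add, add_neg_cancel, Complex.exp_zero, one_mul]
    have := (hasDerivAt_integral_of_dominated_loc_of_deriv_le (μ := volume.restrict (Ioi 0))
      (F := fun (s : ℂ) (t : ℝ) => Complex.exp (-(s * t)) * ψ t)
      (F' := fun (s : ℂ) (t : ℝ) => Complex.exp (-(s * t)) * -(t : ℂ) * ψ t) (x₀ := s)
      (bound := fun t => δ⁻¹ * |Real.exp (-((s.re - δ - δ) * t)) * ψ t|)
      (s := {z : ℂ | s.re - δ < z.re})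
      ((isOpen_lt continuous_const Complex.continuous_re).mem_nhds
        (show s.re - δ < s.re by linarith))
      (Eventually.of_forall fun z =>
        (Continuous.aestronglyMeasurable (by fun_prop)).mul hm)
      (integrable_cexp_mul hψ hs')
      ((Continuous.aestronglyMeasurable (by fun_prop)).mul hm) ?_ ?_ ?_).2
    · exact this.differentiableAt.differentiableWithinAt
    · refine (ae_restrict_mem measurableSet_Ioi).mono fun t ht z hz => ?_
      have ht0 : (0 : ℝ) < t := ht
      have hz' : s.re - δ < z.re := hz
      rw [norm_mul, norm_mul, norm_cexp_neg_mul, norm_neg, Complex.norm_real, Complex.norm_real,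
        Real.norm_eq_abs, Real.norm_eq_abs, abs_of_pos ht0, abs_mul, abs_of_pos (Real.exp_pos _),
        ← mul_assoc]
      refine mul_le_mul_of_nonneg_right ?_ (abs_nonneg _)
      refine le_trans ?_ (exp_neg_mul_mul_le hδ0 (s.re - δ))
      gcongr
    · refine ((hψ (s.re - δ - δ) (by rw [hδ]; linarith)).norm.const_mul δ⁻¹).congr ?_
      exact Eventually.of_forall fun t => rfl
    · refine Eventually.of_forall fun t z _ => ?_
      have h1 : HasDerivAt (fun z : ℂ => -(z * t)) (-(t : ℂ)) z := by
        simpa using ((hasDerivAt_id z).mul_const (t : ℂ)).fun_neg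
      exact (h1.cexp).mul_const _
  have h1 := hdiff.analyticOnNhd hU
  have h2 : AnalyticOnNhd ℂ Φ {s : ℂ | 1 < s.re} :=
    (hd.analyticOnNhd isOpen_re_pos).mono fun s hs => by
      have : 1 < s.re := hs
      simp only [mem_ofPred_eq]
      linarith
  refine h1.eqOn_of_preconnected_of_frequently_eq h2
    (convex_halfSpace_re_gt 1).isPreconnected (z₀ := 2) (by simp) ?_ hs
  have hlim : Tendsto (fun n : ℕ => ((2 + 1 / ((n : ℝ) + 1) : ℝ) : ℂ)) atTop (𝓝[≠] 2) := by
    refine tendsto_nhdsWithin_iff.2 ⟨?_, Eventually.of_forall fun n => ?_⟩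
    · have := (tendsto_one_div_add_atTop_nhds_zero_nat (𝕜 := ℝ)).const_add 2
      rw [add_zero] at this
      exact_mod_cast (Complex.continuous_ofReal.tendsto _).comp this
    · simp only [mem_compl_iff, mem_singleton_iff]
      intro h
      have h3 : (2 : ℝ) + 1 / ((n : ℝ) + 1) = 2 := by exact_mod_cast h
      have : (0 : ℝ) < 1 / ((n : ℝ) + 1) := by positivity
      linarith
  refine hlim.frequently (Eventually.frequently (Eventually.of_forall fun n => ?_))
  have h3 : (1 : ℝ) < 2 + 1 / ((n : ℝ) + 1) := by
    have : (0 : ℝ) < 1 / ((n : ℝ) + 1) := by positivity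
    linarith
  rw [← hΦ _ h3, ← integral_complex_ofReal]
  push_cast
  rfl

/-- The Fourier transform of e^(−2t) ψ(t) is Φ on the line Re s = 2. Continuity of ψ and
integrability of Φ there make Fourier inversion valid at every point. -/
theorem laplace_inversion (hc : Continuous ψ) (h0 : ∀ t ≤ 0, ψ t = 0) (hψ : ∀ c : ℝ, 1 < c →
      IntegrableOn (fun t => Real.exp (-(c * t)) * ψ t) (Ioi 0))
    (hΦ : ∀ s : ℂ, 1 < s.re → ∫ t in Ioi (0 : ℝ), Complex.exp (-(s * t)) * ψ t = Φ s)
    (hi : Integrable fun ξ => Φ (vline 2 ξ)) (t : ℝ) :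
    (ψ t : ℂ) = ∫ ξ, Complex.exp (vline 2 ξ * t) * Φ (vline 2 ξ) := by
  set f : ℝ → ℂ := fun t => Complex.exp (-(2 * t)) * ψ t with hf
  have hzero : ∀ g : ℝ → ℂ, (∫ t, g t * ψ t) = ∫ t in Ioi (0 : ℝ), g t * ψ t := fun g => by
    refine (setIntegral_eq_integral_of_forall_compl_eq_zero fun t ht => ?_).symm
    rw [h0 t (not_lt.1 ht), Complex.ofReal_zero, mul_zero]
  have hfi : Integrable f := by
    have := integrable_cexp_mul hψ (s := 2) (by simp)
    rw [← integrable_indicator_iff measurableSet_Ioi] at this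
    refine this.congr (Eventually.of_forall fun t => ?_)
    by_cases ht : t ∈ Ioi 0
    · rw [indicator_of_mem ht]
    · rw [indicator_of_notMem ht, hf]
      beta_reduce
      rw [h0 t (not_lt.1 ht), Complex.ofReal_zero, mul_zero]
  have hF : FourierTransform.fourier f = fun ξ => Φ (vline 2 ξ) := by
    funext ξ
    rw [Real.fourier_real_eq_integral_exp_smul, ← hΦ _ (by rw [vline_re]; norm_num), ← hzero]
    congr 1
    funext t
    rw [hf, smul_eq_mul]
    simp only
    rw [← mul_assoc, ← Complex.exp_add]
    congr 2
    simp only [vline]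
    push_cast
    ring
  have hfc : Continuous f := by
    rw [hf]
    fun_prop
  have key := congrFun (hfc.fourierInv_fourier_eq hfi (by rw [hF]; exact hi)) t
  rw [hF, Real.fourierInv_eq'] at key
  have h1 : (ψ t : ℂ) = Complex.exp (2 * t) * f t := by
    rw [hf]
    simp only
    rw [← mul_assoc, ← Complex.exp_add, add_neg_cancel, Complex.exp_zero, one_mul]
  rw [h1, ← key, ← integral_const_mul]
  congr 1
  funext ξ
  rw [smul_eq_mul, ← mul_assoc, ← Complex.exp_add]
  congr 2
  simp only [vline, RCLike.inner_apply, conj_trivial]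
  push_cast
  ring

/-- A function whose Laplace transform `Φ` satisfies `|Φ| ≲ |s|⁻²` and `|Φ'| ≲ |s|⁻ᵃ` on the right
half plane is `O(t ^ (a - 2))`. -/
theorem abs_le_of_laplace {a M : ℝ} (ha : 1 < a) (hc : Continuous ψ) (h0 : ∀ t ≤ 0, ψ t = 0)
    (hψ : ∀ c : ℝ, 1 < c → IntegrableOn (fun t => Real.exp (-(c * t)) * ψ t) (Ioi 0))
    (hd : DifferentiableOn ℂ Φ {s | 0 < s.re})
    (hΦ : ∀ c : ℝ, 1 < c → ((∫ t in Ioi 0, Real.exp (-(c * t)) * ψ t : ℝ) : ℂ) = Φ c)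
    (hM : ∀ s : ℂ, 0 < s.re → ‖Φ s‖ ≤ M * ‖s‖ ^ (-(2 : ℝ)) ∧ ‖deriv Φ s‖ ≤ M * ‖s‖ ^ (-a)) :
    ∃ C : ℝ, ∀ t : ℝ, 0 < t → |ψ t| ≤ C * t ^ (a - 2) := by
  refine ⟨Real.exp 1 * M * ∫ ξ : ℝ, ‖vline 1 ξ‖ ^ (-a), fun t ht => ?_⟩
  have hi : Integrable fun ξ => Φ (vline 2 ξ) :=
    ((integrable_norm_vline_rpow one_lt_two two_pos).const_mul M).mono'
      (continuous_comp_vline hd.continuousOn two_pos).aestronglyMeasurable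
      (Eventually.of_forall fun ξ => (hM _ (by rw [vline_re]; exact two_pos)).1)
  have hinv := laplace_inversion hc h0 hψ (fun s hs => laplace_eq_of_real hψ hd hΦ hs) hi t
  set h : ℂ → ℂ := fun s => Complex.exp (s * t) * Φ s with hh
  have hder : ∀ s : ℂ, 0 < s.re → HasDerivAt h
      (Complex.exp (s * t) * t * Φ s + Complex.exp (s * t) * deriv Φ s) s := fun s hs => by
    have h1 : HasDerivAt (fun z : ℂ => z * t) (t : ℂ) s := by
      simpa using (hasDerivAt_id s).mul_const (t : ℂ)
    exact h1.cexp.mul (hd.differentiableAt (isOpen_re_pos.mem_nhds hs)).hasDerivAt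
  have hexp : ∀ s : ℂ, ‖Complex.exp (s * t)‖ = Real.exp (s.re * t) := fun s => by
    rw [Complex.norm_exp]
    simp
  obtain ⟨hA, hB⟩ := integral_vline_deriv_eq_zero (h := h) (a := a)
    (fun s hs => (hder s hs).differentiableAt.differentiableWithinAt) ha (fun c₁ c₂ hc₁ => by
      refine ⟨Real.exp (c₂ * t) * (1 + t) * M, fun s hs hs2 => ?_⟩
      have hs0 : 0 < s.re := by linarith
      obtain ⟨h1, h2⟩ := hM s hs0
      have hsn : 0 < ‖s‖ := norm_pos_iff.2 fun h => by simp [h] at hs0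
      have hp1 : 0 < ‖s‖ ^ (-(2 : ℝ)) := Real.rpow_pos_of_pos hsn _
      have hp2 : 0 < ‖s‖ ^ (-a) := Real.rpow_pos_of_pos hsn _
      have hM0 : 0 ≤ M := by
        by_contra hneg
        push Not at hneg
        have := (norm_nonneg _).trans h1
        nlinarith
      have he : Real.exp (s.re * t) ≤ Real.exp (c₂ * t) := by gcongr
      constructor
      · rw [hh]
        simp only
        rw [norm_mul, hexp]
        calc Real.exp (s.re * t) * ‖Φ s‖
            ≤ Real.exp (c₂ * t) * (M * ‖s‖ ^ (-(2 : ℝ))) := by gcongr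
          _ ≤ Real.exp (c₂ * t) * ((1 + t) * (M * (‖s‖ ^ (-(2 : ℝ)) + ‖s‖ ^ (-a)))) := by
            refine mul_le_mul_of_nonneg_left ?_ (Real.exp_pos _).le
            have : 0 ≤ M * ‖s‖ ^ (-(2 : ℝ)) := by positivity
            have : 0 ≤ M * ‖s‖ ^ (-a) := by positivity
            nlinarith
          _ = _ := by ring
      · rw [(hder s hs0).deriv]
        refine (norm_add_le _ _).trans ?_
        rw [norm_mul, norm_mul, norm_mul, hexp, Complex.norm_real, Real.norm_eq_abs,
          abs_of_pos ht]
        calc Real.exp (s.re * t) * t * ‖Φ s‖ + Real.exp (s.re * t) * ‖deriv Φ s‖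
            ≤ Real.exp (c₂ * t) * t * (M * ‖s‖ ^ (-(2 : ℝ))) +
              Real.exp (c₂ * t) * (M * ‖s‖ ^ (-a)) := by gcongr
          _ ≤ Real.exp (c₂ * t) * ((1 + t) * (M * (‖s‖ ^ (-(2 : ℝ)) + ‖s‖ ^ (-a)))) := by
            rw [mul_assoc, ← mul_add]
            refine mul_le_mul_of_nonneg_left ?_ (Real.exp_pos _).le
            have : 0 ≤ M * ‖s‖ ^ (-(2 : ℝ)) := by positivity
            have : 0 ≤ t * (M * ‖s‖ ^ (-a)) := by positivity
            nlinarith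
          _ = _ := by ring)
  -- The inversion integral is moved from Re s = 2 to Re s = 1/t, where |e^(st)| = e.
  have ht' : 0 < t⁻¹ := inv_pos.2 ht
  have hz := hA t⁻¹ ht'
  have hΦi : Integrable fun ξ => Complex.exp (vline t⁻¹ ξ * t) * Φ (vline t⁻¹ ξ) := by
    refine ((integrable_norm_vline_rpow one_lt_two ht').const_mul (Real.exp 1 * M)).mono'
      (continuous_comp_vline (g := h) (fun s hs =>
        (hder s hs).continuousAt.continuousWithinAt) ht').aestronglyMeasurable
      (Eventually.of_forall fun ξ => ?_)
    rw [norm_mul, hexp, vline_re, inv_mul_cancel₀ ht.ne', mul_assoc]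
    gcongr
    exact (hM _ (by rwa [vline_re])).1
  have hbd : ∀ ξ, ‖Complex.exp (vline t⁻¹ ξ * t) * deriv Φ (vline t⁻¹ ξ)‖ ≤
      Real.exp 1 * M * ‖vline t⁻¹ ξ‖ ^ (-a) := fun ξ => by
    rw [norm_mul, hexp, vline_re, inv_mul_cancel₀ ht.ne', mul_assoc]
    gcongr
    exact (hM _ (by rwa [vline_re])).2
  have hΦ'i : Integrable fun ξ => Complex.exp (vline t⁻¹ ξ * t) * deriv Φ (vline t⁻¹ ξ) :=
    ((integrable_norm_vline_rpow ha ht').const_mul (Real.exp 1 * M)).mono'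
      (continuous_comp_vline (g := fun s => Complex.exp (s * t) * deriv Φ s)
        (ContinuousOn.mul (by fun_prop) (hd.deriv isOpen_re_pos).continuousOn)
        ht').aestronglyMeasurable
      (Eventually.of_forall hbd)
  -- Integration by parts: the integral of (e^(st) Φ)' over the line is zero. The gain is a factor
  -- 1/t and the replacement of Φ by Φ'.
  have hsum : t * (∫ ξ, Complex.exp (vline t⁻¹ ξ * t) * Φ (vline t⁻¹ ξ)) =
      -∫ ξ, Complex.exp (vline t⁻¹ ξ * t) * deriv Φ (vline t⁻¹ ξ) := by
    rw [eq_neg_iff_add_eq_zero, ← integral_const_mul, ← integral_add (hΦi.const_mul _) hΦ'i, ← hz]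
    congr 1
    funext ξ
    rw [(hder _ (by rwa [vline_re])).deriv]
    ring
  rw [← hB t⁻¹ 2 ht' two_pos] at hinv
  rw [hh] at hinv
  simp only at hinv
  rw [← hinv] at hsum
  have hn : t * |ψ t| ≤ Real.exp 1 * M * (t⁻¹ ^ (1 - a) * ∫ ξ : ℝ, ‖vline 1 ξ‖ ^ (-a)) := by
    rw [← integral_norm_vline_rpow a ht', ← integral_const_mul]
    have h1 : t * |ψ t| = ‖(t : ℂ) * (ψ t : ℂ)‖ := by
      rw [norm_mul, Complex.norm_real, Complex.norm_real, Real.norm_eq_abs, Real.norm_eq_abs,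
        abs_of_pos ht]
    rw [h1, hsum, norm_neg]
    exact norm_integral_le_of_norm_le ((integrable_norm_vline_rpow ha ht').const_mul _)
      (Eventually.of_forall hbd)
  rw [Real.inv_rpow ht.le, ← Real.rpow_neg ht.le, neg_sub] at hn
  have h2 : t ^ (a - 1) = t * t ^ (a - 2) := by
    rw [show a - 1 = 1 + (a - 2) by ring, Real.rpow_add ht, Real.rpow_one]
  rw [h2] at hn
  refine le_of_mul_le_mul_left (hn.trans (le_of_eq ?_)) ht
  ring

end LaplaceInversion

/-! ### Symbol estimates and uniform Mittag-Leffler bounds -/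

/-- For Re s > 0 the argument of s^α stays within απ/2 < π, so s^α avoids a sector around the
negative axis. With c = cos(απ/2) > −1 this reads |1 + s^α|² ≥ ((1 + c)/2) (1 + |s|^α)². -/
theorem exists_norm_inv_one_add_cpow_le {α : ℝ} (hα : 1 < α) (hα2 : α < 2) :
    ∃ K : ℝ, 0 < K ∧ ∀ s : ℂ, 0 < s.re → 1 + s ^ (α : ℂ) ≠ 0 ∧
      ‖(1 + s ^ (α : ℂ))⁻¹‖ * (1 + ‖s‖ ^ α) ≤ K := by
  set c := Real.cos (α * (Real.pi / 2)) with hc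
  have hpi := Real.pi_pos
  have hc1 : -1 < c := by
    rw [hc, ← Real.cos_pi]
    exact Real.cos_lt_cos_of_nonneg_of_le_pi (by positivity) le_rfl (by nlinarith)
  set κ := √((1 + c) / 2) with hκ
  have hκ0 : 0 < κ := Real.sqrt_pos.2 (by linarith)
  refine ⟨κ⁻¹, inv_pos.2 hκ0, fun s hs => ?_⟩
  have hs0 : s ≠ 0 := fun h => by simp [h] at hs
  set ρ := ‖s‖ ^ α with hρ
  have hρ0 : 0 ≤ ρ := Real.rpow_nonneg (norm_nonneg _) _
  set θ := α * s.arg with hθ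
  have hcos : c ≤ Real.cos θ := by
    have harg : |s.arg| < Real.pi / 2 := Complex.abs_arg_lt_pi_div_two_iff.2 (Or.inl hs)
    rw [hc, ← Real.cos_abs θ, hθ, abs_mul, abs_of_pos (show 0 < α by linarith)]
    refine Real.cos_le_cos_of_nonneg_of_le_pi (by positivity) (by nlinarith) ?_
    gcongr
  have hz : s ^ (α : ℂ) = ρ * (Real.cos θ + Real.sin θ * Complex.I) := by
    rw [Complex.cpow_def_of_ne_zero hs0]
    have hlog : Complex.log s * α = ((Real.log ‖s‖ * α : ℝ) : ℂ) + (θ : ℝ) * Complex.I := by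
      conv_lhs => rw [← Complex.re_add_im (Complex.log s), Complex.log_re, Complex.log_im]
      rw [hθ]
      push_cast
      ring
    rw [hlog, Complex.exp_add, ← Complex.ofReal_exp, hρ, Real.rpow_def_of_pos (norm_pos_iff.2 hs0),
      Complex.exp_mul_I, Complex.ofReal_cos, Complex.ofReal_sin]
  have hn : κ * (1 + ρ) ≤ ‖1 + s ^ (α : ℂ)‖ := by
    rw [hz, Complex.norm_def, hκ]
    have h1 : Complex.normSq (1 + ρ * (Real.cos θ + Real.sin θ * Complex.I))
        = 1 + 2 * ρ * Real.cos θ + ρ ^ 2 := by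
      rw [Complex.normSq_apply]
      simp only [Complex.add_re, Complex.one_re, Complex.mul_re, Complex.ofReal_re, Complex.I_re,
        mul_zero, Complex.ofReal_im, Complex.I_im, mul_one, Complex.add_im, Complex.mul_im,
        zero_mul, Complex.one_im, zero_add, sub_self, add_zero, sub_zero]
      nlinarith [Real.sin_sq_add_cos_sq θ]
    rw [h1, ← Real.sqrt_sq (show 0 ≤ 1 + ρ by linarith), ← Real.sqrt_mul (by linarith)]
    refine Real.sqrt_le_sqrt ?_
    have h2 : ρ * c ≤ ρ * Real.cos θ := mul_le_mul_of_nonneg_left hcos hρ0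
    have h3 : c ≤ 1 := Real.cos_le_one _
    nlinarith [mul_nonneg (show 0 ≤ 1 - c by linarith) (sq_nonneg (1 - ρ))]
  have hpos : 0 < ‖1 + s ^ (α : ℂ)‖ := lt_of_lt_of_le (by positivity) hn
  refine ⟨norm_pos_iff.1 hpos, ?_⟩
  rw [norm_inv, inv_mul_eq_div, div_le_iff₀ hpos, inv_mul_eq_div, le_div_iff₀ hκ0]
  linarith

section SymbolBounds

variable {α : ℝ}

theorem hasDerivAt_cpow_ofReal (β : ℝ) {s : ℂ} (hs : 0 < s.re) :
    HasDerivAt (fun s : ℂ => s ^ (β : ℂ)) (β * s ^ ((β - 1 : ℝ) : ℂ)) s := by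
  have := (hasDerivAt_id s).cpow_const (c := (β : ℂ)) (Or.inl hs)
  simpa using this

theorem hasDerivAt_inv_one_add_cpow {s : ℂ} (hs : 0 < s.re) (h0 : 1 + s ^ (α : ℂ) ≠ 0) :
    HasDerivAt (fun s : ℂ => (1 + s ^ (α : ℂ))⁻¹)
      (-(α * s ^ ((α - 1 : ℝ) : ℂ)) * ((1 + s ^ (α : ℂ))⁻¹) ^ 2) s := by
  have := ((hasDerivAt_cpow_ofReal α hs).const_add 1).fun_inv h0
  refine this.congr_deriv ?_
  rw [inv_pow, div_eq_mul_inv]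

/-- The transform s^(α−2)/(1 + s^α) is O(|s|⁻²) and its derivative is O(|s|^(−(3−α))) on the half
plane; the exponent a = 3 − α, above 1 since α < 2, gives t^(1−α). -/
theorem mlKernel_two_bound (hα : 1 < α) (hα2 : α < 2) :
    ∃ C : ℝ, ∀ t : ℝ, 0 < t → |mlKernel α 1 2 t| ≤ C * t ^ (1 - α) := by
  obtain ⟨K, hK0, hK⟩ := exists_norm_inv_one_add_cpow_le hα hα2
  set Φ : ℂ → ℂ := fun s => s ^ ((α - 2 : ℝ) : ℂ) * (1 + s ^ (α : ℂ))⁻¹ with hΦ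
  have hder : ∀ s : ℂ, 0 < s.re → HasDerivAt Φ
      (((α - 2 : ℝ) : ℂ) * s ^ ((α - 2 - 1 : ℝ) : ℂ) * (1 + s ^ (α : ℂ))⁻¹ +
        s ^ ((α - 2 : ℝ) : ℂ) *
        (-(α * s ^ ((α - 1 : ℝ) : ℂ)) * ((1 + s ^ (α : ℂ))⁻¹) ^ 2)) s := fun s hs =>
    (hasDerivAt_cpow_ofReal (α - 2) hs).mul (hasDerivAt_inv_one_add_cpow hs (hK s hs).1)
  have := abs_le_of_laplace (ψ := mlKernel α 1 2) (Φ := Φ) (a := 3 - α) (M := K + 2 * K ^ 2)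
    (by linarith) (continuous_mlKernel hα one_lt_two 1) (fun t ht => mlKernel_of_nonpos _ _ _ ht)
    (fun c hc => (laplace_mlKernel hα two_pos hc).1)
    (fun s hs => (hder s hs).differentiableAt.differentiableWithinAt)
    (fun c hc => by
      have hc0 : (0 : ℝ) ≤ c := by linarith
      rw [(laplace_mlKernel hα two_pos hc).2, hΦ]
      simp only
      rw [← Complex.ofReal_cpow hc0, ← Complex.ofReal_cpow hc0]
      push_cast
      rw [div_eq_mul_inv])
    (fun s hs => by
      have hr : 0 < ‖s‖ := norm_pos_iff.2 fun h => by simp [h] at hs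
      have hq := (hK s hs).2
      set r := ‖s‖ with hrdef
      set q := ‖(1 + s ^ (α : ℂ))⁻¹‖ with hqdef
      have hq0 : 0 ≤ q := norm_nonneg _
      have hrα : 0 < r ^ α := Real.rpow_pos_of_pos hr _
      have hq1 : q ≤ K := by nlinarith
      have hq2 : r ^ α * q ≤ K := by nlinarith
      have hq20 : 0 ≤ r ^ α * q := by positivity
      constructor
      · rw [hΦ]
        simp only
        rw [norm_mul, Complex.norm_cpow_real]
        have h1 : r ^ (α - 2) = r ^ α * r ^ (-(2 : ℝ)) := by
          rw [sub_eq_add_neg, Real.rpow_add hr]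
        rw [h1]
        have h2 : 0 < r ^ (-(2 : ℝ)) := Real.rpow_pos_of_pos hr _
        calc r ^ α * r ^ (-(2 : ℝ)) * q = (r ^ α * q) * r ^ (-(2 : ℝ)) := by ring
          _ ≤ (K + 2 * K ^ 2) * r ^ (-(2 : ℝ)) := by
            gcongr
            nlinarith
      · rw [(hder s hs).deriv]
        refine (norm_add_le _ _).trans ?_
        rw [norm_mul, norm_mul, norm_mul, norm_mul, norm_neg, norm_mul, norm_pow,
          Complex.norm_cpow_real, Complex.norm_cpow_real, Complex.norm_cpow_real,
          Complex.norm_real, Complex.norm_real, Real.norm_eq_abs, Real.norm_eq_abs,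
          abs_of_neg (show α - 2 < 0 by linarith), abs_of_pos (show 0 < α by linarith)]
        have h1 : r ^ (α - 2) * r ^ (α - 1) = r ^ α * r ^ (-(3 - α)) := by
          rw [← Real.rpow_add hr, ← Real.rpow_add hr]
          ring_nf
        have h2 : r ^ (α - 2 - 1) = r ^ (-(3 - α)) := by ring_nf
        rw [h2]
        have h3 : 0 < r ^ (-(3 - α)) := Real.rpow_pos_of_pos hr _
        calc -(α - 2) * r ^ (-(3 - α)) * q + r ^ (α - 2) * (α * r ^ (α - 1) * q ^ 2)
            = (-(α - 2) * q) * r ^ (-(3 - α)) + α * (r ^ α * q) * q * r ^ (-(3 - α)) := by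
              linear_combination α * q ^ 2 * h1
          _ ≤ (1 * K) * r ^ (-(3 - α)) + 2 * K * K * r ^ (-(3 - α)) := by
            gcongr
            linarith
          _ = _ := by ring)
  obtain ⟨C, hC⟩ := this
  refine ⟨C, fun t ht => (hC t ht).trans (le_of_eq ?_)⟩
  ring_nf

/-- The algebra behind `mlKernel_sub_exp_bound`, with r = |s|, A = |s|^(α−1), q = |1 + s^α|⁻¹, n =
|1 + s|⁻¹. Each monomial is a product of the bounded quantities q, A r q, r q, n, r n. In the last
bound one term carries no factor A, and `hrA` supplies it. -/
theorem symbol_bounds {A r q n K : ℝ} (hA : 0 < A) (hr : 0 < r) (hq : 0 ≤ q) (hn : 0 ≤ n)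
    (hqK : q ≤ K) (hArq : A * r * q ≤ K) (hrq : r * q ≤ 2 * K) (hn1 : n ≤ 1) (hrn : r * n ≤ 1)
    (hrA : r ^ 2 ≤ A * (1 + r ^ 2)) :
    (A + 1) * q * n * r ^ 2 ≤ 3 * K ∧
    (A / r * q * n + (A + 1) * (2 * A * q ^ 2 * n + q * n ^ 2)) * r ^ 2 ≤ 5 * K + 10 * K ^ 2 ∧
    (A / r * q * n + (A + 1) * (2 * A * q ^ 2 * n + q * n ^ 2)) * r ^ 2 ≤
      (5 * K + 10 * K ^ 2) * A := by
  have hK : 0 ≤ K := hq.trans hqK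
  have a1 : (A * r * q) * n ≤ K * 1 := by gcongr
  have a2 : (A * r * q) * (A * r * q) * n ≤ K * K * 1 := by gcongr
  have a3 : (A * r * q) * (r * q) * n ≤ K * (2 * K) * 1 := by gcongr
  have a4 : (A * r * q) * (r * n) * n ≤ K * 1 * 1 := by gcongr
  have a5 : (r * n) * (r * n) * q ≤ 1 * 1 * K := by gcongr
  have a6 : (A * r * q) * (r * n) ≤ K * 1 := by gcongr
  have a7 : (r * q) * (r * n) ≤ (2 * K) * 1 := by gcongr
  have a8 : (r * q) * n ≤ (2 * K) * 1 := by gcongr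
  have a9 : (A * r * q) * (r * n) * q ≤ K * 1 * K := by gcongr
  have a10 : (r * q) * (r * q) * n ≤ (2 * K) * (2 * K) * 1 := by gcongr
  have a11 : n * n * q ≤ 1 * 1 * K := by gcongr
  have a12 : r ^ 2 * (q * n ^ 2) ≤ A * (1 + r ^ 2) * (q * n ^ 2) := by gcongr
  have e : A / r * q * n * r ^ 2 = A * r * q * n := by field_simp
  refine ⟨?_, ?_, ?_⟩
  · linarith
  · have : (A / r * q * n + (A + 1) * (2 * A * q ^ 2 * n + q * n ^ 2)) * r ^ 2 =
        (A * r * q) * n + 2 * ((A * r * q) * (A * r * q) * n) + 2 * ((A * r * q) * (r * q) * n) +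
        (A * r * q) * (r * n) * n + (r * n) * (r * n) * q := by
      linear_combination e
    rw [this]
    linarith [sq_nonneg K]
  · have : (A / r * q * n + (A + 1) * (2 * A * q ^ 2 * n + q * n ^ 2)) * r ^ 2 =
        A * ((r * q) * n + 2 * ((A * r * q) * (r * n) * q) + 2 * ((r * q) * (r * q) * n) +
        (r * n) * (r * n) * q) + r ^ 2 * (q * n ^ 2) := by
      linear_combination e
    rw [this]
    have b : A * ((r * q) * n + 2 * ((A * r * q) * (r * n) * q) + 2 * ((r * q) * (r * q) * n) +
        (r * n) * (r * n) * q) ≤ A * (3 * K + 10 * K ^ 2) := by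
      refine mul_le_mul_of_nonneg_left ?_ hA.le
      linarith
    have c : A * (1 + r ^ 2) * (q * n ^ 2) ≤ A * (2 * K) := by
      have : A * (1 + r ^ 2) * (q * n ^ 2) = A * (n * n * q + (r * n) * (r * n) * q) := by ring
      rw [this]
      gcongr
      linarith
    linarith

theorem norm_inv_one_add_le {s : ℂ} (hs : 0 < s.re) :
    1 + s ≠ 0 ∧ ‖(1 + s)⁻¹‖ ≤ 1 ∧ ‖s‖ * ‖(1 + s)⁻¹‖ ≤ 1 := by
  have h1 : 1 ≤ ‖1 + s‖ := by
    have := Complex.re_le_norm (1 + s)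
    simp only [Complex.add_re, Complex.one_re] at this
    linarith
  have h2 : ‖s‖ ≤ ‖1 + s‖ := by
    rw [Complex.norm_def, Complex.norm_def]
    refine Real.sqrt_le_sqrt ?_
    rw [Complex.normSq_apply, Complex.normSq_apply]
    simp only [Complex.add_re, Complex.one_re, Complex.add_im, Complex.one_im, zero_add]
    nlinarith
  have h0 : 0 < ‖1 + s‖ := by linarith
  refine ⟨norm_pos_iff.1 h0, ?_, ?_⟩
  · rw [norm_inv]
    exact inv_le_one_of_one_le₀ h1
  · rw [norm_inv, ← div_eq_mul_inv, div_le_one h0]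
    exact h2

/-- E_α(−t^α) starts at 1, so its transform decays only like 1/s at infinity. Subtracting e^(−t)
removes the jump at 0: the transform becomes (s^(α−1) − 1)/((1 + s^α)(1 + s)), which is O(|s|⁻²).
Its derivative is bounded with exponents 2 and 3 − α, giving boundedness and decay respectively. -/
theorem mlKernel_sub_exp_bound (hα : 1 < α) (hα2 : α < 2) :
    ∃ C : ℝ, ∀ t : ℝ, 0 < t →
      |1 - Real.exp (-t) - mlKernel α 1 (1 + α) t| ≤ C ∧
      |1 - Real.exp (-t) - mlKernel α 1 (1 + α) t| ≤ C * t ^ (1 - α) := by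
  obtain ⟨K, hK0, hK⟩ := exists_norm_inv_one_add_cpow_le hα hα2
  set Φ : ℂ → ℂ := fun s =>
    (s ^ ((α - 1 : ℝ) : ℂ) - 1) * (1 + s ^ (α : ℂ))⁻¹ * (1 + s)⁻¹ with hΦ
  set Φ' : ℂ → ℂ := fun s =>
    (((α - 1 : ℝ) : ℂ) * s ^ ((α - 1 - 1 : ℝ) : ℂ) * (1 + s ^ (α : ℂ))⁻¹ +
      (s ^ ((α - 1 : ℝ) : ℂ) - 1) *
        (-(α * s ^ ((α - 1 : ℝ) : ℂ)) * ((1 + s ^ (α : ℂ))⁻¹) ^ 2)) * (1 + s)⁻¹ +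
    (s ^ ((α - 1 : ℝ) : ℂ) - 1) * (1 + s ^ (α : ℂ))⁻¹ * (-((1 + s)⁻¹) ^ 2) with hΦ'
  have hder : ∀ s : ℂ, 0 < s.re → HasDerivAt Φ (Φ' s) s := fun s hs => by
    have h1 := ((hasDerivAt_cpow_ofReal (α - 1) hs).sub_const 1).mul
      (hasDerivAt_inv_one_add_cpow hs (hK s hs).1)
    have h2 : HasDerivAt (fun s : ℂ => (1 + s)⁻¹) (-((1 + s)⁻¹) ^ 2) s := by
      have := ((hasDerivAt_id s).const_add 1).fun_inv (norm_inv_one_add_le hs).1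
      refine this.congr_deriv ?_
      simp [neg_div]
    exact h1.mul h2
  -- The maximum makes ψ vanish for t ≤ 0 while staying continuous, as Laplace inversion requires.
  set ψ : ℝ → ℝ := fun t => 1 - Real.exp (-max t 0) - mlKernel α 1 (1 + α) t with hψ
  have hψc : Continuous ψ := by
    have := continuous_mlKernel hα (show 1 < 1 + α by linarith) 1
    rw [hψ]
    fun_prop
  have hψ0 : ∀ t ≤ 0, ψ t = 0 := fun t ht => by
    simp [hψ, max_eq_right ht, mlKernel_of_nonpos _ _ _ ht]
  have hlap : ∀ c : ℝ, 1 < c → IntegrableOn (fun t => Real.exp (-(c * t)) * ψ t) (Ioi 0) ∧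
      ∫ t in Ioi 0, Real.exp (-(c * t)) * ψ t =
        (c ^ (α - 1) - 1) * (1 + c ^ α)⁻¹ * (1 + c)⁻¹ := fun c hc => by
    have hc0 : 0 < c := by linarith
    obtain ⟨i1, v1⟩ := laplace_mlKernel hα (show 0 < 1 + α by linarith) hc
    have i2 := integrable_exp_mul_rlKernel one_pos hc0
    have v2 := integral_exp_mul_rlKernel one_pos hc0
    have i3 := integrable_exp_mul_rlKernel one_pos (show 0 < 1 + c by linarith)
    have v3 := integral_exp_mul_rlKernel one_pos (show 0 < 1 + c by linarith)
    have heq : EqOn (fun t => Real.exp (-(c * t)) * ψ t) (fun t =>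
        Real.exp (-(c * t)) * rlKernel 1 t - Real.exp (-((1 + c) * t)) * rlKernel 1 t -
        Real.exp (-(c * t)) * mlKernel α 1 (1 + α) t) (Ioi 0) := fun t ht => by
      simp only [hψ]
      rw [rlKernel_one ht, max_eq_left (le_of_lt ht),
        show -((1 + c) * t) = -(c * t) + -t by ring, Real.exp_add]
      ring
    have i23 : IntegrableOn (fun t => Real.exp (-(c * t)) * rlKernel 1 t -
        Real.exp (-((1 + c) * t)) * rlKernel 1 t) (Ioi 0) := i2.sub i3
    refine ⟨(i23.sub i1).congr_fun heq.symm measurableSet_Ioi, ?_⟩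
    rw [setIntegral_congr_fun measurableSet_Ioi heq, integral_sub i23 i1,
      integral_sub i2 i3, v1, v2, v3, Real.rpow_neg_one, Real.rpow_neg_one]
    have h1 : c ^ α = c ^ (α - 1) * c := by
      rw [← Real.rpow_add_one hc0.ne', sub_add_cancel]
    have h2 : c ^ (α - (1 + α)) = c⁻¹ := by
      rw [show α - (1 + α) = -1 by ring, Real.rpow_neg_one]
    rw [h1, h2]
    have : 0 < c ^ (α - 1) := Real.rpow_pos_of_pos hc0 _
    field_simp
    ring
  have hΦc : ∀ c : ℝ, 1 < c → ((∫ t in Ioi 0, Real.exp (-(c * t)) * ψ t : ℝ) : ℂ) = Φ c := by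
    intro c hc
    have hc0 : (0 : ℝ) ≤ c := by linarith
    rw [(hlap c hc).2, hΦ]
    simp only
    rw [← Complex.ofReal_cpow hc0, ← Complex.ofReal_cpow hc0]
    push_cast
    rfl
  have hbd : ∀ s : ℂ, 0 < s.re →
      ‖Φ s‖ ≤ (5 * K + 10 * K ^ 2) * ‖s‖ ^ (-(2 : ℝ)) ∧
      ‖Φ' s‖ ≤ (5 * K + 10 * K ^ 2) * ‖s‖ ^ (-(2 : ℝ)) ∧
      ‖Φ' s‖ ≤ (5 * K + 10 * K ^ 2) * ‖s‖ ^ (-(3 - α)) := fun s hs => by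
    have hr : 0 < ‖s‖ := norm_pos_iff.2 fun h => by simp [h] at hs
    have hq := (hK s hs).2
    obtain ⟨-, hn1, hrn⟩ := norm_inv_one_add_le hs
    set r := ‖s‖ with hrdef
    set q := ‖(1 + s ^ (α : ℂ))⁻¹‖ with hqdef
    set n := ‖(1 + s)⁻¹‖ with hndef
    set A := r ^ (α - 1) with hAdef
    have hq0 : 0 ≤ q := norm_nonneg _
    have hn0 : 0 ≤ n := norm_nonneg _
    have hA : 0 < A := Real.rpow_pos_of_pos hr _
    have hrα : r ^ α = A * r := by
      rw [hAdef, ← Real.rpow_add_one hr.ne', sub_add_cancel]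
    rw [hrα] at hq
    have hAr : 0 < A * r := by positivity
    have hq1 : q ≤ K := by nlinarith
    have hq2 : A * r * q ≤ K := by nlinarith
    have hr1 : r ≤ 1 + A * r := by
      rw [← hrα]
      rcases le_total r 1 with h | h
      · have := Real.rpow_nonneg hr.le α
        linarith
      · have := Real.rpow_le_rpow_of_exponent_le h hα.le
        rw [Real.rpow_one] at this
        linarith
    have hrA : r ^ 2 ≤ A * (1 + r ^ 2) := by
      rcases le_total r 1 with h | h
      · have : r ^ 2 ≤ A := by
          rw [← Real.rpow_natCast, hAdef]
          exact Real.rpow_le_rpow_of_exponent_ge hr h (by norm_num; linarith)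
        nlinarith [sq_nonneg r]
      · have : 1 ≤ A := Real.one_le_rpow h (by linarith)
        nlinarith [sq_nonneg r]
    obtain ⟨b1, b2, b3⟩ := symbol_bounds hA hr hq0 hn0 hq1 hq2 (by nlinarith) hn1 hrn hrA
    have hs1 : ‖s ^ ((α - 1 : ℝ) : ℂ) - 1‖ ≤ A + 1 := by
      refine (norm_sub_le _ _).trans ?_
      rw [Complex.norm_cpow_real, norm_one]
    have hΦ'n : ‖Φ' s‖ ≤ A / r * q * n + (A + 1) * (2 * A * q ^ 2 * n + q * n ^ 2) := by
      rw [hΦ']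
      simp only
      refine (norm_add_le _ _).trans ?_
      rw [norm_mul, norm_mul, norm_mul, norm_neg, norm_pow]
      have h1 : ‖((α - 1 : ℝ) : ℂ) * s ^ ((α - 1 - 1 : ℝ) : ℂ) * (1 + s ^ (α : ℂ))⁻¹ +
          (s ^ ((α - 1 : ℝ) : ℂ) - 1) * (-(α * s ^ ((α - 1 : ℝ) : ℂ)) *
          ((1 + s ^ (α : ℂ))⁻¹) ^ 2)‖ ≤ A / r * q + (A + 1) * (2 * A * q ^ 2) := by
        refine (norm_add_le _ _).trans ?_
        rw [norm_mul, norm_mul, norm_mul, norm_mul, norm_neg, norm_mul, norm_pow,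
          Complex.norm_cpow_real, Complex.norm_cpow_real, Complex.norm_real, Complex.norm_real,
          Real.norm_eq_abs, Real.norm_eq_abs, abs_of_pos (show 0 < α - 1 by linarith),
          abs_of_pos (show 0 < α by linarith), Real.rpow_sub_one hr.ne' (α - 1)]
        gcongr
        have : 0 ≤ A / r := by positivity
        nlinarith
      calc _ ≤ (A / r * q + (A + 1) * (2 * A * q ^ 2)) * n + (A + 1) * q * n ^ 2 := by gcongr
        _ = _ := by ring
    have hr2 : r ^ (-(2 : ℝ)) = (r ^ 2)⁻¹ := by
      rw [Real.rpow_neg hr.le]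
      norm_cast
    have hr3 : r ^ (-(3 - α)) = A * (r ^ 2)⁻¹ := by
      rw [← hr2, hAdef, ← Real.rpow_add hr]
      ring_nf
    have hr20 : 0 < r ^ 2 := by positivity
    rw [hr2, hr3]
    refine ⟨?_, ?_, ?_⟩
    · rw [← div_eq_mul_inv, le_div_iff₀ hr20, hΦ]
      simp only
      rw [norm_mul, norm_mul]
      calc _ ≤ (A + 1) * q * n * r ^ 2 := by gcongr
        _ ≤ _ := b1
        _ ≤ _ := by nlinarith
    · rw [← div_eq_mul_inv, le_div_iff₀ hr20]
      exact (mul_le_mul_of_nonneg_right hΦ'n hr20.le).trans b2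
    · rw [← mul_assoc, ← div_eq_mul_inv, le_div_iff₀ hr20]
      exact (mul_le_mul_of_nonneg_right hΦ'n hr20.le).trans b3
  have hdiff : DifferentiableOn ℂ Φ {s | 0 < s.re} := fun s hs =>
    (hder s hs).differentiableAt.differentiableWithinAt
  obtain ⟨C1, hC1⟩ := abs_le_of_laplace (a := 2) one_lt_two hψc hψ0 (fun c hc => (hlap c hc).1)
    hdiff hΦc (fun s hs => ⟨(hbd s hs).1, by rw [(hder s hs).deriv]; exact (hbd s hs).2.1⟩)
  obtain ⟨C2, hC2⟩ := abs_le_of_laplace (a := 3 - α) (by linarith) hψc hψ0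
    (fun c hc => (hlap c hc).1)
    hdiff hΦc (fun s hs => ⟨(hbd s hs).1, by rw [(hder s hs).deriv]; exact (hbd s hs).2.2⟩)
  refine ⟨max C1 C2, fun t ht => ?_⟩
  have hψt : ψ t = 1 - Real.exp (-t) - mlKernel α 1 (1 + α) t := by
    simp [hψ, max_eq_left ht.le]
  rw [← hψt]
  constructor
  · have := hC1 t ht
    rw [sub_self, Real.rpow_zero, mul_one] at this
    exact this.trans (le_max_left _ _)
  · have := hC2 t ht
    rw [show 3 - α - 2 = 1 - α by ring] at this
    have h0 := Real.rpow_pos_of_pos ht (1 - α)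
    refine this.trans ?_
    gcongr
    exact le_max_right _ _

/-- Uniform bounds on the Mittag-Leffler kernels in terms of the eigenvalue parameter. -/
theorem exists_mlKernel_bounds (hα : 1 < α) (hα2 : α < 2) :
    ∃ C : ℝ, 0 < C ∧ ∀ l : ℝ, 0 < l →
      (∀ t : ℝ, |l * mlKernel α l (1 + α) t| ≤ C) ∧
      ∀ t : ℝ, 0 < t → l ^ (1 - 1 / α) * |1 - l * mlKernel α l (1 + α) t| ≤ C * t ^ (1 - α) ∧
        l * |mlKernel α l 2 t| ≤ C * t ^ (1 - α) := by
  obtain ⟨C1, h1⟩ := mlKernel_sub_exp_bound hα hα2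
  obtain ⟨C2, h2⟩ := mlKernel_two_bound hα hα2
  have hα0 : 0 < α := by linarith
  have hC1 : 0 ≤ C1 := (abs_nonneg _).trans (h1 1 one_pos).1
  refine ⟨max (C1 + 1) C2, lt_max_of_lt_left (by linarith), fun l hl => ?_⟩
  have hlp : 0 < l ^ (1 / α) := Real.rpow_pos_of_pos hl _
  have hsc : ∀ t, l * mlKernel α l (1 + α) t = mlKernel α 1 (1 + α) (l ^ (1 / α) * t) := fun t => by
    rw [mlKernel_scaling hα hl, show -(1 + α - 1) / α = -1 by field_simp; ring,
      Real.rpow_neg_one, mul_inv_cancel_left₀ hl.ne']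
  -- Since (1/α)(1 − α) = −(1 − 1/α), decay in the rescaled time is worth exactly the power
  -- l^(1−1/α), the part of l that u(0) ∈ V_{1/α} leaves uncovered.
  have hsplit : ∀ t, 0 < t → (l ^ (1 / α) * t) ^ (1 - α) =
      (l ^ (1 - 1 / α))⁻¹ * t ^ (1 - α) := fun t ht => by
    rw [Real.mul_rpow hlp.le ht.le, ← Real.rpow_mul hl.le, ← Real.rpow_neg hl.le]
    congr 2
    field_simp
    ring
  -- Needed to add back the exponential subtracted in `mlKernel_sub_exp_bound`.
  have hexp : ∀ t, 0 < t → Real.exp (-t) ≤ t ^ (1 - α) := fun t ht => by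
    rcases le_total t 1 with h | h
    · exact (Real.exp_le_one_iff.2 (by linarith)).trans
        (Real.one_le_rpow_of_pos_of_le_one_of_nonpos ht h (by linarith))
    · have h3 : t ^ (-(1 : ℝ)) ≤ t ^ (1 - α) := Real.rpow_le_rpow_of_exponent_le h (by linarith)
      refine le_trans ?_ h3
      rw [Real.rpow_neg_one, Real.exp_neg]
      exact inv_anti₀ ht (by linarith [Real.add_one_le_exp t])
  refine ⟨fun t => ?_, fun t ht => ⟨?_, ?_⟩⟩
  · rcases le_or_gt t 0 with h | h
    · rw [mlKernel_of_nonpos _ _ _ h, mul_zero, abs_zero]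
      exact (show (0 : ℝ) ≤ C1 + 1 by linarith).trans (le_max_left _ _)
    · have hτ : 0 < l ^ (1 / α) * t := by positivity
      rw [hsc]
      have h3 := abs_le.1 (h1 _ hτ).1
      have h4 := Real.exp_pos (-(l ^ (1 / α) * t))
      have h5 : Real.exp (-(l ^ (1 / α) * t)) ≤ 1 := Real.exp_le_one_iff.2 (by linarith)
      refine le_trans (abs_le.2 ⟨by linarith, by linarith⟩) (le_max_left (C1 + 1) C2)
  · have hτ : 0 < l ^ (1 / α) * t := by positivity
    rw [hsc]
    have h3 := (h1 _ hτ).2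
    have h4 := hexp _ hτ
    have h5 : |1 - mlKernel α 1 (1 + α) (l ^ (1 / α) * t)| ≤
        (C1 + 1) * (l ^ (1 / α) * t) ^ (1 - α) := by
      have h6 := abs_add_le (1 - Real.exp (-(l ^ (1 / α) * t)) -
        mlKernel α 1 (1 + α) (l ^ (1 / α) * t)) (Real.exp (-(l ^ (1 / α) * t)))
      rw [abs_of_pos (Real.exp_pos _)] at h6
      rw [show 1 - mlKernel α 1 (1 + α) (l ^ (1 / α) * t) = 1 - Real.exp (-(l ^ (1 / α) * t)) -
        mlKernel α 1 (1 + α) (l ^ (1 / α) * t) + Real.exp (-(l ^ (1 / α) * t)) by ring]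
      linarith
    rw [hsplit t ht] at h5
    have hp : 0 < l ^ (1 - 1 / α) := Real.rpow_pos_of_pos hl _
    have h0 := Real.rpow_pos_of_pos ht (1 - α)
    calc _ ≤ l ^ (1 - 1 / α) * ((C1 + 1) * ((l ^ (1 - 1 / α))⁻¹ * t ^ (1 - α))) := by gcongr
      _ = (C1 + 1) * t ^ (1 - α) := by field_simp
      _ ≤ _ := by gcongr; exact le_max_left _ _
  · have hτ : 0 < l ^ (1 / α) * t := by positivity
    have h3 := h2 _ hτ
    rw [hsplit t ht] at h3
    rw [mlKernel_scaling hα hl, abs_mul, abs_of_pos (Real.rpow_pos_of_pos hl _)]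
    have hp : 0 < l ^ (1 - 1 / α) := Real.rpow_pos_of_pos hl _
    have h0 := Real.rpow_pos_of_pos ht (1 - α)
    have h4 : l * l ^ (-((2 : ℝ) - 1) / α) = l ^ (1 - 1 / α) := by
      rw [show 1 - 1 / α = 1 + -(2 - 1) / α by ring, Real.rpow_add hl, Real.rpow_one]
    rw [← mul_assoc, h4]
    calc _ ≤ l ^ (1 - 1 / α) * (C2 * ((l ^ (1 - 1 / α))⁻¹ * t ^ (1 - α))) := by gcongr
      _ = C2 * t ^ (1 - α) := by field_simp
      _ ≤ _ := by gcongr; exact le_max_right _ _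

end SymbolBounds

/-! ### Test functions and the du Bois-Reymond lemma -/

/-- Smooth functions with compact support in `(0, T)`. -/
structure IsTestFun (T : ℝ) (η : ℝ → ℝ) : Prop where
  contDiff : ContDiff ℝ ∞ η
  compact : HasCompactSupport η
  subset : tsupport η ⊆ Ioo 0 T

namespace IsTestFun

variable {T : ℝ} {η ζ : ℝ → ℝ}

theorem deriv (h : IsTestFun T η) : IsTestFun T (deriv η) :=
  ⟨(contDiff_infty_iff_deriv.1 h.contDiff).2, h.compact.deriv,
    tsupport_deriv_subset.trans h.subset⟩

theorem hasDerivAt (h : IsTestFun T η) (t : ℝ) : HasDerivAt η (_root_.deriv η t) t :=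
  ((contDiff_infty_iff_deriv.1 h.contDiff).1 t).hasDerivAt

theorem continuous (h : IsTestFun T η) : Continuous η := h.contDiff.continuous

theorem eq_zero (h : IsTestFun T η) {t : ℝ} (ht : t ∉ Ioo 0 T) : η t = 0 :=
  image_eq_zero_of_notMem_tsupport fun h' => ht (h.subset h')

theorem sub_const_mul (h : IsTestFun T η) (h' : IsTestFun T ζ) (c : ℝ) :
    IsTestFun T (fun t => η t - c * ζ t) := by
  have hs : Function.support (fun t => η t - c * ζ t) ⊆ tsupport η ∪ tsupport ζ := fun t ht => by
    by_contra hcon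
    rw [mem_union, not_or] at hcon
    refine ht ?_
    simp only
    rw [image_eq_zero_of_notMem_tsupport hcon.1, image_eq_zero_of_notMem_tsupport hcon.2]
    simp
  refine ⟨h.contDiff.sub (contDiff_const.mul h'.contDiff),
    HasCompactSupport.of_support_subset_isCompact (h.compact.isCompact.union h'.compact.isCompact)
      hs, ?_⟩
  exact (closure_minimal hs ((isClosed_tsupport _).union (isClosed_tsupport _))).trans
    (union_subset h.subset h'.subset)

theorem exists_bound (h : IsTestFun T η) : ∃ C, ∀ t, ‖η t‖ ≤ C :=
  h.compact.exists_bound_of_continuous h.continuous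

theorem integrable (h : IsTestFun T η) : Integrable η :=
  h.continuous.integrable_of_hasCompactSupport h.compact

theorem setIntegral_eq (h : IsTestFun T η) : ∫ t in Ioo 0 T, η t = ∫ t, η t :=
  setIntegral_eq_integral_of_forall_compl_eq_zero fun _ ht => h.eq_zero ht

theorem integrableOn_mul (h : IsTestFun T η) {D : ℝ → ℝ} (hD : IntegrableOn D (Ioo 0 T)) :
    IntegrableOn (fun t => η t * D t) (Ioo 0 T) := by
  obtain ⟨C, hC⟩ := h.exists_bound
  exact hD.bdd_mul h.continuous.aestronglyMeasurable (Eventually.of_forall hC)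

/-- The primitive starting at the left end of the support; zero mean makes it vanish again to the
right of the support. -/
theorem exists_deriv_eq (h : IsTestFun T η) (h0 : ∫ t, η t = 0) :
    ∃ ζ, IsTestFun T ζ ∧ _root_.deriv ζ = η := by
  rcases (tsupport η).eq_empty_or_nonempty with he | hne
  · have : η = 0 := tsupport_eq_empty_iff.1 he
    exact ⟨0, ⟨contDiff_const, HasCompactSupport.zero, by simp [tsupport]⟩, by rw [this]; simp⟩
  obtain ⟨a, ha, ha'⟩ := h.compact.isCompact.exists_isLeast hne
  obtain ⟨b, hb, hb'⟩ := h.compact.isCompact.exists_isGreatest hne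
  have hz : ∀ t, t < a ∨ b < t → η t = 0 := fun t ht =>
    image_eq_zero_of_notMem_tsupport fun h' => by
      rcases ht with ht | ht
      · exact absurd (ha' h') (not_le.2 ht)
      · exact absurd (hb' h') (not_le.2 ht)
  have hd : ∀ t, HasDerivAt (fun t => ∫ s in a..t, η s) (η t) t := fun t =>
    (h.continuous.integral_hasStrictDerivAt a t).hasDerivAt
  have hder : _root_.deriv (fun t => ∫ s in a..t, η s) = η := funext fun t => (hd t).deriv
  have hsupp : Function.support (fun t => ∫ s in a..t, η s) ⊆ Icc a b := fun t ht => by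
    by_contra hcon
    refine ht ?_
    simp only
    rcases lt_or_ge t a with hta | hta
    · rw [intervalIntegral.integral_symm, intervalIntegral.integral_of_le hta.le,
        integral_Ioc_eq_integral_Ioo, setIntegral_congr_fun measurableSet_Ioo
          (fun s hs => hz s (Or.inl hs.2))]
      simp
    · have htb : b < t := not_le.1 fun h' => hcon ⟨hta, h'⟩
      rw [intervalIntegral.integral_of_le hta, ← integral_Icc_eq_integral_Ioc, ← h0]
      refine setIntegral_eq_integral_of_forall_compl_eq_zero fun s hs => hz s ?_
      by_contra hcon2
      push Not at hcon2
      exact hs ⟨hcon2.1, hcon2.2.trans htb.le⟩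
  refine ⟨fun t => ∫ s in a..t, η s, ⟨contDiff_infty_iff_deriv.2 ⟨fun t => (hd t).differentiableAt,
    by rw [hder]; exact h.contDiff⟩, HasCompactSupport.of_support_subset_isCompact isCompact_Icc
    hsupp, (closure_minimal hsupp isClosed_Icc).trans fun t ht =>
      ⟨(h.subset ha).1.trans_le ht.1, ht.2.trans_lt (h.subset hb).2⟩⟩, hder⟩

theorem exists_integral_eq_one (hT : 0 < T) : ∃ ρ, IsTestFun T ρ ∧ ∫ t, ρ t = 1 := by
  let b : ContDiffBump (T / 2) := ⟨T / 8, T / 4, by positivity, by linarith⟩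
  refine ⟨b.normed volume, ⟨b.contDiff_normed, b.hasCompactSupport_normed, ?_⟩, b.integral_normed⟩
  rw [b.tsupport_normed_eq, Real.closedBall_eq_Icc]
  intro t ht
  have : b.rOut = T / 4 := rfl
  rw [this] at ht
  exact ⟨by linarith [ht.1], by linarith [ht.2]⟩

end IsTestFun

section DuBoisReymond

variable {T : ℝ} {D : ℝ → ℝ}

/-- Subtracting (∫η) ρ from a test function η, with ∫ρ = 1, leaves a derivative of a test function;
hence D and the constant ∫ρD have the same pairing with η. -/
theorem ae_const_of_weak_deriv_eq_zero (hT : 0 < T) (hD : IntegrableOn D (Ioo 0 T))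
    (h : ∀ η, IsTestFun T η → ∫ t in Ioo 0 T, deriv η t * D t = 0) :
    ∃ c, ∀ᵐ t ∂(volume.restrict (Ioo 0 T)), D t = c := by
  obtain ⟨ρ, hρ, hρ1⟩ := IsTestFun.exists_integral_eq_one hT
  refine ⟨∫ t in Ioo 0 T, ρ t * D t, ?_⟩
  set c := ∫ t in Ioo 0 T, ρ t * D t with hc
  have hDc : IntegrableOn (fun t => D t - c) (Ioo 0 T) := hD.sub (integrableOn_const (by simp))
  have := isOpen_Ioo.ae_eq_zero_of_integral_contDiff_smul_eq_zero (f := fun t => D t - c)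
    (U := Ioo 0 T) (μ := volume) hDc.locallyIntegrableOn (fun η h1 h2 h3 => by
      have hη : IsTestFun T η := ⟨h1, h2, h3⟩
      obtain ⟨ζ, hζ, hζη⟩ := (hη.sub_const_mul hρ (∫ t, η t)).exists_deriv_eq (by
        rw [integral_sub hη.integrable (hρ.integrable.const_mul _), integral_const_mul, hρ1,
          mul_one, sub_self])
      have hz := h ζ hζ
      rw [hζη] at hz
      have hcalc : ∫ t in Ioo 0 T, (η t - (∫ t, η t) * ρ t) * D t =
          (∫ t in Ioo 0 T, η t * D t) - (∫ t, η t) * c := by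
        rw [hc, ← integral_const_mul, ← integral_sub (hη.integrableOn_mul hD)
          ((hρ.integrableOn_mul hD).const_mul _)]
        congr 1
        funext t
        ring
      rw [hcalc] at hz
      simp only [smul_eq_mul]
      rw [← setIntegral_eq_integral_of_forall_compl_eq_zero (s := Ioo 0 T)
        (fun t ht => by rw [hη.eq_zero ht, zero_mul])]
      simp only [mul_sub]
      rw [integral_sub (hη.integrableOn_mul hD) (hη.integrable.integrableOn.mul_const _),
        integral_mul_const, hη.setIntegral_eq]
      exact hz)
  rw [ae_restrict_iff' measurableSet_Ioo]
  filter_upwards [this] with t ht ht'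
  linarith [ht ht']

theorem ae_affine_of_weak_deriv2_eq_zero (hT : 0 < T) (hD : IntegrableOn D (Ioo 0 T))
    (h : ∀ η, IsTestFun T η → ∫ t in Ioo 0 T, deriv (deriv η) t * D t = 0) :
    ∃ a b, ∀ᵐ t ∂(volume.restrict (Ioo 0 T)), D t = a + b * t := by
  obtain ⟨ρ, hρ, hρ1⟩ := IsTestFun.exists_integral_eq_one hT
  set κ := ∫ t in Ioo 0 T, deriv ρ t * D t with hκ
  have hlin : IntegrableOn (fun t : ℝ => κ * t) (Ioo 0 T) :=
    (Continuous.integrableOn_Icc (by fun_prop)).mono_set Ioo_subset_Icc_self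
  -- If D = a + b t then κ = ∫ρ'D = −b by parts, so adding κ t removes the slope and reduces to the
  -- first-order lemma.
  obtain ⟨c, hc⟩ := ae_const_of_weak_deriv_eq_zero hT (D := fun t => D t + κ * t)
    (hD.add hlin) (fun η hη => by
      obtain ⟨ζ, hζ, hζη⟩ := (hη.sub_const_mul hρ (∫ t, η t)).exists_deriv_eq (by
        rw [integral_sub hη.integrable (hρ.integrable.const_mul _), integral_const_mul, hρ1,
          mul_one, sub_self])
      have hz := h ζ hζ
      have hd : deriv (fun t => η t - (∫ t, η t) * ρ t) =
          fun t => deriv η t - (∫ t, η t) * deriv ρ t := funext fun t =>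
        ((hη.hasDerivAt t).sub ((hρ.hasDerivAt t).const_mul _)).deriv
      rw [hζη, hd] at hz
      have hcalc : ∫ t in Ioo 0 T, (deriv η t - (∫ t, η t) * deriv ρ t) * D t =
          (∫ t in Ioo 0 T, deriv η t * D t) - (∫ t, η t) * κ := by
        rw [hκ, ← integral_const_mul, ← integral_sub (hη.deriv.integrableOn_mul hD)
          ((hρ.deriv.integrableOn_mul hD).const_mul _)]
        congr 1
        funext t
        ring
      rw [hcalc] at hz
      have hibp : ∫ t in Ioo 0 T, deriv η t * (κ * t) = -(κ * ∫ t, η t) := by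
        rw [setIntegral_eq_integral_of_forall_compl_eq_zero
          (fun t ht => by rw [hη.deriv.eq_zero ht, zero_mul])]
        have h1 : Integrable (fun t => deriv η t * (κ * t)) :=
          (hη.deriv.continuous.mul (by fun_prop)).integrable_of_hasCompactSupport
            hη.deriv.compact.mul_right
        have h2 : Integrable (fun t => η t * κ) := hη.integrable.mul_const _
        have h3 : Integrable (fun t => η t * (κ * t)) :=
          (hη.continuous.mul (by fun_prop)).integrable_of_hasCompactSupport
            hη.compact.mul_right
        have h4 := integral_eq_zero_of_hasDerivAt_of_integrable (f := fun t => η t * (κ * t))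
          (f' := fun t => deriv η t * (κ * t) + η t * κ) (fun t => by
            have h5 : HasDerivAt (fun t : ℝ => κ * t) κ t := by
              simpa using (hasDerivAt_id t).const_mul κ
            exact (hη.hasDerivAt t).mul h5) (h1.add h2) h3
        rw [integral_add h1 h2, integral_mul_const] at h4
        linarith
      simp only [mul_add]
      rw [integral_add (hη.deriv.integrableOn_mul hD) (hη.deriv.integrableOn_mul hlin), hibp]
      linarith)
  refine ⟨c, -κ, ?_⟩
  filter_upwards [hc] with t ht
  linarith

/-- Convolution with t is double integration, so its second distributional derivative is z: Fubini,
then an integration by parts from s to T for each fixed s. -/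
theorem integral_deriv2_mul_causalConv {z : ℝ → ℝ} (hz : IntegrableOn z (Ioo 0 T))
    {η : ℝ → ℝ} (hη : IsTestFun T η) :
    ∫ t in Ioo 0 T, deriv (deriv η) t * causalConv (rlKernel 2) z t =
      ∫ t in Ioo 0 T, η t * z t := by
  have h1 : ∀ t ∈ Ioo 0 T, deriv (deriv η) t * causalConv (rlKernel 2) z t =
      ∫ s in Ioo 0 T, deriv (deriv η) t * (rlKernel 2 (t - s) * z s) := fun t ht => by
    rw [integral_const_mul, causalConv]
    congr 1
    symm
    rw [← integral_indicator measurableSet_Ioo, ← integral_indicator measurableSet_Ioo]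
    congr 1
    funext s
    by_cases hs : s ∈ Ioo 0 t
    · have hs' : s ∈ Ioo 0 T := ⟨hs.1, hs.2.trans ht.2⟩
      rw [indicator_of_mem hs, indicator_of_mem hs', smul_eq_mul]
    · rw [indicator_of_notMem hs]
      by_cases hs' : s ∈ Ioo 0 T
      · rw [indicator_of_mem hs', rlKernel_of_nonpos, zero_mul]
        by_contra hcon
        exact hs ⟨hs'.1, by linarith⟩
      · rw [indicator_of_notMem hs']
  rw [setIntegral_congr_fun measurableSet_Ioo h1]
  have hint : Integrable (Function.uncurry fun t s =>
      deriv (deriv η) t * (rlKernel 2 (t - s) * z s))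
      ((volume.restrict (Ioo 0 T)).prod (volume.restrict (Ioo 0 T))) := by
    have h2 : Integrable (fun p : ℝ × ℝ => deriv (deriv η) p.1 * z p.2)
        ((volume.restrict (Ioo 0 T)).prod (volume.restrict (Ioo 0 T))) :=
      hη.deriv.deriv.integrable.integrableOn.mul_prod hz
    have h3 := h2.bdd_mul (f := fun p : ℝ × ℝ => rlKernel 2 (p.1 - p.2)) (c := rlKernel 2 T)
      (((continuous_rlKernel one_lt_two).comp
        (continuous_fst.sub continuous_snd)).aestronglyMeasurable) (by
        rw [Measure.prod_restrict]
        refine (ae_restrict_mem (measurableSet_Ioo.prod measurableSet_Ioo)).mono fun p hp => ?_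
        rw [Real.norm_eq_abs, abs_of_nonneg (rlKernel_nonneg two_pos _)]
        exact rlKernel_le_of_le one_le_two (by linarith [hp.1.2, hp.2.1]))
    refine h3.congr (Eventually.of_forall fun p => ?_)
    simp only [Function.uncurry]
    ring
  rw [integral_integral_swap hint]
  refine setIntegral_congr_fun measurableSet_Ioo fun s hs => ?_
  have h4 : ∫ t in Ioo 0 T, deriv (deriv η) t * (rlKernel 2 (t - s) * z s) =
      (∫ t in Ioo s T, deriv (deriv η) t * (t - s)) * z s := by
    rw [← integral_mul_const, ← integral_indicator measurableSet_Ioo,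
      ← integral_indicator measurableSet_Ioo]
    congr 1
    funext t
    by_cases ht : t ∈ Ioo s T
    · have ht' : t ∈ Ioo 0 T := ⟨hs.1.trans ht.1, ht.2⟩
      rw [indicator_of_mem ht, indicator_of_mem ht', rlKernel_two (sub_pos.2 ht.1)]
      ring
    · rw [indicator_of_notMem ht]
      by_cases ht' : t ∈ Ioo 0 T
      · rw [indicator_of_mem ht', rlKernel_of_nonpos, zero_mul, mul_zero]
        by_contra hcon
        exact ht ⟨by linarith, ht'.2⟩
      · rw [indicator_of_notMem ht']
  rw [h4]
  congr 1
  rw [← integral_Ioc_eq_integral_Ioo, ← intervalIntegral.integral_of_le hs.2.le]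
  have h5 : ∀ t, HasDerivAt (fun t => deriv η t * (t - s) - η t)
      (deriv (deriv η) t * (t - s)) t := fun t => by
    have h6 : HasDerivAt (fun t : ℝ => t - s) 1 t := (hasDerivAt_id t).sub_const s
    refine (((hη.deriv.hasDerivAt t).mul h6).sub (hη.hasDerivAt t)).congr_deriv ?_
    ring
  rw [intervalIntegral.integral_eq_sub_of_hasDerivAt (fun t _ => h5 t)
    ((hη.deriv.deriv.continuous.mul (by fun_prop)).intervalIntegrable _ _)]
  rw [hη.deriv.eq_zero (t := T) (by simp), hη.eq_zero (t := T) (by simp)]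
  simp

end DuBoisReymond

/-! ### Linearity and differentiation of causal convolutions -/

section CausalConvLinear

variable {F : Type*} [NormedAddCommGroup F] [NormedSpace ℝ F]

theorem integrableOn_causalConv_integrand {f : ℝ → ℝ} {g : ℝ → F} {t : ℝ} (hf : Continuous f)
    (hg : IntegrableOn g (Ioo 0 t)) : IntegrableOn (fun s => f (t - s) • g s) (Ioo 0 t) := by
  have h1 : Continuous fun s => f (t - s) := by fun_prop
  obtain ⟨C, hC⟩ := (isCompact_Icc (a := (0 : ℝ)) (b := t)).exists_bound_of_continuousOn
    h1.continuousOn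
  exact hg.bdd_smul C h1.aestronglyMeasurable
    ((ae_restrict_mem measurableSet_Ioo).mono fun s hs => hC s (Ioo_subset_Icc_self hs))

theorem causalConv_add {f : ℝ → ℝ} {g h : ℝ → F} {t : ℝ} (hf : Continuous f)
    (hg : IntegrableOn g (Ioo 0 t)) (hh : IntegrableOn h (Ioo 0 t)) :
    causalConv f (fun s => g s + h s) t = causalConv f g t + causalConv f h t := by
  simp only [causalConv, smul_add]
  exact integral_add (integrableOn_causalConv_integrand hf hg)
    (integrableOn_causalConv_integrand hf hh)

theorem causalConv_const_smul (f : ℝ → ℝ) (g : ℝ → F) (c t : ℝ) :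
    causalConv f (fun s => c • g s) t = c • causalConv f g t := by
  simp only [causalConv, smul_comm _ c]
  exact integral_smul _ _

theorem causalConv_const_mul_left (f : ℝ → ℝ) (g : ℝ → F) (c t : ℝ) :
    causalConv (fun s => c * f s) g t = c • causalConv f g t := by
  simp only [causalConv, mul_smul]
  exact integral_smul _ _

theorem causalConv_add_const_mul {f g h : ℝ → ℝ} {t : ℝ} (hf : Continuous f)
    (hg : IntegrableOn g (Ioo 0 t)) (hh : IntegrableOn h (Ioo 0 t)) (c : ℝ) :
    causalConv f (fun s => g s + c * h s) t = causalConv f g t + c * causalConv f h t := by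
  rw [causalConv_add hf hg (hh.const_mul c)]
  congr 1
  exact causalConv_const_smul f h c t

theorem causalConv_rlKernel_one (g : ℝ → F) (t : ℝ) :
    causalConv (rlKernel 1) g t = ∫ s in Ioo 0 t, g s := by
  refine setIntegral_congr_fun measurableSet_Ioo fun s hs => ?_
  rw [rlKernel_one (sub_pos.2 hs.2), one_smul]

theorem hasDerivAt_causalConv_rlKernel_one [CompleteSpace F] {g : ℝ → F} {T t : ℝ}
    (hg : ContinuousOn g (Icc 0 T)) (ht : t ∈ Ioo 0 T) :
    HasDerivAt (causalConv (rlKernel 1) g) (g t) t := by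
  have h1 : HasDerivAt (fun t => ∫ s in (0 : ℝ)..t, g s) (g t) t := by
    refine intervalIntegral.integral_hasDerivAt_right ?_ ?_ ?_
    · exact (hg.mono (Icc_subset_Icc_right ht.2.le)).intervalIntegrable_of_Icc ht.1.le
    · exact (hg.mono Ioo_subset_Icc_self).stronglyMeasurableAtFilter isOpen_Ioo t ht
    · exact hg.continuousAt (Icc_mem_nhds ht.1 ht.2)
  refine h1.congr_of_eventuallyEq ((lt_mem_nhds ht.1).mono fun s hs => ?_)
  simp only [causalConv_rlKernel_one]
  rw [intervalIntegral.integral_of_le hs.le, integral_Ioc_eq_integral_Ioo]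

end CausalConvLinear

/-! ### The scalar fractional equation -/

section FractionalEquation

variable {α T l : ℝ} {y z Fs : ℝ → ℝ}

/-- The function `y` minus its first order Taylor polynomial at `0`. -/
def taylorRem (T : ℝ) (y : ℝ → ℝ) (s : ℝ) : ℝ := y s - y 0 - s * derivWithin y (Icc 0 T) 0

theorem taylorRem_zero (T : ℝ) (y : ℝ → ℝ) : taylorRem T y 0 = 0 := by simp [taylorRem]

theorem continuousOn_taylorRem (hy : ContDiffOn ℝ 1 y (Icc 0 T)) :
    ContinuousOn (taylorRem T y) (Icc 0 T) :=
  (hy.continuousOn.sub continuousOn_const).sub (by fun_prop)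

theorem abs_taylorRem_le (hT : 0 < T) (hy : ContDiffOn ℝ 1 y (Icc 0 T)) {ε : ℝ} (hε : 0 < ε) :
    ∃ δ, 0 < δ ∧ δ < T ∧ ∀ s ∈ Ioo 0 δ, |taylorRem T y s| ≤ ε * s := by
  have hd := (hy.differentiableOn one_ne_zero 0 (left_mem_Icc.2 hT.le)).hasDerivWithinAt
  have h1 := hasDerivWithinAt_iff_isLittleO.1 hd
  have h2 := h1.def hε
  rw [eventually_nhdsWithin_iff, Metric.eventually_nhds_iff] at h2
  obtain ⟨δ, hδ, h3⟩ := h2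
  refine ⟨min δ (T / 2), by positivity, (min_le_right _ _).trans_lt (by linarith), fun s hs => ?_⟩
  have h4 := h3 (y := s) (by
    rw [Real.dist_eq, sub_zero, abs_of_pos hs.1]
    exact hs.2.trans_le (min_le_left _ _)) ⟨hs.1.le, by
      have := hs.2.trans_le (min_le_right _ _)
      linarith⟩
  simpa [taylorRem, abs_of_pos hs.1] using h4

/-- Both sides have the same second distributional derivative, so they differ by a + b t. Both are
o(t) at 0: on the left the Taylor remainder is o(s) and the kernel is integrable, on the right the
value is at most t ∫₀ᵗ |z|. Hence a = b = 0. -/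
theorem causalConv_eq_of_hasFracDeriv (hα2 : α < 2) (hT : 0 < T)
    (hy : ContDiffOn ℝ 1 y (Icc 0 T)) (h : HasFracDeriv α T y z) :
    ∀ t ∈ Ioo 0 T, causalConv (rlKernel (2 - α)) (taylorRem T y) t =
      causalConv (rlKernel 2) z t := by
  obtain ⟨hz, hw⟩ := h
  have hα0 : 0 < 2 - α := by linarith
  set w := taylorRem T y with hwdef
  have hwc : ContinuousOn w (Icc 0 T) := continuousOn_taylorRem hy
  have hG : ContinuousOn (causalConv (rlKernel (2 - α)) w) (Icc 0 T) :=
    continuousOn_causalConv hT (integrableOn_rlKernel hα0 T) hwc (taylorRem_zero T y)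
  have hZ : ContinuousOn (causalConv (rlKernel 2) z) (Icc 0 T) := by
    rw [show causalConv (rlKernel 2) z = causalConv z (rlKernel 2) from
      funext fun t => causalConv_comm _ _ _]
    exact continuousOn_causalConv hT hz (continuous_rlKernel one_lt_two).continuousOn
      (rlKernel_of_nonpos le_rfl)
  have hGi := (hG.integrableOn_Icc (μ := volume)).mono_set (Ioo_subset_Icc_self (a := 0) (b := T))
  have hZi := (hZ.integrableOn_Icc (μ := volume)).mono_set (Ioo_subset_Icc_self (a := 0) (b := T))
  obtain ⟨a, b, hab⟩ := ae_affine_of_weak_deriv2_eq_zero hT (hGi.sub hZi) (fun η hη => by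
    have h1 := hw η hη.contDiff hη.compact hη.subset
    have h2 : ∀ t, (Real.Gamma (2 - α))⁻¹ • ∫ s in Ioo 0 t, (t - s) ^ (1 - α) •
        (y s - y 0 - s • derivWithin y (Icc 0 T) 0) = causalConv (rlKernel (2 - α)) w t :=
      fun t => by
        rw [← integral_smul]
        refine setIntegral_congr_fun measurableSet_Ioo fun s hs => ?_
        simp only [smul_eq_mul, hwdef, taylorRem]
        rw [rlKernel_of_pos (sub_pos.2 hs.2), show 2 - α - 1 = 1 - α by ring]
        ring
    simp only [h2] at h1
    simp only [smul_eq_mul] at h1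
    have h3 := integral_deriv2_mul_causalConv hz hη
    simp only [Pi.sub_apply, mul_sub]
    rw [integral_sub (hη.deriv.deriv.integrableOn_mul hGi) (hη.deriv.deriv.integrableOn_mul hZi),
      h1, h3, sub_self])
  have heq : EqOn (fun t => causalConv (rlKernel (2 - α)) w t - causalConv (rlKernel 2) z t)
      (fun t => a + b * t) (Ioo 0 T) :=
    Measure.eqOn_open_of_ae_eq hab isOpen_Ioo ((hG.sub hZ).mono Ioo_subset_Icc_self)
      (by fun_prop)
  set C0 := ∫ s in Ioo 0 T, rlKernel (2 - α) s with hC0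
  have hsmall : ∀ ε, 0 < ε → ∃ δ, 0 < δ ∧ δ < T ∧ ∀ t ∈ Ioo 0 δ, |a + b * t| ≤ ε * t := by
    intro ε hε
    have hC0' : 0 ≤ C0 := integral_nonneg fun s => rlKernel_nonneg hα0 s
    -- C0 is the mass of the kernel on (0, T); using C0 + 1 avoids dividing by zero.
    obtain ⟨δ₁, hδ₁, hδ₁T, hδ₁w⟩ := abs_taylorRem_le hT hy
      (show 0 < ε / (2 * (C0 + 1)) by positivity)
    have hprim : ContinuousOn (fun x => ∫ t in Ioc 0 x, |z t|) (Icc 0 T) :=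
      intervalIntegral.continuousOn_primitive (by
        rw [integrableOn_Icc_iff_integrableOn_Ioo]
        exact hz.norm)
    have hp0 := (Metric.continuousWithinAt_iff.1 (hprim 0 (left_mem_Icc.2 hT.le))) (ε / 2)
      (by positivity)
    obtain ⟨δ₂, hδ₂, hp⟩ := hp0
    refine ⟨min δ₁ δ₂, lt_min hδ₁ hδ₂, (min_le_left _ _).trans_lt hδ₁T, fun t ht => ?_⟩
    have ht1 : t < δ₁ := ht.2.trans_le (min_le_left _ _)
    have ht2 : t < δ₂ := ht.2.trans_le (min_le_right _ _)
    have htT : t < T := ht1.trans hδ₁T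
    have he : _ - _ = a + b * t := heq ⟨ht.1, htT⟩
    rw [← he]
    have hb1 : |causalConv (rlKernel (2 - α)) w t| ≤ ε / 2 * t := by
      rw [causalConv_comm, causalConv]
      have h1 : ‖∫ s in Ioo 0 t, w (t - s) • rlKernel (2 - α) s‖ ≤
          ∫ s in Ioo 0 t, ε / (2 * (C0 + 1)) * t * rlKernel (2 - α) s := by
        refine norm_integral_le_of_norm_le ((integrableOn_rlKernel hα0 t).const_mul _)
          ((ae_restrict_mem measurableSet_Ioo).mono fun s hs => ?_)
        rw [norm_smul, Real.norm_eq_abs, Real.norm_eq_abs, abs_of_nonneg (rlKernel_nonneg hα0 s)]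
        refine mul_le_mul_of_nonneg_right ?_ (rlKernel_nonneg hα0 s)
        refine (hδ₁w (t - s) ⟨by linarith [hs.2], by linarith [hs.1]⟩).trans ?_
        have : t - s ≤ t := by linarith [hs.1]
        gcongr
      rw [integral_const_mul, Real.norm_eq_abs] at h1
      refine h1.trans ?_
      have h2 : ∫ s in Ioo 0 t, rlKernel (2 - α) s ≤ C0 :=
        setIntegral_mono_set (integrableOn_rlKernel hα0 T)
          (Eventually.of_forall fun s => rlKernel_nonneg hα0 s)
          (Ioo_subset_Ioo_right htT.le).eventuallyLE
      have ht0 := ht.1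
      calc ε / (2 * (C0 + 1)) * t * ∫ s in Ioo 0 t, rlKernel (2 - α) s
          ≤ ε / (2 * (C0 + 1)) * t * (C0 + 1) := by gcongr; linarith
        _ = ε / 2 * t := by field_simp
    have hb2 : |causalConv (rlKernel 2) z t| ≤ ε / 2 * t := by
      have h1 : ‖∫ s in Ioo 0 t, rlKernel 2 (t - s) • z s‖ ≤ ∫ s in Ioo 0 t, t * |z s| := by
        refine norm_integral_le_of_norm_le (((hz.mono_set
          (Ioo_subset_Ioo_right htT.le)).norm).const_mul t)
          ((ae_restrict_mem measurableSet_Ioo).mono fun s hs => ?_)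
        rw [norm_smul, Real.norm_eq_abs, Real.norm_eq_abs, rlKernel_two (sub_pos.2 hs.2),
          abs_of_pos (sub_pos.2 hs.2)]
        refine mul_le_mul_of_nonneg_right ?_ (abs_nonneg _)
        linarith [hs.1]
      rw [integral_const_mul, Real.norm_eq_abs] at h1
      have h2 := hp (x := t) ⟨ht.1.le, htT.le⟩ (by
        rw [Real.dist_eq, sub_zero, abs_of_pos ht.1]
        exact ht2)
      simp only [Ioc_self, Measure.restrict_empty, integral_zero_measure] at h2
      rw [Real.dist_eq, sub_zero, integral_Ioc_eq_integral_Ioo] at h2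
      have h3 := (le_abs_self _).trans h2.le
      refine h1.trans ?_
      have := mul_le_mul_of_nonneg_left h3 ht.1.le
      linarith
    have := abs_sub (causalConv (rlKernel (2 - α)) w t) (causalConv (rlKernel 2) z t)
    linarith
  have hlim : ∀ ε, 0 < ε → |a| ≤ 0 ∧ |b| ≤ ε := by
    intro ε hε
    obtain ⟨δ, hδ, -, hδ'⟩ := hsmall ε hε
    have ha : |a| ≤ 0 := by
      refine le_of_forall_pos_le_add fun e he => ?_
      set t := min (δ / 2) (e / (|b| + ε)) with ht
      have hpos : 0 < |b| + ε := by positivity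
      have ht0 : 0 < t := by positivity
      have h1 := hδ' t ⟨ht0, (min_le_left _ _).trans_lt (by linarith)⟩
      have h2 : t * (|b| + ε) ≤ e := by
        rw [← le_div_iff₀ hpos]
        exact min_le_right _ _
      have h3 : |a| ≤ |a + b * t| + |b| * t := by
        have := abs_sub (a + b * t) (b * t)
        rw [add_sub_cancel_right, abs_mul b t, abs_of_pos ht0] at this
        exact this
      linarith
    refine ⟨ha, ?_⟩
    have ha0 : a = 0 := abs_nonpos_iff.1 ha
    have h1 := hδ' (δ / 2) ⟨by linarith, by linarith⟩
    rw [ha0, zero_add, abs_mul, abs_of_pos (show 0 < δ / 2 by linarith)] at h1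
    exact le_of_mul_le_mul_right h1 (by linarith)
  have ha0 : a = 0 := abs_nonpos_iff.1 (hlim 1 one_pos).1
  have hb0 : b = 0 := abs_nonpos_iff.1 (le_of_forall_pos_le_add fun e he => by
    rw [zero_add]
    exact (hlim e he).2)
  intro t ht
  have := heq ht
  simp only [ha0, hb0, zero_mul, add_zero] at this
  exact sub_eq_zero.1 this

/-- With k_β the Mittag-Leffler kernel, g_β the Riemann–Liouville kernel and w the Taylor remainder,
convolving g_{2−α} * w = g₂ * z with k_α gives k₂ * w = k_{2+α} * z. Since g₂ = k₂ + l k_{2+α}, this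
becomes g₂ * w = k_{2+α} * (z + l w), where z + l w is Fs minus l times the Taylor polynomial.
Stripping one integration from both sides ends the proof. -/
theorem taylorRem_volterra (hα : 1 < α) (hα2 : α < 2) (hT : 0 < T)
    (hy : ContDiffOn ℝ 1 y (Icc 0 T)) (h : HasFracDeriv α T y z)
    (hF : IntegrableOn Fs (Ioo 0 T))
    (heq : ∀ᵐ t ∂(volume.restrict (Ioo 0 T)), z t + l * y t = Fs t) :
    ∀ t ∈ Ioo 0 T, causalConv (rlKernel 1) (taylorRem T y) t =
      causalConv (mlKernel α l (1 + α))
        (fun s => Fs s + -(l * y 0 + l * derivWithin y (Icc 0 T) 0 * s)) t := by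
  have hα0 : 0 < 2 - α := by linarith
  have hαp : 0 < α := by linarith
  set w := taylorRem T y with hwdef
  set V : ℝ → ℝ := fun s => Fs s + -(l * y 0 + l * derivWithin y (Icc 0 T) 0 * s) with hV
  have hwc : ContinuousOn w (Icc 0 T) := continuousOn_taylorRem hy
  have hwi : IntegrableOn w (Ioo 0 T) := hwc.integrableOn_Icc.mono_set Ioo_subset_Icc_self
  have hVi : IntegrableOn V (Ioo 0 T) := hF.add
    ((Continuous.integrableOn_Icc (by fun_prop)).mono_set Ioo_subset_Icc_self)
  have h1 := causalConv_eq_of_hasFracDeriv hα2 hT hy h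
  have hbdd : ∀ {β : ℝ}, 1 < β → ∀ t, ∃ C, ∀ s ∈ Ioo 0 t, |mlKernel α l β s| ≤ C := fun hβ t => by
    obtain ⟨C, hC⟩ := (isCompact_Icc (a := (0 : ℝ)) (b := t)).exists_bound_of_continuousOn
      (continuous_mlKernel hα hβ l).continuousOn
    exact ⟨C, fun s hs => hC s (Ioo_subset_Icc_self hs)⟩
  have hmi : ∀ {β : ℝ}, 1 < β → ∀ t, IntegrableOn (mlKernel α l β) (Ioo 0 t) := fun hβ t =>
    (continuous_mlKernel hα hβ l).integrableOn_Icc.mono_set Ioo_subset_Icc_self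
  have hk : ∀ μ β : ℝ, 0 < μ → 0 < β →
      causalConv (mlKernel α l β) (rlKernel μ) = mlKernel α l (μ + β) := fun μ β hμ hβ => by
    rw [← causalConv_rlKernel_mlKernel hα hμ hβ l]
    exact funext fun t => causalConv_comm _ _ _
  have h2 : ∀ t ∈ Ioo 0 T, causalConv (mlKernel α l 2) w t =
      causalConv (mlKernel α l (2 + α)) z t := fun t ht => by
    obtain ⟨C, hC⟩ := hbdd hα t
    have hsub : Ioo 0 t ⊆ Ioo 0 T := Ioo_subset_Ioo_right ht.2.le
    have e1 := causalConv_assoc (hmi hα t) (integrableOn_rlKernel hα0 t) (hwi.mono_set hsub) hC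
    have e2 := causalConv_assoc (hmi hα t) (integrableOn_rlKernel two_pos t)
      (h.1.mono_set hsub) hC
    rw [hk _ _ hα0 hαp, sub_add_cancel] at e1
    rw [hk _ _ two_pos hαp] at e2
    rw [← e1, ← e2]
    exact causalConv_congr (fun s _ => rfl) (fun s hs => h1 s ⟨hs.1, hs.2.trans ht.2⟩)
  have h3 : ∀ t ∈ Ioo 0 T, causalConv (rlKernel 2) w t =
      causalConv (mlKernel α l (2 + α)) V t := fun t ht => by
    have hsub : Ioo 0 t ⊆ Ioo 0 T := Ioo_subset_Ioo_right ht.2.le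
    have hc := continuous_mlKernel hα (show 1 < 2 + α by linarith) l
    have e1 : causalConv (rlKernel 2) w t = causalConv (mlKernel α l 2) w t +
        l * causalConv (mlKernel α l (2 + α)) w t := by
      have i1 := integrableOn_causalConv_integrand (continuous_mlKernel hα one_lt_two l)
        (hwi.mono_set hsub)
      have i2 := integrableOn_causalConv_integrand hc (hwi.mono_set hsub)
      simp only [causalConv]
      rw [← integral_const_mul, ← integral_add i1 (i2.const_mul l)]
      congr 1
      funext s
      rw [← mlKernel_add hα two_pos l]
      simp only [smul_eq_mul]
      ring
    have e2 : causalConv (mlKernel α l (2 + α)) V t =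
        causalConv (mlKernel α l (2 + α)) z t + l * causalConv (mlKernel α l (2 + α)) w t := by
      rw [← causalConv_add_const_mul hc (h.1.mono_set hsub) (hwi.mono_set hsub)]
      refine causalConv_congr_ae ht.2.le ?_
      filter_upwards [heq] with s hs
      simp only [hV, hwdef, taylorRem]
      rw [← hs]
      ring
    rw [e1, e2, h2 t ht]
  have hcα := continuous_mlKernel hα (show 1 < 1 + α by linarith) l
  have hR : ContinuousOn (causalConv (mlKernel α l (1 + α)) V) (Icc 0 T) := by
    rw [show causalConv (mlKernel α l (1 + α)) V = causalConv V (mlKernel α l (1 + α)) from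
      funext fun t => causalConv_comm _ _ _]
    exact continuousOn_causalConv hT hVi hcα.continuousOn (mlKernel_of_nonpos _ _ _ le_rfl)
  have hL : ContinuousOn (causalConv (rlKernel 1) w) (Icc 0 T) :=
    continuousOn_causalConv hT (integrableOn_rlKernel one_pos T) hwc (taylorRem_zero T y)
  -- Both sides are written as primitives of continuous functions, so that differentiating removes
  -- one convolution with 1.
  have h4 : ∀ t ∈ Ioo 0 T, causalConv (rlKernel 1) (causalConv (rlKernel 1) w) t =
      causalConv (rlKernel 1) (causalConv (mlKernel α l (1 + α)) V) t := fun t ht => by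
    have hsub : Ioo 0 t ⊆ Ioo 0 T := Ioo_subset_Ioo_right ht.2.le
    have hC : ∀ s ∈ Ioo 0 t, |rlKernel 1 s| ≤ 1 := fun s hs => by
      rw [rlKernel_one hs.1, abs_one]
    have i1 := integrableOn_rlKernel one_pos t
    rw [causalConv_assoc i1 i1 (hwi.mono_set hsub) hC,
      causalConv_assoc i1 (hmi (by linarith) t) (hVi.mono_set hsub) hC,
      causalConv_rlKernel one_pos one_pos, causalConv_rlKernel_mlKernel hα one_pos (by linarith),
      show (1 : ℝ) + 1 = 2 by norm_num, ← add_assoc, show (1 : ℝ) + 1 = 2 by norm_num, h3 t ht]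
  intro t ht
  have d1 := hasDerivAt_causalConv_rlKernel_one hL ht
  have d2 := hasDerivAt_causalConv_rlKernel_one hR ht
  refine d1.unique (d2.congr_of_eventuallyEq ?_)
  filter_upwards [Ioo_mem_nhds ht.1 ht.2] with s hs
  exact h4 s hs

/-- The scalar fractional equation `𝔻_t^α y + l y = F` in resolved form. -/
theorem hasDerivAt_causalConv_mlKernel (hα : 1 < α) (hα2 : α < 2) (hT : 0 < T)
    (hy : ContDiffOn ℝ 1 y (Icc 0 T)) (h : HasFracDeriv α T y z)
    (hF : IntegrableOn Fs (Ioo 0 T))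
    (heq : ∀ᵐ t ∂(volume.restrict (Ioo 0 T)), z t + l * y t = Fs t) {t : ℝ} (ht : t ∈ Ioo 0 T) :
    HasDerivAt (causalConv (fun s => l * mlKernel α l (1 + α) s) Fs)
      (l * y t - l * y 0 * (1 - l * mlKernel α l (1 + α) t) -
        l * derivWithin y (Icc 0 T) 0 * mlKernel α l 2 t) t := by
  set y1 := derivWithin y (Icc 0 T) 0 with hy1
  have hv := taylorRem_volterra hα hα2 hT hy h hF heq
  have hc1 := continuous_mlKernel hα (show 1 < 1 + α by linarith) l
  have hc2 := continuous_mlKernel hα (show 1 < 2 + α by linarith) l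
  have d1 := hasDerivAt_causalConv_rlKernel_one (continuousOn_taylorRem hy) ht
  have d2 := hasDerivAt_causalConv_rlKernel_one hc1.continuousOn ht
  have d3 := hasDerivAt_causalConv_rlKernel_one hc2.continuousOn ht
  -- The polynomial l y(0) + l y'(0) s is a combination of Riemann–Liouville kernels, so its
  -- convolution is again a Mittag-Leffler kernel and a primitive of one of lower index.
  have hlin : ∀ s ∈ Ioo 0 T, causalConv (fun s => l * mlKernel α l (1 + α) s) Fs s =
      l * causalConv (rlKernel 1) (taylorRem T y) s +
      l * (l * y 0) * causalConv (rlKernel 1) (mlKernel α l (1 + α)) s +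
      l * (l * y1) * causalConv (rlKernel 1) (mlKernel α l (2 + α)) s := fun s hs => by
    have hsub : Ioo 0 s ⊆ Ioo 0 T := Ioo_subset_Ioo_right hs.2.le
    rw [causalConv_const_mul_left, smul_eq_mul, hv s hs]
    have e1 : causalConv (mlKernel α l (1 + α)) (fun s => Fs s + -(l * y 0 + l * y1 * s)) s =
        causalConv (mlKernel α l (1 + α)) Fs s +
        -(l * y 0) * causalConv (mlKernel α l (1 + α)) (rlKernel 1) s +
        -(l * y1) * causalConv (mlKernel α l (1 + α)) (rlKernel 2) s := by
      have i1 := integrableOn_rlKernel one_pos s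
      have i2 := integrableOn_rlKernel two_pos s
      have i3 : IntegrableOn (fun r => Fs r + -(l * y 0) * rlKernel 1 r) (Ioo 0 s) :=
        (hF.mono_set hsub).add (i1.const_mul _)
      rw [← causalConv_add_const_mul hc1 (hF.mono_set hsub) i1,
        ← causalConv_add_const_mul hc1 i3 i2]
      refine causalConv_congr (fun r _ => rfl) (fun r hr => ?_)
      rw [rlKernel_one hr.1, rlKernel_two hr.1]
      ring
    rw [e1, causalConv_comm _ (rlKernel 1), causalConv_comm _ (rlKernel 2),
      causalConv_rlKernel_mlKernel hα two_pos (by linarith),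
      causalConv_rlKernel_mlKernel hα one_pos (show 0 < 2 + α by linarith),
      show 2 + (1 + α) = 1 + (2 + α) by ring]
    ring
  have d := ((d1.const_mul l).add (d2.const_mul (l * (l * y 0)))).add
    (d3.const_mul (l * (l * y1)))
  -- Replaces t − l k_{2+α}(t) by k₂(t) in the y'(0) term.
  have hml := mlKernel_add hα two_pos l t
  rw [rlKernel_two ht.1] at hml
  refine (d.congr_of_eventuallyEq ?_).congr_deriv ?_
  · filter_upwards [Ioo_mem_nhds ht.1 ht.2] with s hs
    exact hlin s hs
  · simp only [taylorRem]
    rw [← hy1]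
    linear_combination (l * y1) * hml

end FractionalEquation

/-! ### Spectral theory of A -/

namespace DirichletForm

section Spectral

variable {X : Type*} [MeasurableSpace X] {m : Measure X} (E : DirichletForm m)

/-- The form domain with the inner product `𝓔_A(u, v) + (u, v)`. -/
def FormSpace : Type _ := E.domain

instance : AddCommGroup E.FormSpace := inferInstanceAs (AddCommGroup E.domain)

instance : Module ℝ E.FormSpace := inferInstanceAs (Module ℝ E.domain)

/-- The inclusion of the form domain in `L²`. -/
def FormSpace.incl : E.FormSpace →ₗ[ℝ] Lp ℝ 2 m := E.domain.subtype

/-- The form, on the form domain with its own inner product. -/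
def FormSpace.form : E.FormSpace →ₗ[ℝ] E.FormSpace →ₗ[ℝ] ℝ := E.form

theorem FormSpace.incl_injective : Function.Injective (FormSpace.incl E) :=
  Subtype.coe_injective

instance formSpaceCore : InnerProductSpace.Core ℝ E.FormSpace where
  inner u v := FormSpace.form E u v + inner ℝ (FormSpace.incl E u) (FormSpace.incl E v)
  conj_inner_symm u v := by
    simp only [conj_trivial]
    rw [real_inner_comm]
    congr 1
    exact E.symm v u
  re_inner_nonneg u := by
    simp only [RCLike.re_to_real]
    exact add_nonneg (E.nonneg u) real_inner_self_nonneg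
  add_left u v w := by
    simp only [map_add, LinearMap.add_apply, inner_add_left]
    ring
  smul_left u v c := by
    simp only [map_smul, LinearMap.smul_apply, real_inner_smul_left, conj_trivial, smul_eq_mul]
    ring
  definite u hu := by
    have h1 : (0 : ℝ) ≤ FormSpace.form E u u := E.nonneg u
    have h2 : (0 : ℝ) ≤ inner ℝ (FormSpace.incl E u) (FormSpace.incl E u) := real_inner_self_nonneg
    have h3 : inner ℝ (FormSpace.incl E u) (FormSpace.incl E u) = 0 := by linarith
    refine FormSpace.incl_injective E ?_
    rw [inner_self_eq_zero.1 h3, map_zero]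

instance : NormedAddCommGroup E.FormSpace :=
  InnerProductSpace.Core.toNormedAddCommGroup (𝕜 := ℝ)

instance : InnerProductSpace ℝ E.FormSpace := InnerProductSpace.ofCore _

theorem FormSpace.inner_def (u v : E.FormSpace) : inner ℝ u v =
    FormSpace.form E u v + inner ℝ (FormSpace.incl E u) (FormSpace.incl E v) := rfl

theorem FormSpace.norm_sq (u : E.FormSpace) :
    ‖u‖ ^ 2 = FormSpace.form E u u + ‖FormSpace.incl E u‖ ^ 2 := by
  rw [← real_inner_self_eq_norm_sq, FormSpace.inner_def, real_inner_self_eq_norm_sq]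

/-- Closedness of the form, taken with l = 1, is precisely this completeness. -/
instance : CompleteSpace E.FormSpace := by
  refine Metric.complete_of_cauchySeq_tendsto fun u hu => ?_
  obtain ⟨v, hv⟩ : ∃ v : E.FormSpace, Tendsto (fun j => FormSpace.form E (u j - v) (u j - v) +
      1 * ‖FormSpace.incl E (u j - v)‖ ^ 2) atTop (𝓝 0) := E.closed 1 one_pos u (fun ε hε => by
    obtain ⟨N, hN⟩ := Metric.cauchySeq_iff.1 hu (√ε) (Real.sqrt_pos.2 hε)
    refine ⟨N, fun j hj k hk => ?_⟩
    have h1 := hN j hj k hk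
    rw [dist_eq_norm, Real.lt_sqrt (norm_nonneg _), FormSpace.norm_sq] at h1
    rw [one_mul]
    exact h1)
  refine ⟨v, tendsto_iff_norm_sub_tendsto_zero.2 ?_⟩
  have h2 := (Real.continuous_sqrt.tendsto 0).comp hv
  rw [Real.sqrt_zero] at h2
  refine h2.congr fun n => ?_
  rw [Function.comp_apply, one_mul]
  rw [← FormSpace.norm_sq, Real.sqrt_sq (norm_nonneg _)]

/-- The inclusion of the form domain in `L²` as a bounded operator. -/
def inclL : E.FormSpace →L[ℝ] Lp ℝ 2 m :=
  (FormSpace.incl E).mkContinuous 1 fun u => by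
    rw [one_mul]
    refine le_of_sq_le_sq ?_ (norm_nonneg _)
    rw [FormSpace.norm_sq]
    have : (0 : ℝ) ≤ FormSpace.form E u u := E.nonneg u
    linarith

/-- The resolvent `(1 + A)⁻¹`. -/
def resolvent : Lp ℝ 2 m →L[ℝ] Lp ℝ 2 m := E.inclL ∘L ContinuousLinearMap.adjoint E.inclL

theorem isSymmetric_resolvent (g h : Lp ℝ 2 m) :
    inner ℝ (E.resolvent g) h = inner ℝ g (E.resolvent h) :=
  (ContinuousLinearMap.adjoint_inner_right E.inclL _ h).symm.trans
    (ContinuousLinearMap.adjoint_inner_left E.inclL _ g)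

/-- The resolvent is ι ι* with ι the inclusion of the form domain, and ι is compact by the compact
embedding. -/
theorem isCompactOperator_resolvent {qA : ℝ} (hE : E.StandingAssumptions qA) :
    IsCompactOperator E.resolvent := by
  have h1 : IsCompactOperator E.inclL := by
    refine (isCompactOperator_iff_isCompact_closure_image_closedBall (𝕜₁ := ℝ) (σ₁₂ := RingHom.id ℝ)
      (E.inclL : E.FormSpace →ₗ[ℝ] Lp ℝ 2 m) one_pos).2 ?_
    refine hE.compact_embedding.of_isClosed_subset isClosed_closure (closure_mono ?_)
    rintro _ ⟨u, hu, rfl⟩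
    rw [mem_closedBall_zero_iff] at hu
    refine ⟨u.2, ?_⟩
    have h2 := FormSpace.norm_sq E u
    have h3 : ‖u‖ ^ 2 ≤ 1 := pow_le_one₀ (norm_nonneg _) hu
    rw [h2] at h3
    exact h3
  exact h1.comp_clm (ContinuousLinearMap.adjoint E.inclL)

theorem mem_op_domain {h a : Lp ℝ 2 m} (hh : h ∈ E.domain)
    (H : ∀ v : E.domain, E.form ⟨h, hh⟩ v = inner ℝ a (v : Lp ℝ 2 m)) :
    ∃ hd : h ∈ E.op.domain, E.op ⟨h, hd⟩ = a := by
  have hd : h ∈ E.opDomain := ⟨hh, a, H⟩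
  refine ⟨hd, E.eq_of_inner_domain fun v => ?_⟩
  rw [← H]
  exact (E.form_eq_inner_opFun ⟨h, hd⟩ v).symm

theorem form_eq_inner_op {h : Lp ℝ 2 m} (hd : h ∈ E.op.domain) (hh : h ∈ E.domain)
    (v : E.domain) : E.form ⟨h, hh⟩ v = inner ℝ (E.op ⟨h, hd⟩) (v : Lp ℝ 2 m) :=
  E.form_eq_inner_opFun ⟨h, hd⟩ v

theorem op_domain_le {h : Lp ℝ 2 m} (hd : h ∈ E.op.domain) : h ∈ E.domain :=
  E.opDomain_le ⟨h, hd⟩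

/-- With k = ι* g, the adjoint relation reads 𝓔(k, v) + (k, v) = (g, v), that is, A k = g − k. -/
theorem op_resolvent (g : Lp ℝ 2 m) :
    ∃ hd : E.resolvent g ∈ E.op.domain, E.op ⟨E.resolvent g, hd⟩ = g - E.resolvent g := by
  set k : E.FormSpace := ContinuousLinearMap.adjoint E.inclL g with hk
  have hmem : E.resolvent g ∈ E.domain := k.2
  refine E.mem_op_domain hmem fun v => ?_
  have h1 : ∀ v' : E.FormSpace, FormSpace.form E k v' +
      inner ℝ (FormSpace.incl E k) (FormSpace.incl E v') = inner ℝ g (FormSpace.incl E v') :=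
    fun v' => ContinuousLinearMap.adjoint_inner_left E.inclL _ g
  rw [inner_sub_left]
  exact eq_sub_of_add_eq (h1 v)

theorem resolvent_injective : Function.Injective E.resolvent := by
  refine (injective_iff_map_eq_zero _).2 fun φ hφ => ?_
  obtain ⟨hd, he⟩ := E.op_resolvent φ
  have h1 : ∀ k (hk : k ∈ E.op.domain), k = 0 → E.op ⟨k, hk⟩ = φ - k → φ = 0 := by
    rintro k hk rfl h2
    have h3 : (⟨0, hk⟩ : E.op.domain) = 0 := rfl
    rw [h3, LinearPMap.map_zero, sub_zero] at h2
    exact h2.symm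
  exact h1 _ hd hφ he

theorem resolvent_add_op {h : Lp ℝ 2 m} (hd : h ∈ E.op.domain) :
    E.resolvent (h + E.op ⟨h, hd⟩) = h := by
  set g := h + E.op ⟨h, hd⟩ with hg
  set k : E.FormSpace := ContinuousLinearMap.adjoint E.inclL g with hk
  let h' : E.FormSpace := (⟨h, E.op_domain_le hd⟩ : E.domain)
  have h1 : k = h' := by
    refine ext_inner_right ℝ fun v => ?_
    have h2 : inner ℝ k v = inner ℝ g (E.inclL v) :=
      ContinuousLinearMap.adjoint_inner_left E.inclL _ g
    rw [h2, FormSpace.inner_def, hg, inner_add_left, add_comm]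
    congr 1
    exact (E.form_eq_inner_op hd (E.op_domain_le hd) v).symm
  have h3 : E.resolvent g = FormSpace.incl E k := rfl
  rw [h3, h1]
  rfl

/-- Translates eigenvectors of A into those of a bounded operator, with eigenvalue 1/(1 + l); the
fixed-point form needs no 1 + l ≠ 0 and exhibits the eigenspace as closed. -/
theorem mem_eigenspace_iff {l : ℝ} {h : Lp ℝ 2 m} :
    h ∈ E.eigenspace l ↔ E.resolvent ((1 + l) • h) = h := by
  constructor
  · rintro ⟨hd, he⟩
    have h1 := E.resolvent_add_op hd
    rw [he] at h1
    rwa [add_smul, one_smul]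
  · intro h1
    obtain ⟨hd, he⟩ := E.op_resolvent ((1 + l) • h)
    have h2 : ∀ k (hk : k ∈ E.op.domain), k = h → E.op ⟨k, hk⟩ = (1 + l) • h - k →
        h ∈ E.eigenspace l := by
      rintro k hk rfl h3
      refine ⟨hk, ?_⟩
      rw [h3, add_smul, one_smul, add_sub_cancel_left]
    exact h2 _ hd h1 he

theorem isClosed_eigenspace (l : ℝ) : IsClosed (E.eigenspace l : Set (Lp ℝ 2 m)) := by
  have : (E.eigenspace l : Set (Lp ℝ 2 m)) = {h | E.resolvent ((1 + l) • h) = h} := by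
    ext h
    exact E.mem_eigenspace_iff
  rw [this]
  exact isClosed_eq (by fun_prop) continuous_id

theorem eigenProj_mem (l : ℝ) (h : Lp ℝ 2 m) : E.eigenProj l h ∈ E.eigenspace l := by
  have h1 := Submodule.starProjection_apply_mem (E.eigenspace l).topologicalClosure h
  exact (E.isClosed_eigenspace l).submodule_topologicalClosure_eq.le h1

theorem inner_eigenProj {l : ℝ} (h : Lp ℝ 2 m) {φ : Lp ℝ 2 m} (hφ : φ ∈ E.eigenspace l) :
    inner ℝ (E.eigenProj l h) φ = inner ℝ h φ := by
  have h1 := Submodule.starProjection_inner_eq_zero (𝕜 := ℝ) h φ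
    ((E.eigenspace l).le_topologicalClosure hφ)
  rw [inner_sub_left, sub_eq_zero] at h1
  exact h1.symm

theorem eigenProj_eq_self {l : ℝ} {φ : Lp ℝ 2 m} (hφ : φ ∈ E.eigenspace l) :
    E.eigenProj l φ = φ :=
  Submodule.starProjection_eq_self_iff.2 ((E.eigenspace l).le_topologicalClosure hφ)

theorem inner_eq_zero_of_mem_eigenspace {l l' : ℝ} (hl : l ≠ l') {φ φ' : Lp ℝ 2 m}
    (hφ : φ ∈ E.eigenspace l) (hφ' : φ' ∈ E.eigenspace l') : inner ℝ φ φ' = 0 := by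
  obtain ⟨hd, he⟩ := hφ
  obtain ⟨hd', he'⟩ := hφ'
  have h1 := E.form_eq_inner_op hd (E.op_domain_le hd) ⟨φ', E.op_domain_le hd'⟩
  have h2 := E.form_eq_inner_op hd' (E.op_domain_le hd') ⟨φ, E.op_domain_le hd⟩
  rw [E.symm, h2, he, he', real_inner_smul_left, real_inner_smul_left, real_inner_comm] at h1
  have h3 : (l' - l) * inner ℝ φ φ' = 0 := by linarith
  exact (mul_eq_zero.1 h3).resolve_left (sub_ne_zero.2 hl.symm)

theorem eigenProj_eq_zero {l l' : ℝ} (hl : l ≠ l') {φ : Lp ℝ 2 m} (hφ : φ ∈ E.eigenspace l) :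
    E.eigenProj l' φ = 0 := by
  have h1 := E.inner_eigenProj φ (E.eigenProj_mem l' φ)
  rw [E.inner_eq_zero_of_mem_eigenspace hl hφ (E.eigenProj_mem l' φ)] at h1
  exact inner_self_eq_zero.1 h1

theorem orthogonalFamily_eigenspace :
    OrthogonalFamily ℝ (fun l : ℝ => E.eigenspace l) fun l => (E.eigenspace l).subtypeₗᵢ :=
  OrthogonalFamily.of_pairwise fun _ _ hl => (Submodule.isOrtho_iff_inner_eq).2
    fun _ hφ _ hφ' => E.inner_eq_zero_of_mem_eigenspace hl hφ hφ'

theorem norm_sum_sq {φ : ℝ → Lp ℝ 2 m} (hφ : ∀ l, φ l ∈ E.eigenspace l) (J : Finset ℝ) :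
    ‖∑ l ∈ J, φ l‖ ^ 2 = ∑ l ∈ J, ‖φ l‖ ^ 2 :=
  E.orthogonalFamily_eigenspace.norm_sum (fun l => ⟨φ l, hφ l⟩) J

/-- Pythagoras. The multiplier is constrained only where φ l ≠ 0, that is, at actual eigenvalues,
which are positive. -/
theorem norm_sum_smul_le {φ : ℝ → Lp ℝ 2 m} (hφ : ∀ l, φ l ∈ E.eigenspace l) (J : Finset ℝ)
    {c : ℝ → ℝ} {C : ℝ} (hC : 0 ≤ C) (hc : ∀ l, φ l ≠ 0 → |c l| ≤ C) :
    ‖∑ l ∈ J, c l • φ l‖ ≤ C * ‖∑ l ∈ J, φ l‖ := by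
  refine le_of_sq_le_sq ?_ (by positivity)
  rw [mul_pow, E.norm_sum_sq (fun l => (E.eigenspace l).smul_mem _ (hφ l)), E.norm_sum_sq hφ,
    Finset.mul_sum]
  refine Finset.sum_le_sum fun l _ => ?_
  rw [norm_smul, mul_pow, Real.norm_eq_abs]
  by_cases h : φ l = 0
  · simp [h]
  · have := hc l h
    gcongr

/-- The eigenvectors of `A` are complete in `L²`. -/
theorem eq_zero_of_inner_eigenspace {qA : ℝ} (hE : E.StandingAssumptions qA) {g : Lp ℝ 2 m}
    (hg : ∀ l, ∀ φ ∈ E.eigenspace l, inner ℝ g φ = 0) : g = 0 := by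
  have h1 := ContinuousLinearMap.orthogonalComplement_iSup_eigenspaces_eq_bot
    (E.isCompactOperator_resolvent hE) (fun x y => E.isSymmetric_resolvent x y)
  have h2 : g ∈ (⨆ μ, Module.End.eigenspace (E.resolvent : Lp ℝ 2 m →ₗ[ℝ] Lp ℝ 2 m) μ)ᗮ := by
    rw [← Submodule.iInf_orthogonal, Submodule.mem_iInf]
    intro μ φ hφ
    rw [Module.End.mem_eigenspace_iff] at hφ
    have hφ' : E.resolvent φ = μ • φ := hφ
    rw [real_inner_comm]
    by_cases hμ : μ = 0
    -- Injectivity of the resolvent excludes μ = 0; any other μ corresponds to the eigenvalue μ⁻¹ −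
    -- 1 of A.
    · have h3 : φ = 0 := E.resolvent_injective (by rw [hφ', hμ, zero_smul, map_zero])
      rw [h3, inner_zero_right]
    · refine hg (μ⁻¹ - 1) φ (E.mem_eigenspace_iff.2 ?_)
      rw [add_sub_cancel, map_smul, hφ', smul_smul, inv_mul_cancel₀ hμ, one_smul]
  rwa [h1, Submodule.mem_bot] at h2

theorem eigenspace_pos {qA : ℝ} (hE : E.StandingAssumptions qA) {l : ℝ} {φ : Lp ℝ 2 m}
    (hφ : φ ∈ E.eigenspace l) (h0 : φ ≠ 0) : 0 < l :=
  hE.eigenvalue_pos l fun h => h0 (by rwa [h, Submodule.mem_bot] at hφ)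

theorem mem_powDomain_of_mem_eigenspace {l : ℝ} (s : ℝ) {φ : Lp ℝ 2 m}
    (hφ : φ ∈ E.eigenspace l) : φ ∈ E.powDomain s := by
  have h1 : E.spec s φ = (lp.single (E := fun _ : ℝ => Lp ℝ 2 m) 2 l (l ^ s • φ) :
      ∀ _ : ℝ, Lp ℝ 2 m) := by
    funext l'
    rw [lp.coeFn_single]
    by_cases h : l' = l
    · subst h
      rw [Pi.single_eq_same]
      exact congrArg (l' ^ s • ·) (E.eigenProj_eq_self hφ)
    · rw [Pi.single_eq_of_ne h]
      have : E.spec s φ l' = l' ^ s • E.eigenProj l' φ := rfl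
      rw [this, E.eigenProj_eq_zero (Ne.symm h) hφ, smul_zero]
  have h2 : Memℓp (E.spec s φ) 2 := by
    rw [h1]
    exact (lp.single (E := fun _ : ℝ => Lp ℝ 2 m) 2 l (l ^ s • φ)).2
  exact h2

theorem exists_bound_of_mem_powDomain {s : ℝ} {h : Lp ℝ 2 m} (hh : h ∈ E.powDomain s) :
    ∃ M : ℝ, 0 ≤ M ∧ ∀ J : Finset ℝ, ‖∑ l ∈ J, l ^ s • E.eigenProj l h‖ ≤ M := by
  have h1 : Memℓp (E.spec s h) 2 := hh
  have h2 := h1.summable (by norm_num)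
  refine ⟨√(∑' l, ‖E.spec s h l‖ ^ (2 : ℝ≥0∞).toReal), Real.sqrt_nonneg _, fun J => ?_⟩
  refine Real.le_sqrt_of_sq_le ?_
  rw [E.norm_sum_sq (fun l => (E.eigenspace l).smul_mem _ (E.eigenProj_mem l h))]
  have h3 := h2.sum_le_tsum J (fun l _ => by positivity)
  refine le_trans (le_of_eq ?_) h3
  refine Finset.sum_congr rfl fun l _ => ?_
  have : E.spec s h l = l ^ s • E.eigenProj l h := rfl
  rw [this]
  norm_num

/-- A vector whose pairings with `A φ` are bounded by `B ‖φ‖`, for `φ` in the span of the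
eigenvectors, lies in `D(A)`. -/
theorem mem_op_domain_of_bound {qA : ℝ} (hE : E.StandingAssumptions qA) {u : Lp ℝ 2 m} {B : ℝ}
    (hB : 0 ≤ B) (h : ∀ (J : Finset ℝ) (φ : ℝ → Lp ℝ 2 m), (∀ l, φ l ∈ E.eigenspace l) →
      ∑ l ∈ J, l * inner ℝ u (φ l) ≤ B * ‖∑ l ∈ J, φ l‖) :
    ∃ hd : u ∈ E.op.domain, ‖E.op ⟨u, hd⟩‖ ≤ B ∧
      ∀ l, ∀ φ ∈ E.eigenspace l, inner ℝ (E.op ⟨u, hd⟩) φ = l * inner ℝ u φ := by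
  have hmem : ∀ l, l • E.eigenProj l u ∈ E.eigenspace l := fun l =>
    (E.eigenspace l).smul_mem _ (E.eigenProj_mem l u)
  have hbd : ∀ J : Finset ℝ, ‖∑ l ∈ J, l • E.eigenProj l u‖ ≤ B := fun J => by
    -- With this choice the hypothesis reads ‖S‖² ≤ B ‖S‖ for the partial sum S of Σ l P_l u.
    have h1 := h J (fun l => l • E.eigenProj l u) hmem
    have h2 : ∑ l ∈ J, l * inner ℝ u (l • E.eigenProj l u) =
        ‖∑ l ∈ J, l • E.eigenProj l u‖ ^ 2 := by
      rw [E.norm_sum_sq hmem]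
      refine Finset.sum_congr rfl fun l _ => ?_
      rw [← E.inner_eigenProj u (hmem l), ← real_inner_smul_left, real_inner_self_eq_norm_sq]
    rw [h2] at h1
    by_contra hcon
    push Not at hcon
    nlinarith
  have hsum : Summable fun l => l • E.eigenProj l u := by
    have h1 : Summable fun l => ‖(⟨l • E.eigenProj l u, hmem l⟩ : E.eigenspace l)‖ ^ 2 := by
      refine summable_of_sum_le (c := B ^ 2) (fun l => by positivity) fun J => ?_
      have h2 := E.norm_sum_sq hmem J
      have h3 := hbd J
      calc _ = ‖∑ l ∈ J, l • E.eigenProj l u‖ ^ 2 := h2.symm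
        _ ≤ _ := by gcongr
    have h2 := (E.orthogonalFamily_eigenspace.summable_iff_norm_sq_summable
      (fun l => (⟨l • E.eigenProj l u, hmem l⟩ : E.eigenspace l))).2 h1
    exact h2
  set g := ∑' l, l • E.eigenProj l u with hg
  have hgB : ‖g‖ ≤ B := le_of_tendsto hsum.hasSum.norm (Eventually.of_forall hbd)
  have hinner : ∀ l, ∀ φ ∈ E.eigenspace l, inner ℝ g φ = l * inner ℝ u φ := fun l φ hφ => by
    have h1 := hsum.hasSum.mapL (innerSL ℝ φ)
    have h2 : HasSum (fun l' => innerSL ℝ φ (l' • E.eigenProj l' u))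
        (innerSL ℝ φ (l • E.eigenProj l u)) := by
      refine hasSum_single l fun l' hl' => ?_
      rw [innerSL_apply_apply]
      exact E.inner_eq_zero_of_mem_eigenspace hl'.symm hφ (hmem l')
    have h3 := h1.unique h2
    rw [innerSL_apply_apply, innerSL_apply_apply] at h3
    rw [real_inner_comm, h3, real_inner_smul_right, real_inner_comm, E.inner_eigenProj u hφ]
  -- Pairing with eigenvectors, which are total, shows that u lies in the range of the resolvent;
  -- hence u ∈ D(A) with A u = g.
  have hres : E.resolvent (u + g) = u := by
    rw [← sub_eq_zero]
    refine E.eq_zero_of_inner_eigenspace hE fun l φ hφ => ?_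
    by_cases h0 : φ = 0
    · rw [h0, inner_zero_right]
    have hl := E.eigenspace_pos hE hφ h0
    have h1 := E.mem_eigenspace_iff.1 hφ
    rw [map_smul] at h1
    have h2 : (1 + l) * inner ℝ (E.resolvent (u + g)) φ = (1 + l) * inner ℝ u φ := by
      rw [E.isSymmetric_resolvent, ← real_inner_smul_right, h1, inner_add_left, hinner l φ hφ]
      ring
    rw [inner_sub_left, sub_eq_zero]
    exact mul_left_cancel₀ (by linarith) h2
  obtain ⟨hd, he⟩ := E.op_resolvent (u + g)
  have h4 : ∀ k (hk : k ∈ E.op.domain), k = u → E.op ⟨k, hk⟩ = u + g - k →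
      ∃ hd : u ∈ E.op.domain, E.op ⟨u, hd⟩ = g := by
    rintro k hk rfl h5
    exact ⟨hk, by rw [h5, add_sub_cancel_left]⟩
  obtain ⟨hd', he'⟩ := h4 _ hd hres he
  exact ⟨hd', by rwa [he'], by rwa [he']⟩

end Spectral

end DirichletForm

/-! ### L¹ modulus of continuity in time -/

section Increments

variable {H : Type*} [NormedAddCommGroup H] {T : ℝ} {F : ℝ → H}

theorem intervalIntegrable_of_integrableOn_Ioo (hF : IntegrableOn F (Ioo 0 T)) {a b : ℝ}
    (ha : 0 ≤ a) (hab : a ≤ b) (hb : b ≤ T) : IntervalIntegrable F volume a b :=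
  (intervalIntegrable_iff_integrableOn_Ioo_of_le hab).2
    (hF.mono_set (Ioo_subset_Ioo ha hb))

theorem intervalIntegrable_shift_of_integrableOn_Ioo (hF : IntegrableOn F (Ioo 0 T)) {a h : ℝ}
    (ha : 0 ≤ a) (hh : 0 ≤ h) (hah : a + h ≤ T) :
    IntervalIntegrable (fun s => F (s + h)) volume 0 a := by
  have h1 := (intervalIntegrable_of_integrableOn_Ioo hF hh (by linarith : h ≤ a + h)
    hah).comp_add_right h
  rwa [sub_self, add_sub_cancel_right] at h1

/-- Integration of the pointwise increment bound; the 2 counts b(s + h) and b(s). -/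
theorem integral_norm_shift_sub_le {b : ℝ → ℝ} (hF : IntegrableOn F (Ioo 0 T))
    (hb : IntegrableOn b (Ioo 0 T)) (hb0 : ∀ t, 0 ≤ b t) {G : Set ℝ}
    (hG : ∀ᵐ t ∂(volume.restrict (Ioo 0 T)), t ∈ G)
    (hinc : ∀ s ∈ G, ∀ t ∈ G, ‖F t - F s‖ ≤ (b t + b s) * |t - s|) {a h : ℝ}
    (ha : 0 ≤ a) (hh : 0 < h) (hah : a + h ≤ T) :
    ∫ s in 0..a, ‖F (s + h) - F s‖ ≤ 2 * (∫ s in Ioo 0 T, b s) * h := by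
  have hT : 0 ≤ T := by linarith
  have hG1 : ∀ᵐ t : ℝ, t ∈ Ioo 0 T → t ∈ G := (ae_restrict_iff' measurableSet_Ioo).1 hG
  have hG2 : ∀ᵐ t : ℝ, t + h ∈ Ioo 0 T → t + h ∈ G :=
    (quasiMeasurePreserving_add_right volume h).ae hG1
  have h0 : ∀ᵐ t : ℝ, t ≠ 0 ∧ t ≠ a := by
    filter_upwards [compl_mem_ae_iff.2 (measure_singleton (0 : ℝ)),
      compl_mem_ae_iff.2 (measure_singleton a)] with t h1 h2
    exact ⟨h1, h2⟩
  have hsum : ∫ s in 0..T, b s = ∫ s in Ioo 0 T, b s := by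
    rw [intervalIntegral.integral_of_le hT, integral_Ioc_eq_integral_Ioo]
  have hb1 := intervalIntegrable_of_integrableOn_Ioo hb le_rfl ha (by linarith : a ≤ T)
  have hb2 := intervalIntegrable_shift_of_integrableOn_Ioo hb ha hh.le hah
  have hle : ∀ c d : ℝ, 0 ≤ c → c ≤ d → d ≤ T → ∫ s in c..d, b s ≤ ∫ s in Ioo 0 T, b s := by
    intro c d hc hcd hd
    rw [← hsum]
    exact intervalIntegral.integral_mono_interval hc hcd hd (Eventually.of_forall hb0)
      (intervalIntegrable_of_integrableOn_Ioo hb le_rfl hT le_rfl)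
  calc ∫ s in 0..a, ‖F (s + h) - F s‖ ≤ ∫ s in 0..a, (b (s + h) + b s) * h := by
        refine intervalIntegral.integral_mono_ae_restrict ha
          ((intervalIntegrable_shift_of_integrableOn_Ioo hF ha hh.le hah).sub
            (intervalIntegrable_of_integrableOn_Ioo hF le_rfl ha (by linarith))).norm
          ((hb2.add hb1).mul_const h) ?_
        refine (ae_restrict_iff' measurableSet_Icc).2 ?_
        filter_upwards [hG1, hG2, h0] with t h1 h2 h3 ht
        have ht0 : 0 < t := lt_of_le_of_ne ht.1 h3.1.symm
        have hta : t < a := lt_of_le_of_ne ht.2 h3.2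
        have := hinc t (h1 ⟨ht0, by linarith⟩) (t + h) (h2 ⟨by linarith, by linarith⟩)
        rwa [add_sub_cancel_left, abs_of_pos hh] at this
    _ = ((∫ s in h..(a + h), b s) + ∫ s in 0..a, b s) * h := by
        rw [intervalIntegral.integral_mul_const, intervalIntegral.integral_add hb2 hb1,
          intervalIntegral.integral_comp_add_right, zero_add]
    _ ≤ _ := by
        have h1 := hle h (a + h) hh.le (by linarith) hah
        have h2 := hle 0 a le_rfl ha (by linarith)
        have : (∫ s in h..(a + h), b s) + ∫ s in 0..a, b s ≤ 2 * ∫ s in Ioo 0 T, b s := by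
          linarith
        gcongr

/-- If the `L¹` modulus of continuity of `F` is linear, so are the integrals of `‖F‖` over initial
intervals. -/
theorem integral_norm_le_of_shift (hF : IntegrableOn F (Ioo 0 T)) {A : ℝ}
    (hA : ∀ a h, 0 ≤ a → 0 < h → a + h ≤ T → ∫ s in 0..a, ‖F (s + h) - F s‖ ≤ A * h)
    {h : ℝ} (hh : 0 < h) (hhT : 2 * h ≤ T) :
    ∫ s in 0..h, ‖F s‖ ≤ (2 / T * (∫ s in Ioo 0 T, ‖F s‖) + A) * h := by
  have hT : 0 < T := by linarith
  set I := ∫ s in 0..h, ‖F s‖ with hI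
  -- The n blocks of length h fill at least half of (0, T), because 2h ≤ T.
  set n := ⌊T / h⌋₊ with hn
  have hnT : n * h ≤ T := by
    have := Nat.floor_le (div_pos hT hh).le
    rwa [le_div_iff₀ hh] at this
  have hn2 : T / 2 ≤ n * h := by
    have h1 := Nat.lt_floor_add_one (T / h)
    rw [div_lt_iff₀ hh] at h1
    nlinarith
  have hn0 : (0 : ℝ) < n * h := by linarith
  have hint : ∀ {c d : ℝ}, 0 ≤ c → c ≤ d → d ≤ T →
      IntervalIntegrable (fun s => ‖F s‖) volume c d := fun hc hcd hd =>
    intervalIntegrable_of_integrableOn_Ioo hF.norm hc hcd hd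
  -- Passing from (0, kh) to (h, (k+1)h) drops the first block and gains the k-th one (counted from
  -- 0), so their integrals differ by at most A h. Averaging over the n blocks then bounds the
  -- first.
  have hk : ∀ k < n, I - A * h ≤ ∫ s in (k * h : ℝ)..((k + 1 : ℕ) * h : ℝ), ‖F s‖ := by
    intro k hk
    have hkn : (k : ℝ) + 1 ≤ n := by exact_mod_cast hk
    have hkT : (k : ℝ) * h + h ≤ T := by nlinarith
    have hk0 : 0 ≤ (k : ℝ) * h := by positivity
    have h1 := hA (k * h) h hk0 hh hkT
    have h2 : (∫ s in 0..(k * h : ℝ), ‖F s‖) - ∫ s in 0..(k * h : ℝ), ‖F (s + h)‖ ≤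
        ∫ s in 0..(k * h : ℝ), ‖F (s + h) - F s‖ := by
      rw [← intervalIntegral.integral_sub (hint le_rfl hk0 (by linarith))
        (intervalIntegrable_shift_of_integrableOn_Ioo hF.norm hk0 hh.le hkT)]
      refine intervalIntegral.integral_mono_on hk0 ?_ ?_ fun s _ => ?_
      · exact (hint le_rfl hk0 (by linarith)).sub
          (intervalIntegrable_shift_of_integrableOn_Ioo hF.norm hk0 hh.le hkT)
      · exact ((intervalIntegrable_shift_of_integrableOn_Ioo hF hk0 hh.le hkT).sub
          (intervalIntegrable_of_integrableOn_Ioo hF le_rfl hk0 (by linarith))).norm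
      · rw [norm_sub_rev]
        exact norm_sub_norm_le _ _
    rw [intervalIntegral.integral_comp_add_right (fun s => ‖F s‖) h, zero_add] at h2
    have h3 := intervalIntegral.integral_add_adjacent_intervals
      (hint le_rfl hh.le (by linarith)) (hint hh.le (by linarith : h ≤ k * h + h) hkT)
    have h4 := intervalIntegral.integral_add_adjacent_intervals
      (hint le_rfl hk0 (by linarith)) (hint hk0 (by linarith : k * h ≤ k * h + h) hkT)
    have h5 : ((k + 1 : ℕ) * h : ℝ) = k * h + h := by push_cast; ring
    rw [h5]
    linarith
  have hsum := intervalIntegral.sum_integral_adjacent_intervals (f := fun s => ‖F s‖)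
    (μ := volume) (a := fun k : ℕ => (k * h : ℝ)) (n := n) (fun k hk => by
      have hkn : (k : ℝ) + 1 ≤ n := by exact_mod_cast hk
      refine hint (by positivity) ?_ ?_
      · push_cast; nlinarith
      · push_cast; nlinarith)
  have h6 := Finset.sum_le_sum fun k hk' => hk k (Finset.mem_range.1 hk')
  rw [hsum, Finset.sum_const, Finset.card_range, nsmul_eq_mul, Nat.cast_zero, zero_mul] at h6
  have h7 : ∫ s in 0..(n * h : ℝ), ‖F s‖ ≤ ∫ s in Ioo 0 T, ‖F s‖ := by
    rw [intervalIntegral.integral_of_le hn0.le, integral_Ioc_eq_integral_Ioo]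
    exact setIntegral_mono_set hF.norm (Eventually.of_forall fun s => norm_nonneg _)
      (Ioo_subset_Ioo_right hnT).eventuallyLE
  set N := ∫ s in Ioo 0 T, ‖F s‖ with hN
  have hN0 : 0 ≤ N := integral_nonneg fun s => norm_nonneg _
  have h8 : (n : ℝ) * (I - A * h) ≤ N := h6.trans h7
  have h9 : (n * h) * (I - A * h) ≤ N * h := by nlinarith
  have h10 : (n * h) * (I - A * h) ≤ (n * h) * (2 / T * N * h) := by
    refine h9.trans ?_
    have : N * h = T / 2 * (2 / T * N * h) := by field_simp
    rw [this]
    gcongr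
  have h11 := le_of_mul_le_mul_left h10 hn0
  linarith

/-- A bound for the derivative of a convolution with a bounded kernel, in terms of the `L¹` modulus
of continuity of the other factor. -/
theorem abs_deriv_integral_inner_le {H : Type*} [NormedAddCommGroup H] [InnerProductSpace ℝ H]
    {F : ℝ → H} (hF : IntegrableOn F (Ioo 0 T)) {A M B : ℝ}
    (hA : ∀ a h, 0 ≤ a → 0 < h → a + h ≤ T → ∫ s in 0..a, ‖F (s + h) - F s‖ ≤ A * h)
    (hM : ∀ h, 0 < h → 2 * h ≤ T → ∫ s in 0..h, ‖F s‖ ≤ M * h)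
    {Ψ : ℝ → H} (hΨ : Continuous Ψ) (hB : ∀ t, ‖Ψ t‖ ≤ B) {t d : ℝ} (ht : t ∈ Ioo 0 T)
    (hd : HasDerivAt (fun t => ∫ s in 0..t, inner ℝ (F s) (Ψ (t - s))) d t) :
    |d| ≤ B * (A + M) := by
  have hB0 : 0 ≤ B := (norm_nonneg _).trans (hB 0)
  have hint : ∀ {c e : ℝ} (t' : ℝ), 0 ≤ c → c ≤ e → e ≤ T →
      IntervalIntegrable (fun s => inner ℝ (F s) (Ψ (t' - s))) volume c e := by
    intro c e t' hc hce he
    have h1 := intervalIntegrable_of_integrableOn_Ioo hF hc hce he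
    rw [intervalIntegrable_iff] at h1 ⊢
    refine (h1.norm.mul_const B).mono' (h1.aestronglyMeasurable.inner
      (hΨ.comp (continuous_const.sub continuous_id)).aestronglyMeasurable) ?_
    refine Eventually.of_forall fun s => ?_
    exact (norm_inner_le_norm _ _).trans (by gcongr; exact hB _)
  rw [hasDerivAt_iff_tendsto_slope_zero] at hd
  -- Right difference quotients suffice, as the derivative is known to exist.
  have hd' := (hd.mono_left (nhdsWithin_mono (s := Ioi 0) 0 fun x hx => ne_of_gt hx)).norm
  rw [← Real.norm_eq_abs]
  refine le_of_tendsto hd' ?_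
  have hev : ∀ᶠ h : ℝ in 𝓝[>] 0, h ∈ Ioo 0 (min (T - t) (T / 2)) :=
    Ioo_mem_nhdsGT (lt_min (by linarith [ht.2]) (by linarith [ht.1, ht.2]))
  filter_upwards [hev] with h hh
  have hh0 : 0 < h := hh.1
  have hhT : t + h ≤ T := by linarith [hh.2.trans_le (min_le_left _ _)]
  have hhT2 : 2 * h ≤ T := by linarith [hh.2.trans_le (min_le_right _ _)]
  have ht0 := ht.1
  -- The substitution s ↦ s + h moves the increment from Ψ to F and leaves a boundary piece on (0,
  -- h): these contribute B A h and B M h.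
  have h1 : ∫ s in 0..(t + h), inner ℝ (F s) (Ψ (t + h - s)) =
      (∫ s in 0..h, inner ℝ (F s) (Ψ (t + h - s))) +
        ∫ s in 0..t, inner ℝ (F (s + h)) (Ψ (t - s)) := by
    rw [← intervalIntegral.integral_add_adjacent_intervals
      (hint (t + h) le_rfl hh0.le (by linarith)) (hint (t + h) hh0.le (by linarith) hhT)]
    congr 1
    have := intervalIntegral.integral_comp_add_right (a := 0) (b := t)
      (fun s => inner ℝ (F s) (Ψ (t + h - s))) h
    rw [zero_add] at this
    rw [← this]
    refine intervalIntegral.integral_congr fun s _ => ?_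
    rw [show t + h - (s + h) = t - s by ring]
  have hsh : IntervalIntegrable (fun s => inner ℝ (F (s + h)) (Ψ (t - s))) volume 0 t := by
    have h1 := hint (t + h) hh0.le (by linarith : h ≤ t + h) hhT
    have h2 := h1.comp_add_right h
    rw [sub_self, add_sub_cancel_right] at h2
    refine h2.congr ?_
    intro s _
    simp only
    rw [show t + h - (s + h) = t - s by ring]
  have h2 : |∫ s in 0..h, inner ℝ (F s) (Ψ (t + h - s))| ≤ B * (M * h) := by
    calc _ ≤ ∫ s in 0..h, B * ‖F s‖ := by
          rw [← Real.norm_eq_abs]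
          refine intervalIntegral.norm_integral_le_of_norm_le hh0.le
            (Eventually.of_forall fun s _ => ?_)
            ((intervalIntegrable_of_integrableOn_Ioo hF.norm le_rfl hh0.le
              (by linarith)).const_mul B)
          rw [mul_comm]
          exact (norm_inner_le_norm _ _).trans (by gcongr; exact hB _)
      _ ≤ _ := by
          rw [intervalIntegral.integral_const_mul]
          have := hM h hh0 hhT2
          gcongr
  have h3 : |(∫ s in 0..t, inner ℝ (F (s + h)) (Ψ (t - s))) -
      ∫ s in 0..t, inner ℝ (F s) (Ψ (t - s))| ≤ B * (A * h) := by
    rw [← intervalIntegral.integral_sub hsh (hint t le_rfl ht0.le ht.2.le)]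
    calc _ ≤ ∫ s in 0..t, B * ‖F (s + h) - F s‖ := by
          rw [← Real.norm_eq_abs]
          refine intervalIntegral.norm_integral_le_of_norm_le ht0.le
            (Eventually.of_forall fun s _ => ?_) ?_
          · rw [mul_comm, ← inner_sub_left]
            exact (norm_inner_le_norm _ _).trans (by gcongr; exact hB _)
          · exact ((intervalIntegrable_shift_of_integrableOn_Ioo hF ht0.le hh0.le hhT).sub
              (intervalIntegrable_of_integrableOn_Ioo hF le_rfl ht0.le ht.2.le)).norm.const_mul B
      _ ≤ _ := by
          rw [intervalIntegral.integral_const_mul]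
          have := hA t h ht0.le hh0 hhT
          gcongr
  rw [h1, norm_smul, Real.norm_eq_abs, Real.norm_eq_abs, abs_inv, abs_of_pos hh0,
    inv_mul_le_iff₀ hh0]
  rw [add_sub_assoc]
  refine (abs_add_le _ _).trans ?_
  linarith

end Increments

/-! ### The superposition operator along a solution -/

theorem one_lt_of_isCriticalGrowth {qA α r : ℝ} (hqA : 1 < qA) (hα : 1 < α)
    (h : IsCriticalGrowth qA α r) : 1 < r := by
  have hθ : 0 < thetaA qA := div_pos (by linarith) (by linarith)
  have key : 1 < thetaA qA * α → r = thetaA qA * α / (thetaA qA * α - 1) → 1 < r := by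
    intro h1 h2
    rw [h2, one_lt_div (by linarith)]
    linarith
  rcases h with ⟨-, -, ⟨-, h1⟩ | ⟨h1, h2⟩⟩ | ⟨-, h1, -, -, h2⟩
  · exact h1
  · refine key ?_ h2
    rwa [div_lt_iff₀ hθ, mul_comm] at h1
  · refine key ?_ h2
    have : 1 ≤ thetaA qA := by
      rw [thetaA, one_le_div (by linarith)]
      linarith
    nlinarith

/-- Mean value inequality on [−M, M], where |f'| ≤ C M^(r−1). -/
theorem HasGrowth.exists_lipschitz {f : ℝ → ℝ} {r : ℝ} (hf : HasGrowth f r) (hr : 1 < r) :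
    ∃ C : ℝ, 0 < C ∧ ∀ M a b : ℝ, |a| ≤ M → |b| ≤ M →
      |f a - f b| ≤ C * M ^ (r - 1) * |a - b| := by
  obtain ⟨hf1, -, C, hC, hfC⟩ := hf
  refine ⟨C, hC, fun M a b ha hb => ?_⟩
  refine (convex_Icc (-M) M).norm_image_sub_le_of_norm_deriv_le
    (fun x _ => (hf1.differentiable one_ne_zero) x) (fun x hx => ?_) (abs_le.1 hb) (abs_le.1 ha)
  refine (hfC x).trans ?_
  have hx' : |x| ≤ M := abs_le.2 hx
  have hr' : 0 ≤ r - 1 := by linarith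
  gcongr

section Nemytskii

variable {X : Type*} [MeasurableSpace X] {m : Measure X}

open Classical in
/-- The superposition operator `v ↦ f ∘ v` in `L²`, set to zero where `f ∘ v` is not in `L²`. -/
def nemytskii (f : ℝ → ℝ) (v : Lp ℝ 2 m) : Lp ℝ 2 m :=
  if h : MemLp (fun x => f (v x)) 2 m then h.toLp else 0

theorem abs_le_of_eLpNorm_top_le {v : Lp ℝ 2 m} {M : ℝ} (hM : 0 ≤ M)
    (h : eLpNorm v ⊤ m ≤ ENNReal.ofReal M) : ∀ᵐ x ∂m, |v x| ≤ M := by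
  rw [eLpNorm_exponent_top] at h
  filter_upwards [ae_le_eLpNormEssSup (f := v) (μ := m)] with x hx
  have h1 := hx.trans h
  rwa [← ofReal_norm, ENNReal.ofReal_le_ofReal_iff hM, Real.norm_eq_abs] at h1

theorem coeFn_nemytskii {f : ℝ → ℝ} {r : ℝ} (hf : HasGrowth f r) (hr : 1 < r) {v : Lp ℝ 2 m}
    (hv : eLpNorm v ⊤ m < ⊤) : nemytskii f v =ᵐ[m] fun x => f (v x) := by
  obtain ⟨C, hC, hL⟩ := hf.exists_lipschitz hr
  have h1 := abs_le_of_eLpNorm_top_le ENNReal.toReal_nonneg (ENNReal.ofReal_toReal hv.ne).ge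
  have h2 : MemLp (fun x => f (v x)) 2 m := by
    refine (Lp.memLp v).of_le_mul (c := C * (eLpNorm v ⊤ m).toReal ^ (r - 1))
      (hf.1.continuous.comp_aestronglyMeasurable (Lp.aestronglyMeasurable v)) ?_
    filter_upwards [h1] with x hx
    have h3 := hL _ (v x) 0 hx (by rw [abs_zero]; exact ENNReal.toReal_nonneg)
    rwa [hf.2.1, sub_zero, sub_zero] at h3
  rw [nemytskii, dif_pos h2]
  exact h2.coeFn_toLp

theorem HasGrowth.exists_norm_nemytskii_sub_le {f : ℝ → ℝ} {r : ℝ} (hf : HasGrowth f r)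
    (hr : 1 < r) : ∃ C : ℝ, 0 < C ∧ ∀ M : ℝ, 0 ≤ M → ∀ v w : Lp ℝ 2 m,
      eLpNorm v ⊤ m ≤ ENNReal.ofReal M → eLpNorm w ⊤ m ≤ ENNReal.ofReal M →
      ‖nemytskii f v - nemytskii f w‖ ≤ C * M ^ (r - 1) * ‖v - w‖ := by
  obtain ⟨C, hC, hL⟩ := hf.exists_lipschitz hr
  refine ⟨C, hC, fun M hM v w hv hw => Lp.norm_le_mul_norm_of_ae_le_mul ?_⟩
  filter_upwards [coeFn_nemytskii hf hr (hv.trans_lt ENNReal.ofReal_lt_top),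
    coeFn_nemytskii hf hr (hw.trans_lt ENNReal.ofReal_lt_top),
    abs_le_of_eLpNorm_top_le hM hv, abs_le_of_eLpNorm_top_le hM hw,
    Lp.coeFn_sub v w, Lp.coeFn_sub (nemytskii f v) (nemytskii f w)] with x h1 h2 h3 h4 h5 h6
  rw [h5, h6, Pi.sub_apply, Pi.sub_apply, h1, h2]
  exact hL M _ _ h3 h4

/-- L² convergence yields an a.e. convergent subsequence, along which the essential supremum is
lower semicontinuous. This makes t ↦ ‖u(t)‖_∞ measurable although u is continuous only into L². -/
theorem isClosed_eLpNorm_top_le (k : ℝ≥0∞) :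
    IsClosed {v : Lp ℝ 2 m | eLpNorm v ⊤ m ≤ k} := by
  refine IsSeqClosed.isClosed fun v w hv hvw => ?_
  obtain ⟨ns, -, hns⟩ := (tendstoInMeasure_of_tendsto_Lp hvw).exists_seq_tendsto_ae
  refine (Lp.eLpNorm_lim_le_liminf_eLpNorm (fun n => Lp.aestronglyMeasurable (v (ns n))) w
    hns).trans ?_
  refine (liminf_le_liminf (v := fun _ => k) (Eventually.of_forall fun n => hv (ns n))).trans ?_
  rw [liminf_const]

variable {T : ℝ} {u : ℝ → Lp ℝ 2 m}

theorem isClosed_sublevel_eLpNorm_top (hu : ContinuousOn u (Icc 0 T)) (k : ℝ≥0∞) :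
    IsClosed {t | t ∈ Icc 0 T ∧ eLpNorm (u t) ⊤ m ≤ k} :=
  hu.preimage_isClosed_of_isClosed isClosed_Icc (isClosed_eLpNorm_top_le k)

theorem aemeasurable_eLpNorm_top (hu : ContinuousOn u (Icc 0 T)) :
    AEMeasurable (fun t => eLpNorm (u t) ⊤ m) (volume.restrict (Ioo 0 T)) := by
  rw [← aemeasurable_indicator_iff measurableSet_Ioo]
  refine (measurable_of_Iic fun k => ?_).aemeasurable
  have : (Ioo 0 T).indicator (fun t => eLpNorm (u t) ⊤ m) ⁻¹' Iic k =
      (Ioo 0 T)ᶜ ∪ (Ioo 0 T ∩ {t | t ∈ Icc 0 T ∧ eLpNorm (u t) ⊤ m ≤ k}) := by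
    ext t
    by_cases ht : t ∈ Ioo 0 T
    · simp [ht, Ioo_subset_Icc_self ht, -mem_Ioo, -mem_Icc]
    · simp [ht, -mem_Ioo]
  rw [this]
  exact measurableSet_Ioo.compl.union
    (measurableSet_Ioo.inter (isClosed_sublevel_eLpNorm_top hu k).measurableSet)

/-- The interval has finite measure and q ≥ 1, so the exponent can be lowered from q s to s; q = ∞
is included. -/
theorem lintegral_eLpNorm_top_rpow_lt_top (hu : ContinuousOn u (Icc 0 T)) {q : ℝ≥0∞}
    (hq : 1 ≤ q) {s : ℝ} (hs : 0 < s) (h : mixedNorm (q * ENNReal.ofReal s) ⊤ T u < ⊤) :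
    ∫⁻ t in Ioo 0 T, eLpNorm (u t) ⊤ m ^ s < ⊤ := by
  have h1 : eLpNorm (fun t => eLpNorm (u t) ⊤ m) (ENNReal.ofReal s) (volume.restrict (Ioo 0 T))
      < ⊤ := by
    refine (eLpNorm_le_eLpNorm_mul_rpow_measure_univ (le_mul_of_one_le_left zero_le hq)
      (aemeasurable_eLpNorm_top hu).aestronglyMeasurable).trans_lt ?_
    refine ENNReal.mul_lt_top h (ENNReal.rpow_lt_top_of_nonneg ?_ (by simp))
    rw [sub_nonneg]
    by_cases hqt : q * ENNReal.ofReal s = ⊤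
    · rw [hqt]; simp [hs.le]
    · refine one_div_le_one_div_of_le (by rwa [ENNReal.toReal_ofReal hs.le]) ?_
      exact ENNReal.toReal_mono hqt (le_mul_of_one_le_left zero_le hq)
  rw [eLpNorm_lt_top_iff_lintegral_rpow_enorm_lt_top (by simpa using hs) (by simp),
    ENNReal.toReal_ofReal hs.le] at h1
  simpa using h1

theorem ae_eLpNorm_top_lt_top (hu : ContinuousOn u (Icc 0 T)) {s : ℝ} (hs : 0 < s)
    (h : ∫⁻ t in Ioo 0 T, eLpNorm (u t) ⊤ m ^ s < ⊤) :
    ∀ᵐ t ∂(volume.restrict (Ioo 0 T)), t ∈ Ioo 0 T ∧ eLpNorm (u t) ⊤ m < ⊤ := by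
  filter_upwards [ae_lt_top' ((aemeasurable_eLpNorm_top hu).pow_const s) h.ne,
    ae_restrict_mem measurableSet_Ioo] with t ht ht'
  refine ⟨ht', ?_⟩
  rw [ENNReal.rpow_lt_top_iff_of_pos hs] at ht
  exact ht

/-- On each closed set of times with ‖u(t)‖_∞ ≤ k the map is continuous, by the local Lipschitz
bound, and these sets cover almost every time. -/
theorem aestronglyMeasurable_nemytskii {f : ℝ → ℝ} {r : ℝ} (hf : HasGrowth f r) (hr : 1 < r)
    (hu : ContinuousOn u (Icc 0 T))
    (hfin : ∀ᵐ t ∂(volume.restrict (Ioo 0 T)), t ∈ Ioo 0 T ∧ eLpNorm (u t) ⊤ m < ⊤) :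
    AEStronglyMeasurable (fun t => nemytskii f (u t)) (volume.restrict (Ioo 0 T)) := by
  obtain ⟨C, hC, hL⟩ := hf.exists_norm_nemytskii_sub_le (m := m) hr
  have hcont : ∀ k : ℕ, ContinuousOn (fun t => nemytskii f (u t))
      {t | t ∈ Icc 0 T ∧ eLpNorm (u t) ⊤ m ≤ ENNReal.ofReal k} := by
    intro k t ht
    have h1 : Tendsto (fun s => C * (k : ℝ) ^ (r - 1) * ‖u s - u t‖)
        (𝓝[{t | t ∈ Icc 0 T ∧ eLpNorm (u t) ⊤ m ≤ ENNReal.ofReal k}] t) (𝓝 0) := by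
      have h2 : Tendsto u (𝓝[{t | t ∈ Icc 0 T ∧ eLpNorm (u t) ⊤ m ≤ ENNReal.ofReal k}] t)
          (𝓝 (u t)) := (hu t ht.1).mono fun s hs => hs.1
      simpa using (tendsto_iff_norm_sub_tendsto_zero.1 h2).const_mul (C * (k : ℝ) ^ (r - 1))
    refine tendsto_iff_norm_sub_tendsto_zero.2
      (squeeze_zero' (Eventually.of_forall fun s => norm_nonneg _) ?_ h1)
    filter_upwards [self_mem_nhdsWithin] with s hs
    exact hL k k.cast_nonneg _ _ hs.2 ht.2
  have h1 : AEStronglyMeasurable (fun t => nemytskii f (u t)) (volume.restrict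
      (⋃ k : ℕ, {t | t ∈ Icc 0 T ∧ eLpNorm (u t) ⊤ m ≤ ENNReal.ofReal k})) :=
    AEStronglyMeasurable.iUnion fun k =>
      (hcont k).aestronglyMeasurable (isClosed_sublevel_eLpNorm_top hu _).measurableSet
  refine h1.mono_measure (Measure.restrict_mono_ae ?_)
  filter_upwards [(ae_restrict_iff' measurableSet_Ioo).1 hfin] with t ht ht'
  obtain ⟨k, hk⟩ := ENNReal.exists_nat_gt (ht ht').2.ne
  refine mem_iUnion.2 ⟨k, Ioo_subset_Icc_self ht', ?_⟩
  rw [ENNReal.ofReal_natCast]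
  exact hk.le

/-- The function `t ↦ f(u(t))` is integrable with values in `L²`, and it is Lipschitz in time up to
an integrable weight. -/
theorem exists_weight_nemytskii {f : ℝ → ℝ} {r : ℝ} (hf : HasGrowth f r) (hr : 1 < r)
    (hu : ContDiffOn ℝ 1 u (Icc 0 T)) {q : ℝ≥0∞} (hq : 1 ≤ q)
    (h : mixedNorm (q * ENNReal.ofReal (r - 1)) ⊤ T u < ⊤) :
    IntegrableOn (fun t => nemytskii f (u t)) (Ioo 0 T) ∧
    (∀ᵐ t ∂(volume.restrict (Ioo 0 T)), nemytskii f (u t) =ᵐ[m] fun x => f (u t x)) ∧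
    ∃ (b : ℝ → ℝ) (G : Set ℝ), IntegrableOn b (Ioo 0 T) ∧ (∀ t, 0 ≤ b t) ∧
      (∀ᵐ t ∂(volume.restrict (Ioo 0 T)), t ∈ G) ∧
      ∀ s ∈ G, ∀ t ∈ G, ‖nemytskii f (u t) - nemytskii f (u s)‖ ≤ (b t + b s) * |t - s| := by
  have huc := hu.continuousOn
  have hr' : 0 < r - 1 := by linarith
  have hlt := lintegral_eLpNorm_top_rpow_lt_top huc hq hr' h
  have hfin := ae_eLpNorm_top_lt_top huc hr' hlt
  obtain ⟨C, hC, hL⟩ := hf.exists_norm_nemytskii_sub_le (m := m) hr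
  set b₀ : ℝ → ℝ := fun t => (eLpNorm (u t) ⊤ m ^ (r - 1)).toReal with hb₀
  have hb₀i : IntegrableOn b₀ (Ioo 0 T) := integrable_toReal_of_lintegral_ne_top
    ((aemeasurable_eLpNorm_top huc).pow_const _) hlt.ne
  have hb₀n : ∀ t, 0 ≤ b₀ t := fun t => ENNReal.toReal_nonneg
  obtain ⟨K, hK⟩ := (isCompact_Icc (a := (0 : ℝ)) (b := T)).exists_bound_of_continuousOn huc
  have hsup : ∀ t, eLpNorm (u t) ⊤ m < ⊤ → eLpNorm (u t) ⊤ m ≤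
      ENNReal.ofReal (eLpNorm (u t) ⊤ m).toReal := fun t ht => (ENNReal.ofReal_toReal ht.ne).ge
  have hz : eLpNorm (0 : Lp ℝ 2 m) ⊤ m = 0 := by
    rw [eLpNorm_congr_ae (Lp.coeFn_zero ℝ 2 m), eLpNorm_zero]
  have hzero : nemytskii f (0 : Lp ℝ 2 m) = 0 := by
    have h1 := coeFn_nemytskii hf hr (v := (0 : Lp ℝ 2 m)) (hz.trans_lt ENNReal.zero_lt_top)
    refine Lp.ext ?_
    filter_upwards [h1, Lp.coeFn_zero ℝ 2 m] with x h1 h2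
    rw [h1, h2, Pi.zero_apply, hf.2.1]
  refine ⟨?_, ?_, ?_⟩
  · refine (hb₀i.const_mul (C * K)).mono' (aestronglyMeasurable_nemytskii hf hr huc hfin) ?_
    filter_upwards [hfin] with t ht
    have h1 := hL _ ENNReal.toReal_nonneg (u t) 0 (hsup t ht.2)
      (hz.trans_le zero_le)
    rw [hzero, sub_zero, sub_zero] at h1
    refine h1.trans ?_
    rw [ENNReal.toReal_rpow]
    have h2 := hK t (Ioo_subset_Icc_self ht.1)
    have h3 := hb₀n t
    calc C * b₀ t * ‖u t‖ ≤ C * b₀ t * K := by gcongr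
      _ = C * K * b₀ t := by ring
  · filter_upwards [hfin] with t ht
    exact coeFn_nemytskii hf hr ht.2
  -- The weight is C K' ‖u(t)‖_∞^(r−1), with K' the Lipschitz constant of u into L²; max(a, c)^(r−1)
  -- is then bounded by the sum of the two powers.
  · obtain ⟨K', hK'⟩ : ∃ K' : NNReal, LipschitzOnWith K' u (Icc 0 T) :=
      hu.exists_lipschitzOnWith one_ne_zero (convex_Icc 0 T) isCompact_Icc
    refine ⟨fun t => C * K' * b₀ t, {t | t ∈ Ioo 0 T ∧ eLpNorm (u t) ⊤ m < ⊤},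
      hb₀i.const_mul _, fun t => by have := hb₀n t; positivity, hfin, ?_⟩
    intro s hs t ht
    have h1 := hK'.norm_sub_le (Ioo_subset_Icc_self ht.1) (Ioo_subset_Icc_self hs.1)
    rw [Real.norm_eq_abs] at h1
    set a := (eLpNorm (u t) ⊤ m).toReal with ha
    set c := (eLpNorm (u s) ⊤ m).toReal with hc
    have ha0 : 0 ≤ a := ENNReal.toReal_nonneg
    have hc0 : 0 ≤ c := ENNReal.toReal_nonneg
    have h2 := hL (max a c) (ha0.trans (le_max_left _ _)) (u t) (u s)
      ((hsup t ht.2).trans (ENNReal.ofReal_le_ofReal (le_max_left _ _)))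
      ((hsup s hs.2).trans (ENNReal.ofReal_le_ofReal (le_max_right _ _)))
    have h3 : max a c ^ (r - 1) ≤ b₀ t + b₀ s := by
      have hbt : b₀ t = a ^ (r - 1) := by rw [hb₀, ha, ENNReal.toReal_rpow]
      have hbs : b₀ s = c ^ (r - 1) := by rw [hb₀, hc, ENNReal.toReal_rpow]
      rcases max_cases a c with ⟨h4, -⟩ | ⟨h4, -⟩
      · rw [h4, hbt]; linarith [hb₀n s]
      · rw [h4, hbs]; linarith [hb₀n t]
    refine h2.trans ?_
    calc C * max a c ^ (r - 1) * ‖u t - u s‖ ≤ C * (b₀ t + b₀ s) * (K' * |t - s|) := by gcongr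
      _ = _ := by ring

end Nemytskii

theorem derivWithin_inner_const {H : Type*} [NormedAddCommGroup H] [InnerProductSpace ℝ H]
    {u : ℝ → H} {s : Set ℝ} {t : ℝ} (hu : DifferentiableWithinAt ℝ u s t)
    (hs : UniqueDiffWithinAt ℝ s t) (φ : H) :
    derivWithin (fun t => inner ℝ (u t) φ) s t = inner ℝ (derivWithin u s t) φ := by
  have h1 := (hu.hasDerivWithinAt.inner ℝ (hasDerivWithinAt_const t s φ)).derivWithin hs
  rwa [inner_zero_right, zero_add] at h1

/-! ### The bound for A u(t) -/

namespace DirichletForm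

section OperatorBound

variable {X : Type*} [MeasurableSpace X] {m : Measure X} (E : DirichletForm m)

theorem inner_sum_sum {a b : ℝ → Lp ℝ 2 m} (ha : ∀ l, a l ∈ E.eigenspace l)
    (hb : ∀ l, b l ∈ E.eigenspace l) (J : Finset ℝ) :
    inner ℝ (∑ l ∈ J, a l) (∑ l ∈ J, b l) = ∑ l ∈ J, inner ℝ (a l) (b l) := by
  rw [sum_inner]
  refine Finset.sum_congr rfl fun l hl => ?_
  rw [inner_sum]
  exact Finset.sum_eq_single_of_mem l hl fun l' _ hl' =>
    E.inner_eq_zero_of_mem_eigenspace hl'.symm (ha l) (hb l')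

/-- A weak solution satisfies the scalar equation of each eigenvector of `A`. -/
theorem IsWeakSolution.modal_equation {α : ℝ} {q : ℝ≥0∞} {f : ℝ → ℝ} {u₀ u₁ : Lp ℝ 2 m} {T : ℝ}
    {u : ℝ → Lp ℝ 2 m} (hu : E.IsWeakSolution α q f u₀ u₁ T u) {F : ℝ → Lp ℝ 2 m}
    (hF : ∀ᵐ t ∂(volume.restrict (Ioo 0 T)), F t =ᵐ[m] fun x => f (u t x))
    {l : ℝ} {φ : Lp ℝ 2 m} (hφ : φ ∈ E.eigenspace l) :
    ∃ z : ℝ → ℝ, HasFracDeriv α T (fun t => inner ℝ (u t) φ) z ∧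
      ∀ᵐ t ∂(volume.restrict (Ioo 0 T)), z t + l * inner ℝ (u t) φ = inner ℝ (F t) φ := by
  obtain ⟨d₁, d₂, -, -, heq⟩ := hu.equation
  obtain ⟨h1, h2⟩ := heq (⟨φ, E.mem_powDomain_of_mem_eigenspace (1 / α) hφ⟩ : E.powDomain (1 / α))
  refine ⟨_, h1, ?_⟩
  filter_upwards [h2, hF] with t ht hFt
  obtain ⟨hut, hφt, he⟩ := ht
  obtain ⟨hd, hop⟩ := hφ
  -- Symmetry puts A on the eigenvector, so u(t) ∈ D(A) is not needed here.
  have h3 : E.form ⟨u t, hut⟩ ⟨φ, hφt⟩ = l * inner ℝ (u t) φ := by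
    rw [E.symm, E.form_eq_inner_op hd hφt, hop, real_inner_smul_left, real_inner_comm]
  have h4 : inner ℝ (F t) φ = ∫ x, f (u t x) * φ x ∂m := by
    rw [L2.inner_def]
    refine integral_congr_ae ?_
    filter_upwards [hFt] with x hx
    rw [hx, RCLike.inner_apply, conj_trivial, mul_comm]
  rw [h4, ← h3]
  exact he

/-- Duality: Σ l (u(t), φ_l) over a finite family of eigenvectors is split by the resolved scalar
equations into a forcing term and two data terms, each bounded by a multiple of ‖Σ φ_l‖ independent
of the family. The forcing term gives C₂, the data terms give C₁ t^(1−α). -/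
theorem exists_op_bound {qA : ℝ} (hE : E.StandingAssumptions qA) {α : ℝ} (hα : 1 < α)
    (hα2 : α < 2) {T : ℝ} (hT : 0 < T) {u : ℝ → Lp ℝ 2 m} (hu : ContDiffOn ℝ 1 u (Icc 0 T))
    (hu0 : u 0 ∈ E.powDomain (1 / α)) {F : ℝ → Lp ℝ 2 m} (hF : IntegrableOn F (Ioo 0 T))
    {b : ℝ → ℝ} {G : Set ℝ} (hb : IntegrableOn b (Ioo 0 T)) (hb0 : ∀ t, 0 ≤ b t)
    (hG : ∀ᵐ t ∂(volume.restrict (Ioo 0 T)), t ∈ G)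
    (hinc : ∀ s ∈ G, ∀ t ∈ G, ‖F t - F s‖ ≤ (b t + b s) * |t - s|)
    (hmode : ∀ l, ∀ φ ∈ E.eigenspace l, ∃ z : ℝ → ℝ,
      HasFracDeriv α T (fun t => inner ℝ (u t) φ) z ∧
      ∀ᵐ t ∂(volume.restrict (Ioo 0 T)), z t + l * inner ℝ (u t) φ = inner ℝ (F t) φ) :
    ∃ C₁ C₂ : ℝ, ∀ t ∈ Ioo 0 T, ∃ hd : u t ∈ E.op.domain,
      ‖E.op ⟨u t, hd⟩‖ ≤ C₁ * t ^ (1 - α) + C₂ ∧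
      ∀ l, ∀ φ ∈ E.eigenspace l, inner ℝ (E.op ⟨u t, hd⟩) φ = l * inner ℝ (u t) φ := by
  obtain ⟨C, hC, hker⟩ := exists_mlKernel_bounds hα hα2
  obtain ⟨M₀, hM₀, hM₀b⟩ := E.exists_bound_of_mem_powDomain hu0
  set A := 2 * ∫ s in Ioo 0 T, b s with hAdef
  have hA0 : 0 ≤ A := mul_nonneg two_pos.le (integral_nonneg hb0)
  have hA : ∀ a h, 0 ≤ a → 0 < h → a + h ≤ T → ∫ s in 0..a, ‖F (s + h) - F s‖ ≤ A * h :=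
    fun a h ha hh hah => integral_norm_shift_sub_le hF hb hb0 hG hinc ha hh hah
  set M := 2 / T * (∫ s in Ioo 0 T, ‖F s‖) + A with hMdef
  have hM0 : 0 ≤ M := by
    have : 0 ≤ ∫ s in Ioo 0 T, ‖F s‖ := integral_nonneg fun s => norm_nonneg _
    positivity
  have hM : ∀ h, 0 < h → 2 * h ≤ T → ∫ s in 0..h, ‖F s‖ ≤ M * h := fun h hh hhT =>
    integral_norm_le_of_shift hF hA hh hhT
  set u₁ := derivWithin u (Icc 0 T) 0 with hu₁
  have hud : DifferentiableWithinAt ℝ u (Icc 0 T) 0 :=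
    hu.differentiableOn one_ne_zero 0 ⟨le_rfl, hT.le⟩
  refine ⟨M₀ * C + ‖u₁‖ * C, C * (A + M), fun t ht => ?_⟩
  have ht0 : 0 < t := ht.1
  have htα : 0 < t ^ (1 - α) := Real.rpow_pos_of_pos ht0 _
  refine E.mem_op_domain_of_bound hE (by positivity) fun J φ hφ => ?_
  have hpos : ∀ l, φ l ≠ 0 → 0 < l := fun l h => E.eigenspace_pos hE (hφ l) h
  set N : ℝ → ℝ → ℝ := fun l s => l * mlKernel α l (1 + α) s with hN
  have hNc : ∀ l, Continuous (N l) := fun l =>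
    continuous_const.mul (continuous_mlKernel hα (by linarith) l)
  -- The scalar kernels are bundled into one L²-valued function, so that the derivative estimate is
  -- applied once to the vector F; mode-by-mode bounds could not be summed.
  set Ψ : ℝ → Lp ℝ 2 m := fun s => ∑ l ∈ J, N l s • φ l with hΨ
  have hΨc : Continuous Ψ := continuous_finsetSum _ fun l _ => (hNc l).smul continuous_const
  have hΨB : ∀ s, ‖Ψ s‖ ≤ C * ‖∑ l ∈ J, φ l‖ := fun s =>
    E.norm_sum_smul_le hφ J hC.le fun l hl => (hker l (hpos l hl)).1 s
  have hFl : ∀ l, IntegrableOn (fun s => inner ℝ (F s) (φ l)) (Ioo 0 T) := fun l =>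
    hF.inner_const (φ l)
  set D : ℝ → ℝ := fun l => l * inner ℝ (u t) (φ l) - l * inner ℝ (u 0) (φ l) * (1 - N l t) -
    l * inner ℝ u₁ (φ l) * mlKernel α l 2 t with hD
  have hder : ∀ l, HasDerivAt (causalConv (N l) fun s => inner ℝ (F s) (φ l)) (D l) t := by
    intro l
    obtain ⟨z, hz, hzeq⟩ := hmode l (φ l) (hφ l)
    have h1 := hasDerivAt_causalConv_mlKernel hα hα2 hT (hu.inner ℝ contDiffOn_const) hz (hFl l)
      hzeq ht
    rwa [derivWithin_inner_const hud (uniqueDiffOn_Icc hT 0 ⟨le_rfl, hT.le⟩)] at h1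
  have hsum : HasDerivAt (fun t => ∫ s in 0..t, inner ℝ (F s) (Ψ (t - s))) (∑ l ∈ J, D l) t := by
    have h1 := HasDerivAt.fun_sum fun l (_ : l ∈ J) => hder l
    refine h1.congr_of_eventuallyEq ?_
    filter_upwards [Ioo_mem_nhds ht.1 ht.2] with t' ht'
    rw [intervalIntegral.integral_of_le ht'.1.le, integral_Ioc_eq_integral_Ioo]
    simp only [causalConv]
    rw [← integral_finsetSum _ fun l _ => integrableOn_causalConv_integrand (hNc l)
      ((hFl l).mono_set (Ioo_subset_Ioo_right ht'.2.le))]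
    refine setIntegral_congr_fun measurableSet_Ioo fun s _ => ?_
    simp only [hΨ, inner_sum, real_inner_smul_right, smul_eq_mul]
  have hDb : |∑ l ∈ J, D l| ≤ C * ‖∑ l ∈ J, φ l‖ * (A + M) :=
    abs_deriv_integral_inner_le hF hA hM hΨc hΨB ht hsum
  have hdata₀ : ∑ l ∈ J, l * inner ℝ (u 0) (φ l) * (1 - N l t) ≤
      M₀ * (C * t ^ (1 - α) * ‖∑ l ∈ J, φ l‖) := by
    -- The eigenvalue is shared as l^(1/α) l^(1−1/α): the first factor is paid by u(0) ∈ V_{1/α},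
    -- the second by the decay of the kernel.
    have h1 : ∑ l ∈ J, l * inner ℝ (u 0) (φ l) * (1 - N l t) =
        inner ℝ (∑ l ∈ J, l ^ (1 / α) • E.eigenProj l (u 0))
          (∑ l ∈ J, (l ^ (1 - 1 / α) * (1 - N l t)) • φ l) := by
      rw [E.inner_sum_sum (fun l => (E.eigenspace l).smul_mem _ (E.eigenProj_mem l _))
        (fun l => (E.eigenspace l).smul_mem _ (hφ l))]
      refine Finset.sum_congr rfl fun l _ => ?_
      by_cases h0 : φ l = 0
      · rw [h0, smul_zero, inner_zero_right, inner_zero_right, mul_zero, zero_mul]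
      · rw [real_inner_smul_left, real_inner_smul_right, E.inner_eigenProj _ (hφ l)]
        have h2 : l ^ (1 / α) * l ^ (1 - 1 / α) = l := by
          rw [← Real.rpow_add (hpos l h0), add_sub_cancel, Real.rpow_one]
        linear_combination (-(inner ℝ (u 0) (φ l)) * (1 - N l t)) * h2
    rw [h1]
    refine (real_inner_le_norm _ _).trans (mul_le_mul (hM₀b J) ?_ (norm_nonneg _) hM₀)
    refine E.norm_sum_smul_le hφ J (by positivity) fun l hl => ?_
    have := ((hker l (hpos l hl)).2 t ht0).1
    rwa [abs_mul, abs_of_pos (Real.rpow_pos_of_pos (hpos l hl) _)]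
  have hdata₁ : ∑ l ∈ J, l * inner ℝ u₁ (φ l) * mlKernel α l 2 t ≤
      ‖u₁‖ * (C * t ^ (1 - α) * ‖∑ l ∈ J, φ l‖) := by
    have h1 : ∑ l ∈ J, l * inner ℝ u₁ (φ l) * mlKernel α l 2 t =
        inner ℝ u₁ (∑ l ∈ J, (l * mlKernel α l 2 t) • φ l) := by
      rw [inner_sum]
      refine Finset.sum_congr rfl fun l _ => ?_
      rw [real_inner_smul_right]
      ring
    rw [h1]
    refine (real_inner_le_norm _ _).trans ?_
    gcongr
    refine E.norm_sum_smul_le hφ J (by positivity) fun l hl => ?_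
    have := ((hker l (hpos l hl)).2 t ht0).2
    rwa [abs_mul, abs_of_pos (hpos l hl)]
  have hsplit : ∑ l ∈ J, l * inner ℝ (u t) (φ l) = ∑ l ∈ J, D l +
      ∑ l ∈ J, l * inner ℝ (u 0) (φ l) * (1 - N l t) +
      ∑ l ∈ J, l * inner ℝ u₁ (φ l) * mlKernel α l 2 t := by
    rw [← Finset.sum_add_distrib, ← Finset.sum_add_distrib]
    refine Finset.sum_congr rfl fun l _ => ?_
    simp only [hD]
    ring
  rw [hsplit]
  have h3 := (le_abs_self _).trans hDb
  calc _ ≤ C * ‖∑ l ∈ J, φ l‖ * (A + M) + M₀ * (C * t ^ (1 - α) * ‖∑ l ∈ J, φ l‖) +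
        ‖u₁‖ * (C * t ^ (1 - α) * ‖∑ l ∈ J, φ l‖) := add_le_add (add_le_add h3 hdata₀) hdata₁
    _ = _ := by ring

end OperatorBound

end DirichletForm

/-! ### Fractional derivatives in a Hilbert space -/

theorem HasFracDeriv.congr_ae {F : Type*} [NormedAddCommGroup F] [NormedSpace ℝ F] {α T : ℝ}
    {y z z' : ℝ → F} (h : HasFracDeriv α T y z) (hz : z =ᵐ[volume.restrict (Ioo 0 T)] z') :
    HasFracDeriv α T y z' := by
  refine ⟨h.1.congr hz, fun η h1 h2 h3 => (h.2 η h1 h2 h3).trans (integral_congr_ae ?_)⟩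
  filter_upwards [hz] with t ht
  rw [ht]

theorem gamma_inv_smul_integral_eq_causalConv {F : Type*} [NormedAddCommGroup F]
    [NormedSpace ℝ F] (α : ℝ) (R : ℝ → F) (t : ℝ) :
    (Real.Gamma (2 - α))⁻¹ • ∫ s in Ioo 0 t, (t - s) ^ (1 - α) • R s =
      causalConv (rlKernel (2 - α)) R t := by
  rw [← integral_smul]
  refine setIntegral_congr_fun measurableSet_Ioo fun s hs => ?_
  rw [rlKernel_of_pos (sub_pos.2 hs.2), show 2 - α - 1 = 1 - α by ring, smul_smul, div_eq_inv_mul]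

section InnerProduct

variable {H : Type*} [NormedAddCommGroup H] [InnerProductSpace ℝ H] [CompleteSpace H]

theorem inner_causalConv {β t : ℝ} (hβ : 0 < β) {R : ℝ → H} (hR : ContinuousOn R (Icc 0 t))
    (φ : H) : inner ℝ (causalConv (rlKernel β) R t) φ =
      causalConv (rlKernel β) (fun s => inner ℝ (R s) φ) t := by
  rcases le_or_gt t 0 with ht | ht
  · rw [causalConv_of_nonpos _ _ ht, causalConv_of_nonpos _ _ ht, inner_zero_left]
  obtain ⟨C, hC⟩ := isCompact_Icc.exists_bound_of_continuousOn hR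
  have h1 : IntegrableOn (fun s => rlKernel β (t - s)) (Ioo 0 t) := by
    have h2 := (intervalIntegrable_iff_integrableOn_Ioo_of_le ht.le).2 (integrableOn_rlKernel hβ t)
    have h3 := (h2.comp_sub_left t).symm
    rw [sub_zero, sub_self] at h3
    exact (intervalIntegrable_iff_integrableOn_Ioo_of_le ht.le).1 h3
  have h4 : IntegrableOn (fun s => rlKernel β (t - s) • R s) (Ioo 0 t) :=
    h1.smul_bdd C ((hR.mono Ioo_subset_Icc_self).aestronglyMeasurable measurableSet_Ioo)
      ((ae_restrict_mem measurableSet_Ioo).mono fun s hs => hC s (Ioo_subset_Icc_self hs))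
  rw [causalConv, real_inner_comm, ← integral_inner h4]
  refine setIntegral_congr_fun measurableSet_Ioo fun s _ => ?_
  simp only
  rw [real_inner_smul_right, real_inner_comm, smul_eq_mul]

/-- The fractional derivative of a function with values in a Hilbert space can be tested on a total
set of vectors. -/
theorem hasFracDeriv_of_inner {α T : ℝ} (hα2 : α < 2) (hT : 0 < T) {u d : ℝ → H}
    (hu : ContDiffOn ℝ 1 u (Icc 0 T)) (hd : IntegrableOn d (Ioo 0 T)) {S : Set H}
    (hS : ∀ g : H, (∀ φ ∈ S, inner ℝ g φ = 0) → g = 0)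
    (h : ∀ φ ∈ S, HasFracDeriv α T (fun t => inner ℝ (u t) φ) fun t => inner ℝ (d t) φ) :
    HasFracDeriv α T u d := by
  have hα0 : 0 < 2 - α := by linarith
  set R : ℝ → H := fun s => u s - u 0 - s • derivWithin u (Icc 0 T) 0 with hR
  have hRc : ContinuousOn R (Icc 0 T) :=
    (hu.continuousOn.sub continuousOn_const).sub (by fun_prop)
  have hcc : ContinuousOn (causalConv (rlKernel (2 - α)) R) (Icc 0 T) :=
    continuousOn_causalConv hT (integrableOn_rlKernel hα0 T) hRc (by simp [hR])
  have hud : DifferentiableWithinAt ℝ u (Icc 0 T) 0 :=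
    hu.differentiableOn one_ne_zero 0 ⟨le_rfl, hT.le⟩
  have hbdd : ∀ {η : ℝ → ℝ} {v : ℝ → H}, Continuous η → HasCompactSupport η →
      IntegrableOn v (Ioo 0 T) → IntegrableOn (fun t => η t • v t) (Ioo 0 T) := by
    intro η v hη hηc hv
    obtain ⟨C, hC⟩ := hηc.exists_bound_of_continuous hη
    exact hv.bdd_smul C hη.aestronglyMeasurable (Eventually.of_forall hC)
  refine ⟨hd, fun η h1 h2 h3 => ?_⟩
  have hη1 : ContDiff ℝ ∞ (deriv η) := (contDiff_infty_iff_deriv.1 h1).2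
  have hη2 : Continuous (deriv (deriv η)) := (contDiff_infty_iff_deriv.1 hη1).2.continuous
  have h0 : ∀ t, (Real.Gamma (2 - α))⁻¹ • ∫ s in Ioo 0 t, (t - s) ^ (1 - α) •
      (u s - u 0 - s • derivWithin u (Icc 0 T) 0) = causalConv (rlKernel (2 - α)) R t :=
    gamma_inv_smul_integral_eq_causalConv α R
  simp only [h0]
  rw [← sub_eq_zero]
  refine hS _ fun φ hφ => ?_
  have h4 := (h φ hφ).2 η h1 h2 h3
  rw [derivWithin_inner_const hud (uniqueDiffOn_Icc hT 0 ⟨le_rfl, hT.le⟩)] at h4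
  have h5 : (fun s => inner ℝ (R s) φ) = fun s => inner ℝ (u s) φ - inner ℝ (u 0) φ -
      s • inner ℝ (derivWithin u (Icc 0 T) 0) φ := by
    funext s
    simp only [hR, inner_sub_left, real_inner_smul_left, smul_eq_mul]
  simp only [gamma_inv_smul_integral_eq_causalConv, ← h5] at h4
  rw [inner_sub_left, sub_eq_zero, real_inner_comm, real_inner_comm φ,
    ← integral_inner (hbdd hη2 h2.deriv.deriv
      (hcc.integrableOn_Icc.mono_set Ioo_subset_Icc_self)),
    ← integral_inner (hbdd h1.continuous h2 hd)]
  refine Eq.trans ?_ (h4.trans ?_)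
  · refine setIntegral_congr_fun measurableSet_Ioo fun t ht => ?_
    rw [real_inner_smul_right, real_inner_comm,
      inner_causalConv hα0 (hRc.mono (Icc_subset_Icc_right ht.2.le)), smul_eq_mul]
  · refine setIntegral_congr_fun measurableSet_Ioo fun t _ => ?_
    rw [real_inner_smul_right, real_inner_comm, smul_eq_mul]

end InnerProduct

/-! ### Weak solutions are strong -/

namespace DirichletForm

variable {X : Type*} [MeasurableSpace X] {m : Measure X} (E : DirichletForm m)

/-- A is unbounded, but u = (1 + A)⁻¹(u + w) with a continuous injective resolvent. On a separable
complete space such a map is a measurable embedding (Lusin–Souslin), so measurability passes from u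
back to u + w. -/
theorem aestronglyMeasurable_op [SecondCountableTopology (Lp ℝ 2 m)] {μ : Measure ℝ}
    {u w : ℝ → Lp ℝ 2 m} (hu : AEStronglyMeasurable u μ)
    (hw : ∀ᵐ t ∂μ, ∃ hd : u t ∈ E.op.domain, E.op ⟨u t, hd⟩ = w t) :
    AEStronglyMeasurable w μ := by
  let _ : MeasurableSpace (Lp ℝ 2 m) := borel (Lp ℝ 2 m)
  have : BorelSpace (Lp ℝ 2 m) := ⟨rfl⟩
  have h1 : AEMeasurable (E.resolvent ∘ fun t => u t + w t) μ := by
    refine hu.aemeasurable.congr ?_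
    filter_upwards [hw] with t ht
    obtain ⟨hd, he⟩ := ht
    rw [Function.comp_apply, ← he, E.resolvent_add_op hd]
  have h2 := ((E.resolvent.continuous.measurableEmbedding
    E.resolvent_injective).aemeasurable_comp_iff.1 h1).aestronglyMeasurable
  refine (h2.sub hu).congr (Eventually.of_forall fun t => ?_)
  rw [Pi.sub_apply, add_sub_cancel_left]

/-- Once A u is integrable, F − Au is the only candidate for 𝔻^α u; the scalar equations identify it
against each eigenvector, and totality of eigenvectors finishes. -/
theorem IsWeakSolution.isStrongSolution [SecondCountableTopology (Lp ℝ 2 m)] {qA : ℝ}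
    (hE : E.StandingAssumptions qA) {α r : ℝ} (hα : 1 < α) (hα2 : α < 2) (hr : 1 < r)
    {f : ℝ → ℝ} (hf : HasGrowth f r) {q : ℝ≥0∞} (hq : 1 ≤ q) {u₀ u₁ : Lp ℝ 2 m} {T : ℝ}
    (hT : 0 < T) {u : ℝ → Lp ℝ 2 m} (hu : E.IsWeakSolution α q f u₀ u₁ T u)
    (hbound : mixedNorm (q * ENNReal.ofReal (r - 1)) ⊤ T u < ⊤) :
    E.IsStrongSolution α q f u₀ u₁ T u := by
  obtain ⟨hFi, hFf, b, G, hb, hb0, hG, hinc⟩ :=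
    exists_weight_nemytskii hf hr hu.contDiffOn hq hbound
  have hmode := fun l φ (hφ : φ ∈ E.eigenspace l) => hu.modal_equation E hFf hφ
  have hu0 : u 0 ∈ E.powDomain (1 / α) := by
    obtain ⟨v, -, hv⟩ := hu.continuousInto
    rw [← hv 0 ⟨le_rfl, hT.le⟩]
    exact (v 0).2
  obtain ⟨C₁, C₂, hop⟩ := E.exists_op_bound hE hα hα2 hT hu.contDiffOn hu0 hFi hb hb0 hG hinc hmode
  choose! hd hdb hdi using hop
  classical
  set w : ℝ → Lp ℝ 2 m := fun t => if h : u t ∈ E.op.domain then E.op ⟨u t, h⟩ else 0 with hw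
  have hwt : ∀ t ∈ Ioo 0 T, ∀ h : u t ∈ E.op.domain, E.op ⟨u t, h⟩ = w t := fun t _ h => by
    simp only [hw, dif_pos h]
  have hwop : ∀ᵐ t ∂(volume.restrict (Ioo 0 T)), ∃ h : u t ∈ E.op.domain, E.op ⟨u t, h⟩ = w t := by
    filter_upwards [ae_restrict_mem measurableSet_Ioo] with t ht
    exact ⟨hd t ht, hwt t ht _⟩
  have hwi : IntegrableOn w (Ioo 0 T) := by
    -- Integrable at 0 because α < 2 gives 1 − α > −1.
    have h1 : IntegrableOn (fun t : ℝ => C₁ * t ^ (1 - α) + C₂) (Ioo 0 T) :=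
      (((intervalIntegral.integrableOn_Ioo_rpow_iff hT).2 (by linarith)).const_mul C₁).add
        (integrableOn_const (by simp))
    refine Integrable.mono' h1 (E.aestronglyMeasurable_op
      ((hu.contDiffOn.continuousOn.mono Ioo_subset_Icc_self).aestronglyMeasurable
        measurableSet_Ioo) hwop) ?_
    filter_upwards [ae_restrict_mem measurableSet_Ioo] with t ht
    rw [← hwt t ht (hd t ht)]
    exact hdb t ht
  have hdint : IntegrableOn (fun t => nemytskii f (u t) - w t) (Ioo 0 T) := hFi.sub hwi
  refine ⟨hu, fun t => nemytskii f (u t) - w t, w, ⟨?_, hdint⟩, ⟨hwi, hwop⟩, ?_⟩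
  · refine hasFracDeriv_of_inner hα2 hT hu.contDiffOn hdint
      (S := {φ | ∃ l, φ ∈ E.eigenspace l}) (fun g hg => E.eq_zero_of_inner_eigenspace hE
        fun l φ hφ => hg φ ⟨l, hφ⟩) ?_
    rintro φ ⟨l, hφ⟩
    obtain ⟨z, hz, hzeq⟩ := hmode l φ hφ
    refine hz.congr_ae ?_
    filter_upwards [hzeq, ae_restrict_mem measurableSet_Ioo] with t h1 ht
    rw [inner_sub_left, ← h1, ← hwt t ht (hd t ht), hdi t ht l φ hφ, add_sub_cancel_right]
  · filter_upwards [hFf] with t ht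
    filter_upwards [ht, Lp.coeFn_sub (nemytskii f (u t)) (w t)] with x h1 h2
    rw [h2, Pi.sub_apply, sub_add_cancel, h1]

end DirichletForm

end

theorem mainTheorem7 {X : Type*} [MetricSpace X] [MeasurableSpace X] [BorelSpace X]
    (hX : TotallyBounded (Set.univ : Set X))
    (m : MeasureTheory.Measure X) [MeasureTheory.IsFiniteMeasure m] [m.Regular]
    [m.IsOpenPosMeasure]
    (E : DirichletForm m) (qA : ℝ) (hE : E.StandingAssumptions qA)
    (α r : ℝ) (hα : 1 < α ∧ α < 2) (hcase : IsCriticalGrowth qA α r)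
    (f : ℝ → ℝ) (hf : HasGrowth f r)
    (p : ℝ) (hp : 1 ≤ p ∧ p < 1 / (2 - α))
    (q : ENNReal) (hq : (ENNReal.ofReal p)⁻¹ + q⁻¹ = 1)
    (u₀ u₁ : MeasureTheory.Lp ℝ 2 m) (T : ℝ) (hT : 0 < T)
    (u : ℝ → MeasureTheory.Lp ℝ 2 m)
    (hu : E.IsWeakSolution α q f u₀ u₁ T u)
    (hbound : mixedNorm (q * ENNReal.ofReal (r - 1)) ⊤ T u < ⊤) :
    E.IsStrongSolution α q f u₀ u₁ T u := by
  have hr : 1 < r := one_lt_of_isCriticalGrowth hE.one_lt hα.1 hcase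
  have hq1 : 1 ≤ q := by
    rw [← ENNReal.inv_le_one, ← hq]
    exact le_add_self
  -- Total boundedness makes X second countable and hence L²(X) separable, as required for the
  -- measurability of A u.
  have hsep : TopologicalSpace.IsSeparable (Set.univ : Set X) := hX.isSeparable
  have : TopologicalSpace.SeparableSpace X := TopologicalSpace.isSeparable_univ_iff.1 hsep
  have : SecondCountableTopology X := UniformSpace.secondCountable_of_separable X
  have : Fact ((2 : ENNReal) ≠ ⊤) := ⟨ENNReal.ofNat_ne_top⟩
  exact hu.isStrongSolution E hE hα.1 hα.2 hr hf hq1 hT hbound
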